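/- Let $n\ge 2$ and let $\mathfrak g=\mathfrak{so}_{2n+1}(\mathbb C)$ be the simple Lie algebra of type $\mathsf B_n$, with Cartan subalgebra $\mathfrak h$ having a basis $h_1,\dots,h_n$ whose dual basis $\varepsilon_1,\dots,\varepsilon_n$ of $\mathfrak h^*$ is such that the positive roots are $\varepsilon_i$ $(1\le i\le n)$ and $\varepsilon_i\pm\varepsilon_j$ $(1\le i<j\le n)$. Put $\mathbf I_n=\{\pm1,\dots,\pm n\}$ and $\varepsilon_{-a}=-\varepsilon_a$. Let $K$ be a field of characteristic $0$ and $q\in K$ nonzero (for instance $q$ an indeterminate and $K=\mathbb C(q)$). For a family of variables $L_a$ $(a\in\mathbf I_n)$ with $L_{-a}=L_a^{-1}$ and an integer $k\ge 0$ put \[ G_{n,k}=q^{-k}+\sum_{a\in\mathbf I_n}\frac{qL_a-q^{-1}L_a^{-1}+q-q^{-1}}{L_a-L_a^{-1}}\,L_a^k\prod_{b\in\mathbf I_n\setminus\{\pm a\}}\frac{qL_a-q^{-1}L_b}{L_a-L_b}, \] and let $\mathbf{Ch}\,G_{n,k}$ be the element obtained from $G_{n,k}$ by replacing every $L_a$ with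 the formal exponential $e^{\varepsilon_a}$; it lies in the field of fractions of the group algebra over $K$ of the lattice $\bigoplus_i\mathbb Z\varepsilon_i$. For $0\le r\le 2n-1$ let $\bar r=\min\{r,2n-1-r\}$ and \[ \lambda_k^r=(k-r)\varepsilon_1+\mu_{\bar r},\qquad \mu_{\bar r}=\varepsilon_2+\cdots+\varepsilon_{\bar r+1}\quad(\mu_0=0). \] When $k-r\ge1$, this is a dominant integral weight; let $\chi(\lambda_k^r)=\sum_\mu \dim L(\lambda_k^r)_\mu\, e^\mu$ be the character of the simple $\mathfrak g$-module $L(\lambda_k^r)$ with highest weight $\lambda_k^r$. Then for all integers $k\ge0$, \[ \mathbf{Ch}\,G_{n,k}= \begin{cases} 1+\displaystyle\sum_{r=0}^{2n-1}q^{2n-2r-1}, & k=0,\\[2ex] \displaystyle\sum_{r=0}^{k-1}(-1)^rq^{2n-2r-1}\chi(\lambda_k^r), & 1\le k\le 2n-1 \text{ and } k \text{ odd},\\[2ex] q^{-k}+\displaystyle\sum_{r=0}^{\min\{k-1,2n-1\}}(-1)^rq^{2n-2r-1}\chi(\lambda_k^r), & \text{otherwise.} \end{cases} \] -/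

import Mathlib

noncomputable section

namespace TypeB

attribute [local instance 100] LieRing.ofAssociativeRing

/-! ### The simple Lie algebra of type `B_n` and its irreducible characters

A weight `∑ i, μ i • ε_i` in the lattice spanned by the `ε_i` is written as its coordinate vector
`μ : Fin n → ℤ`. The index `i : Fin n` stands for the traditional index `i + 1`, so `ε_1`
has its `1` at the index `0 : Fin n`. -/

/-- The Lie algebra `𝔰𝔬_{2n+1}(ℂ)` (type `B_n`), as the matrices that are skew-adjoint for the
symmetric form `2 x₀² + 2 ∑ xᵢ xᵢ'` on `ℂ^(1 + n + n)`. -/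
abbrev Lie (n : ℕ) := LieAlgebra.Orthogonal.typeB (Fin n) ℂ

/-- The diagonal matrix of `h_i`: it has entry `1` at the `i`-th place of the first block of
length `n`, entry `-1` at the `i`-th place of the second one, and `0` elsewhere. -/
def cartanMatrix (n : ℕ) (i : Fin n) : Matrix (Unit ⊕ (Fin n ⊕ Fin n)) (Unit ⊕ (Fin n ⊕ Fin n)) ℂ :=
  Matrix.diagonal (Sum.elim (fun _ => 0) (Sum.elim (Pi.single i 1) (-Pi.single i 1)))

theorem cartanMatrix_mem (n : ℕ) (i : Fin n) : cartanMatrix n i ∈ Lie n := by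
  rw [Lie, LieAlgebra.Orthogonal.typeB, mem_skewAdjointMatricesLieSubalgebra,
    mem_skewAdjointMatricesSubmodule]
  unfold Matrix.IsSkewAdjoint Matrix.IsAdjointPair
  ext a b
  rcases a with a | a | a <;> rcases b with b | b | b <;>
    simp [cartanMatrix, LieAlgebra.Orthogonal.JB, LieAlgebra.Orthogonal.JD, Matrix.one_apply] <;>
    split_ifs with h <;> simp [h]

/-- The basis `h_1, …, h_n` of the diagonal Cartan subalgebra, dual to `ε_1, …, ε_n`. -/
def cartan (n : ℕ) (i : Fin n) : Lie n := ⟨cartanMatrix n i, cartanMatrix_mem n i⟩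

/-- The weight `ε_i`. -/
def eps {n : ℕ} (i : Fin n) : Fin n → ℤ := Pi.single i 1

/-- The positive roots `ε_i` and `ε_i ± ε_j` with `i < j`. -/
def posRoots (n : ℕ) : Set (Fin n → ℤ) :=
  {α | (∃ i, α = eps i) ∨ ∃ i j, i < j ∧ (α = eps i + eps j ∨ α = eps i - eps j)}

/-- The positive root vectors: `x` with `[h, x] = α(h) x` for all `h` in the Cartan subalgebra,
for some positive root `α`. -/
def posRootVectors (n : ℕ) : Set (Lie n) :=
  {x | ∃ α ∈ posRoots n, ∀ i, ⁅cartan n i, x⁆ = (α i : ℂ) • x}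

/-- The universal enveloping algebra of the Lie algebra of type `B_n`. -/
abbrev Env (n : ℕ) := UniversalEnvelopingAlgebra ℂ (Lie n)

/-- The canonical map from the Lie algebra to its enveloping algebra. -/
def toEnv (n : ℕ) (x : Lie n) : Env n := UniversalEnvelopingAlgebra.ι ℂ x

/-- The left ideal generated by the positive root vectors and the elements `h - lam(h)`. -/
def vermaIdeal {n : ℕ} (lam : Fin n → ℤ) : Submodule (Env n) (Env n) :=
  Submodule.span (Env n)
    (toEnv n '' posRootVectors n ∪
      Set.range fun i => toEnv n (cartan n i) - algebraMap ℂ (Env n) (lam i : ℂ))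

/-- The Verma module `M(lam)`. -/
abbrev Verma {n : ℕ} (lam : Fin n → ℤ) := Env n ⧸ vermaIdeal lam

/-- The sum of all proper submodules of the Verma module, which is its largest proper
submodule. -/
def vermaRadical {n : ℕ} (lam : Fin n → ℤ) : Submodule (Env n) (Verma lam) :=
  sSup {N | N ≠ ⊤}

/-- The simple module `L(lam)` with highest weight `lam`. -/
abbrev Simple {n : ℕ} (lam : Fin n → ℤ) := Verma lam ⧸ vermaRadical lam

/-- The weight space `L(lam)_μ`. -/
def weightSpace {n : ℕ} (lam μ : Fin n → ℤ) : Submodule ℂ (Simple lam) where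
  carrier := {v | ∀ i, toEnv n (cartan n i) • v = (μ i : ℂ) • v}
  zero_mem' := by intro i; rw [smul_zero, smul_zero]
  add_mem' := by intro a b ha hb i; rw [smul_add, smul_add, ha i, hb i]
  smul_mem' := by intro c a ha i; rw [smul_comm, ha i, smul_comm]

/-! ### Formal exponentials -/

/-- The fraction field of the group algebra over `K` of the lattice spanned by the `ε_i`. -/
abbrev CharField (K : Type*) [Field K] (n : ℕ) := FractionRing (AddMonoidAlgebra K (Fin n → ℤ))

section

variable {K : Type*} [Field K] {n : ℕ}

/-- The formal exponential `e^μ`. -/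
def fexp (K : Type*) [Field K] {n : ℕ} (μ : Fin n → ℤ) : CharField K n :=
  algebraMap (AddMonoidAlgebra K (Fin n → ℤ)) (CharField K n) (AddMonoidAlgebra.single μ 1)

/-- A scalar of `K`, as a constant. -/
def const (n : ℕ) (c : K) : CharField K n := algebraMap K (CharField K n) c

/-- The formal character `χ(lam) = ∑_μ dim L(lam)_μ e^μ`. All weights of `L(lam)` lie in `lam` plus
the root lattice, which is the lattice spanned by the `ε_i`. -/
def chi (K : Type*) [Field K] {n : ℕ} (lam : Fin n → ℤ) : CharField K n :=
  ∑ᶠ μ : Fin n → ℤ, (Module.finrank ℂ (weightSpace lam μ) : CharField K n) * fexp K μ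

/-- The index set `{±1, …, ±n}`, an index `± i` being the pair `(i, ±1)`. -/
abbrev Idx (n : ℕ) := Fin n × ℤˣ

/-- `P_{n,a}` as an expression in `q` and a family `L_a`; the product is over `b ≠ ± a`. -/
def P {F : Type*} [Field F] (q : F) (L : Idx n → F) (a : Idx n) : F :=
  ∏ b : Idx n with b.1 ≠ a.1, (q * L a - q⁻¹ * L b) / (L a - L b)

/-- `G_{n,k}` of type `B_n` as an expression in `q` and a family `L_a`. -/
def G {F : Type*} [Field F] (q : F) (L : Idx n → F) (k : ℕ) : F :=
  (q ^ k)⁻¹ +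
    ∑ a : Idx n, (q * L a - q⁻¹ * (L a)⁻¹ + q - q⁻¹) / (L a - (L a)⁻¹) * L a ^ k * P q L a

/-- `Ch G_{n,k}`: the expression `G_{n,k}` with `e^{ε_a}` in place of `L_a`, where
`ε_{-a} = -ε_a`. -/
def ChG (n : ℕ) (q : K) (k : ℕ) : CharField K n :=
  G (const n q) (fun a : Idx n => fexp K ((a.2 : ℤ) • eps a.1)) k

end

/-- `r̄ = min {r, 2n - 1 - r}`, for `0 ≤ r ≤ 2n - 1`. -/
def rbar (n r : ℕ) : ℕ := min r (2 * n - 1 - r)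

/-- The hook weight `λ_k^r = (k - r) ε_1 + (ε_2 + ⋯ + ε_{r̄+1})`. -/
def hook (n k r : ℕ) : Fin n → ℤ := fun i =>
  if (i : ℕ) = 0 then (k : ℤ) - r else if (i : ℕ) ≤ rbar n r then 1 else 0

end TypeB

end

/-! Everything is multiplied by the Weyl denominator A, the alternant `alt` with exponents `rho n`.
Exponents are shifted by 1/2 throughout, so that ρ becomes (n, …, 1) and the sign change of a
coordinate becomes l ↦ 1 - l.

By the product formula for A (`alt_rho`), the coefficient of L_a^k in G is, up to a factor q⁻¹, the
quotient by A of the determinant in which the variable y = L_a is replaced by q²y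
(`alt_cons_rho_mul_sq`). Expanding this shifted determinant along the row of q²y gives 2n powers of
y, indexed by r, whose coefficients are minors with one entry of ρ omitted (`alt_cons_rho_expand`).
The sum over a is then a Laplace expansion along a column, so A (G - q^(-k)) is the sum over r of
(-1)^r q^(2n-2r-1) times the alternant with exponent k - r + n followed by (n, …, 1) without n - r̄
(`alt_rho_mul_G`).

For r < k these exponents are λ_k^r + ρ, and the alternant is A χ(λ_k^r). For r ≥ k two columns
agree up to sign and the alternant vanishes, unless k = 0 or 2r = k + 2n - 1, where it is ±A
(`alt_straighten`). In the last case the contribution is -q^(-k), which cancels the isolated summand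
of G; this happens exactly for odd k ≤ 2n - 1.

The remaining input is the Weyl character formula for L(λ), constructed as a quotient of a Verma
module (`alt_rho_mul_chi`). Exterior powers and tensor products of the vector representation supply
finite-dimensional representations with highest weight vectors of the hook weights; these show that
the Verma module is nonzero and that L(λ) is finite-dimensional (`finiteDimensional_simple`). The
Casimir operator acts on L(λ) by a scalar, and formal traces turn this into an eigenvalue equation
for A·ch under a shifted Laplacian (`laplacian_alt_rho_mul_fchar`), so all exponents of A·ch lie on
one sphere. Representation theory of sl₂ makes ch invariant, hence A·ch antisymmetric, under the
Weyl group. The exponents of A·ch lie below λ + ρ; a strictly dominant one on the sphere of λ + ρ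
must be λ + ρ itself, and its coefficient is 1. Antisymmetric elements are determined by their
strictly dominant coefficients (`eq_zero_of_antisymm`), so A·ch is the alternant of λ + ρ. -/

noncomputable section

namespace TypeB

open Polynomial

/-! ### Alternants of type `B` -/

section Alternant

variable {R : Type*} [CommRing R] {n : ℕ}

/-- The alternant `det (x_i ^ l_j - x_i ^ (1 - l_j))`. Up to the factor `∏ x_i ^ (1/2)` it is the
antisymmetrization of the monomial with exponents `l_j - 1/2` over the Weyl group of type `B_n`. -/
def alt (x : Fin n → Rˣ) (l : Fin n → ℤ) : R :=
  Matrix.det (Matrix.of fun i j => ((x i ^ l j : Rˣ) : R) - ((x i ^ (1 - l j) : Rˣ) : R))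

/-- The vector `(n, n - 1, …, 1)`, which is the half sum of the positive roots with `1/2` added to
each coordinate. -/
def rho (n : ℕ) (j : Fin n) : ℤ := (n : ℤ) - (j : ℕ)

theorem map_alt {S : Type*} [CommRing S] (f : R →+* S) (x : Fin n → Rˣ) (l : Fin n → ℤ) :
    f (alt x l) = alt (fun i => Units.map (f : R →* S) (x i)) l := by
  unfold alt
  rw [RingHom.map_det]
  congr 1
  ext i j
  simp only [RingHom.mapMatrix_apply, Matrix.map_apply, Matrix.of_apply, map_sub]
  rw [← map_zpow, ← map_zpow]
  rfl

theorem alt_comp_perm (x : Fin n → Rˣ) (l : Fin n → ℤ) (σ : Equiv.Perm (Fin n)) :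
    alt x (l ∘ σ) = ((Equiv.Perm.sign σ : ℤ) : R) * alt x l := by
  unfold alt
  rw [← Matrix.det_permute']
  rfl

theorem alt_perm_comp (x : Fin n → Rˣ) (l : Fin n → ℤ) (σ : Equiv.Perm (Fin n)) :
    alt (x ∘ σ) l = ((Equiv.Perm.sign σ : ℤ) : R) * alt x l := by
  unfold alt
  rw [← Matrix.det_permute]
  rfl

theorem alt_eq_zero (x : Fin n → Rˣ) (l : Fin n → ℤ) {i j : Fin n} (hij : i ≠ j) (h : l i = l j) :
    alt x l = 0 := by
  unfold alt
  exact Matrix.det_zero_of_column_eq hij fun k => by simp [h]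

theorem alt_update (x : Fin n → Rˣ) (l : Fin n → ℤ) (j : Fin n) :
    alt x (Function.update l j (1 - l j)) = -alt x l := by
  unfold alt
  have : (Matrix.of fun i k => ((x i ^ (Function.update l j (1 - l j)) k : Rˣ) : R) -
      ((x i ^ (1 - (Function.update l j (1 - l j)) k) : Rˣ) : R)) =
      Matrix.updateCol (Matrix.of fun i k => ((x i ^ l k : Rˣ) : R) - ((x i ^ (1 - l k) : Rˣ) : R))
        j ((-1 : R) • fun i => ((x i ^ l j : Rˣ) : R) - ((x i ^ (1 - l j) : Rˣ) : R)) := by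
    ext i k
    by_cases hk : k = j
    · subst hk; simp
    · simp [hk]
  rw [this, Matrix.det_updateCol_smul]
  have h2 : ∀ A : Matrix (Fin n) (Fin n) R, A.updateCol j (fun i => A i j) = A := by
    intro A; exact Matrix.updateCol_eq_self A j
  have h3 := h2 (Matrix.of fun i k => ((x i ^ l k : Rˣ) : R) - ((x i ^ (1 - l k) : Rˣ) : R))
  simp only [Matrix.of_apply] at h3
  rw [h3]; ring

/-- Inverting x_i exchanges the two terms of every entry of row i up to the factor x_i⁻¹. This
factor is the price of clearing half-integral exponents. -/
theorem alt_update_inv (x : Fin n → Rˣ) (l : Fin n → ℤ) (i : Fin n) :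
    alt (Function.update x i (x i)⁻¹) l = -((x i)⁻¹ : Rˣ) * alt x l := by
  unfold alt
  have : (Matrix.of fun a k => ((Function.update x i (x i)⁻¹ a ^ l k : Rˣ) : R) -
      ((Function.update x i (x i)⁻¹ a ^ (1 - l k) : Rˣ) : R)) =
      Matrix.updateRow (Matrix.of fun a k => ((x a ^ l k : Rˣ) : R) - ((x a ^ (1 - l k) : Rˣ) : R))
        i ((-((x i)⁻¹ : Rˣ) : R) •
          fun k => ((x i ^ l k : Rˣ) : R) - ((x i ^ (1 - l k) : Rˣ) : R)) := by
    ext a k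
    by_cases ha : a = i
    · subst ha
      have e1 : ((x a)⁻¹ ^ l k : Rˣ) = (x a)⁻¹ * x a ^ (1 - l k) := by
        rw [zpow_sub, zpow_one, inv_zpow]; group
      have e2 : ((x a)⁻¹ ^ (1 - l k) : Rˣ) = (x a)⁻¹ * x a ^ (l k) := by
        rw [inv_zpow, ← zpow_neg, neg_sub, zpow_sub, zpow_one, mul_comm]
      simp only [Matrix.of_apply, Function.update_self, Matrix.updateRow_self, Pi.smul_apply,
        smul_eq_mul, e1, e2, Units.val_mul]
      ring
    · simp [ha]
  rw [this, Matrix.det_updateRow_smul]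
  have h3 := Matrix.updateRow_eq_self
    (Matrix.of fun a k => ((x a ^ l k : Rˣ) : R) - ((x a ^ (1 - l k) : Rˣ) : R)) i
  have h4 : (Matrix.of fun a k => ((x a ^ l k : Rˣ) : R) - ((x a ^ (1 - l k) : Rˣ) : R)) i =
      fun k => ((x i ^ l k : Rˣ) : R) - ((x i ^ (1 - l k) : Rˣ) : R) := rfl
  rw [h4] at h3
  rw [h3]

/-- The polynomials with `(x - 1) p_l (x + x⁻¹) = x ^ (l + 1) - x ^ (-l)`. -/
def altPoly (R : Type*) [CommRing R] : ℕ → R[X]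
  | 0 => 1
  | 1 => X + 1
  | (l + 2) => X * altPoly R (l + 1) - altPoly R l

theorem altPoly_monic [Nontrivial R] (l : ℕ) :
    (altPoly R l).Monic ∧ (altPoly R l).natDegree = l := by
  induction l using Nat.strong_induction_on with
  | _ l ih =>
    match l with
    | 0 => simp [altPoly]
    | 1 =>
      rw [altPoly]
      exact ⟨by simpa using monic_X_add_C (1 : R), by simpa using natDegree_X_add_C (1 : R)⟩
    | l + 2 =>
      obtain ⟨m1, d1⟩ := ih (l + 1) (by omega)
      obtain ⟨m0, d0⟩ := ih l (by omega)
      rw [altPoly]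
      have hm : (X * altPoly R (l + 1)).Monic := monic_X.mul m1
      have hd : (X * altPoly R (l + 1)).natDegree = l + 2 := by
        rw [natDegree_X_mul m1.ne_zero, d1]
      have hlt : (altPoly R l).degree < (X * altPoly R (l + 1)).degree := by
        rw [degree_eq_natDegree m0.ne_zero, degree_eq_natDegree hm.ne_zero, d0, hd]
        exact_mod_cast (by omega : l < l + 2)
      refine ⟨hm.sub_of_left hlt, ?_⟩
      rw [natDegree_eq_of_degree_eq (degree_sub_eq_left_of_degree_lt hlt), hd]

/-- Both sides satisfy the Chebyshev recurrence u_{l+2} = (x + x⁻¹) u_{l+1} - u_l with the same two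
initial values. -/
theorem altPoly_eval (x : Rˣ) (l : ℕ) :
    ((x : R) - 1) * (altPoly R l).eval ((x : R) + (x⁻¹ : Rˣ)) =
      ((x ^ ((l : ℤ) + 1) : Rˣ) : R) - ((x ^ (-(l : ℤ)) : Rˣ) : R) := by
  have hx : (x : R) * (x⁻¹ : Rˣ) = 1 := by simp
  induction l using Nat.strong_induction_on with
  | _ l ih =>
    match l with
    | 0 => simp [altPoly]
    | 1 =>
      simp only [altPoly, eval_add, eval_X, eval_one]
      have : ((x ^ (((1 : ℕ) : ℤ) + 1) : Rˣ) : R) = (x : R) ^ 2 := by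
        rw [← Units.val_pow_eq_pow_val]; norm_cast
      rw [this]
      simp only [Nat.cast_one, zpow_neg, zpow_one]
      linear_combination hx
    | l + 2 =>
      have h1 := ih (l + 1) (by omega)
      have h0 := ih l (by omega)
      rw [altPoly, eval_sub, eval_mul, eval_X]
      have e1 : x ^ (((l + 2 : ℕ) : ℤ) + 1) = x * x * x ^ ((l : ℤ) + 1) := by
        push_cast; rw [← pow_two, ← zpow_natCast, ← zpow_add]; congr 1; push_cast; ring
      have e2 : x ^ (-((l + 2 : ℕ) : ℤ)) = x⁻¹ * x⁻¹ * x ^ (-(l : ℤ)) := by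
        push_cast; rw [← pow_two, ← zpow_natCast, ← zpow_neg_one, ← zpow_mul, ← zpow_add]
        congr 1; push_cast; ring
      have e3 : x ^ (((l + 1 : ℕ) : ℤ) + 1) = x * x ^ ((l : ℤ) + 1) := by
        push_cast; rw [← zpow_one_add]; congr 1; ring
      have e4 : x ^ (-((l + 1 : ℕ) : ℤ)) = x⁻¹ * x ^ (-(l : ℤ)) := by
        push_cast; rw [← zpow_neg_one, ← zpow_add]; congr 1; ring
      rw [e3, e4] at h1
      rw [e1, e2]
      simp only [Units.val_mul] at h1 ⊢
      linear_combination ((x : R) + (x⁻¹ : Rˣ)) * h1 - h0 +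
        (((x ^ ((l : ℤ) + 1) : Rˣ) : R) - ((x ^ (-(l : ℤ)) : Rˣ) : R)) * hx

/-- The Weyl denominator as a Vandermonde determinant. -/
theorem alt_rho [Nontrivial R] (x : Fin n → Rˣ) :
    alt x (rho n) = ((Equiv.Perm.sign (Fin.revPerm : Equiv.Perm (Fin n)) : ℤ) : R) *
      ((∏ i, ((x i : R) - 1)) * (Matrix.vandermonde fun i => (x i : R) + ((x i)⁻¹ : Rˣ)).det) := by
  rw [Matrix.det_eval_matrixOfPolynomials_eq_det_vandermonde _ (fun j : Fin n => altPoly R j)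
    (fun j => (altPoly_monic _).2) (fun j => (altPoly_monic _).1), ← Matrix.det_mul_column]
  -- `rho` decreases along the columns while the degrees of `altPoly` increase, hence the reversal
  -- and its sign.
  have : rho n = (fun j : Fin n => ((j : ℕ) : ℤ) + 1) ∘ Fin.revPerm := by
    ext j
    simp only [rho, Function.comp, Fin.revPerm_apply, Fin.val_rev]
    omega
  rw [this, alt_comp_perm]
  unfold alt
  congr 2
  ext i j
  simp only [Matrix.of_apply, altPoly_eval]
  congr 3
  ring

/-- Laplace expansion of an alternant along its first column. -/
theorem alt_cons_exponent (x : Fin (n + 1) → Rˣ) (c : ℤ) (l : Fin n → ℤ) :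
    alt x (Fin.cons c l) = ∑ i : Fin (n + 1), (-1) ^ (i : ℕ) *
      (((x i ^ c : Rˣ) : R) - ((x i ^ (1 - c) : Rˣ) : R)) * alt (x ∘ i.succAbove) l := by
  unfold alt
  rw [Matrix.det_succ_column_zero]
  refine Finset.sum_congr rfl fun i _ => ?_
  simp only [Matrix.of_apply, Fin.cons_zero]
  congr 2

/-- Laplace expansion of the Weyl denominator along a row. -/
theorem alt_rho_row (x : Fin (n + 1) → Rˣ) (i : Fin (n + 1)) :
    alt x (rho (n + 1)) = (-1) ^ (i : ℕ) * ∑ j : Fin (n + 1), (-1) ^ (j : ℕ) *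
      (((x i ^ rho (n + 1) j : Rˣ) : R) - ((x i ^ (1 - rho (n + 1) j) : Rˣ) : R)) *
        alt (x ∘ i.succAbove) (rho (n + 1) ∘ j.succAbove) := by
  unfold alt
  rw [Matrix.det_succ_row _ i, Finset.mul_sum]
  refine Finset.sum_congr rfl fun j _ => ?_
  rw [pow_add]
  simp only [Matrix.of_apply, ← mul_assoc]
  congr 2

/-- The constant collects the Vandermonde factors without y. Having it independent of y makes the
ratio of the values at q²y and at y explicit. -/
theorem alt_cons_rho [Nontrivial R] (x : Fin n → Rˣ) :
    ∃ c : R, ∀ y : Rˣ, alt (Fin.cons y x) (rho (n + 1)) =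
      c * (((y : R) - 1) *
        ∏ j, (((y : R) + (y⁻¹ : Rˣ)) - ((x j : R) + ((x j)⁻¹ : Rˣ)))) := by
  refine ⟨((Equiv.Perm.sign (Fin.revPerm : Equiv.Perm (Fin (n + 1))) : ℤ) : R) *
    ((∏ i, ((x i : R) - 1)) * (-1) ^ n *
      (Matrix.vandermonde fun i => (x i : R) + ((x i)⁻¹ : Rˣ)).det), fun y => ?_⟩
  rw [alt_rho, Matrix.det_vandermonde, Matrix.det_vandermonde, Fin.prod_univ_succ,
    Fin.prod_univ_succ (fun i : Fin (n + 1) => ∏ j ∈ Finset.Ioi i, _)]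
  simp only [Fin.cons_zero, Fin.cons_succ, Fin.prod_Ioi_zero, Fin.prod_Ioi_succ]
  have : ∏ j : Fin n, (((x j : R) + ((x j)⁻¹ : Rˣ)) - ((y : R) + (y⁻¹ : Rˣ))) =
      (-1) ^ n * ∏ j : Fin n, (((y : R) + (y⁻¹ : Rˣ)) - ((x j : R) + ((x j)⁻¹ : Rˣ))) := by
    have h := Finset.prod_const (s := (Finset.univ : Finset (Fin n))) (-1 : R)
    rw [Finset.card_univ, Fintype.card_fin] at h
    rw [← h, ← Finset.prod_mul_distrib]
    exact Finset.prod_congr rfl fun j _ => by ring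
  rw [this]
  ring

end Alternant

end TypeB

end

noncomputable section

namespace TypeB

/-! ### The expression `G_{n,k}` in terms of alternants -/

/-- The vector `(n + 1, n, …, 1)` without its entry `n + 1 - j`. -/
def rhoOmit (n j : ℕ) (a : Fin n) : ℤ := if (a : ℕ) < j then (n : ℤ) + 1 - (a : ℕ) else n - (a : ℕ)

theorem rho_comp_succAbove {n : ℕ} (j : Fin (n + 1)) :
    rho (n + 1) ∘ j.succAbove = rhoOmit n j := by
  ext a
  simp only [rho, rhoOmit, Function.comp, Fin.succAbove, Fin.lt_def, Fin.val_castSucc]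
  split_ifs <;> simp

section

variable {F : Type*} [Field F] {n : ℕ}

theorem alt_cons_rho_expand (y : Fˣ) (x : Fin n → Fˣ) :
    alt (Fin.cons y x) (rho (n + 1)) = ∑ r ∈ Finset.range (2 * (n + 1)), (-1) ^ r *
      ((y ^ ((n : ℤ) + 1 - r) : Fˣ) : F) * alt x (rhoOmit n (rbar (n + 1) r)) := by
  have hlap : alt (Fin.cons y x) (rho (n + 1)) = ∑ j ∈ Finset.range (n + 1), (-1) ^ j *
      (((y ^ ((n : ℤ) + 1 - j) : Fˣ) : F) - ((y ^ (1 - ((n : ℤ) + 1 - j)) : Fˣ) : F)) *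
        alt x (rhoOmit n j) := by
    rw [alt_rho_row _ 0, Finset.sum_range]
    simp only [Fin.val_zero, pow_zero, one_mul, Fin.cons_zero, rho_comp_succAbove]
    refine Finset.sum_congr rfl fun j _ => ?_
    have : (Fin.cons y x : Fin (n + 1) → Fˣ) ∘ (0 : Fin (n + 1)).succAbove = x := by
      ext a; simp
    rw [this]
    simp [rho]
  -- The second term of the entry in column j has exponent j - n, which is n + 1 - r for r = 2n + 1
  -- - j, and this r has r̄ = j. So the upper half of the range of r is reversed and paired with the
  -- lower half.
  rw [hlap, two_mul, Finset.sum_range_add _ (n + 1) (n + 1), ← Finset.sum_range_reflect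
    (fun r => (-1 : F) ^ (n + 1 + r) * ((y ^ ((n : ℤ) + 1 - (n + 1 + r : ℕ)) : Fˣ) : F) *
      alt x (rhoOmit n (rbar (n + 1) (n + 1 + r)))), ← Finset.sum_add_distrib]
  refine Finset.sum_congr rfl fun j hj => ?_
  rw [Finset.mem_range] at hj
  have e1 : rbar (n + 1) j = j := by unfold rbar; omega
  have e2 : rbar (n + 1) (n + 1 + (n + 1 - 1 - j)) = j := by unfold rbar; omega
  have e3 : (n : ℤ) + 1 - (n + 1 + (n + 1 - 1 - j) : ℕ) = 1 - ((n : ℤ) + 1 - j) := by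
    omega
  have e4 : (-1 : F) ^ (n + 1 + (n + 1 - 1 - j)) = -(-1) ^ j := by
    have : n + 1 + (n + 1 - 1 - j) + j = 2 * n + 1 := by omega
    have h2 : (-1 : F) ^ (n + 1 + (n + 1 - 1 - j)) * (-1) ^ j = -1 := by
      rw [← pow_add, this, pow_succ, pow_mul]; simp
    have h3 : (-1 : F) ^ j * (-1) ^ j = 1 := by
      rw [← mul_pow]; simp
    linear_combination (-1 : F) ^ j * h2 - (-1) ^ (n + 1 + (n + 1 - 1 - j)) * h3
  rw [e1, e2, e3, e4]
  ring

/-- In the product formula, q²y - 1 = q (qy - q⁻¹), and the factor (y - x)(y - x⁻¹)/y becomes (qy -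
q⁻¹x)(qy - q⁻¹x⁻¹)/y. Only the first factor leaves a spare power of q. -/
theorem alt_cons_rho_mul_sq (q y : Fˣ) (x : Fin n → Fˣ) (hy : (y : F) ≠ 1)
    (hne : ∀ j, (y : F) ≠ x j) (hne' : ∀ j, (y : F) ≠ ((x j)⁻¹ : Fˣ)) :
    alt (Fin.cons (q ^ 2 * y) x) (rho (n + 1)) = q * (alt (Fin.cons y x) (rho (n + 1)) *
      (((q : F) * y - (q : F)⁻¹) / (y - 1) * ∏ j,
        (((q : F) * y - (q : F)⁻¹ * x j) / (y - x j) *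
          (((q : F) * y - (q : F)⁻¹ * ((x j)⁻¹ : Fˣ)) / (y - ((x j)⁻¹ : Fˣ)))))) := by
  obtain ⟨c, hc⟩ := alt_cons_rho x
  rw [hc, hc]
  have h0 : (((q ^ 2 * y : Fˣ) : F) - 1) =
      q * (((y : F) - 1) * (((q : F) * y - (q : F)⁻¹) / (y - 1))) := by
    have : (y : F) - 1 ≠ 0 := sub_ne_zero.2 hy
    have := q.ne_zero
    push_cast
    field_simp
  have hj : ∏ j, ((((q ^ 2 * y : Fˣ) : F) + ((q ^ 2 * y)⁻¹ : Fˣ)) - ((x j : F) + ((x j)⁻¹ : Fˣ))) =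
      (∏ j, (((y : F) + (y⁻¹ : Fˣ)) - ((x j : F) + ((x j)⁻¹ : Fˣ)))) * ∏ j,
        (((q : F) * y - (q : F)⁻¹ * x j) / (y - x j) *
          (((q : F) * y - (q : F)⁻¹ * ((x j)⁻¹ : Fˣ)) / (y - ((x j)⁻¹ : Fˣ)))) := by
    rw [← Finset.prod_mul_distrib]
    refine Finset.prod_congr rfl fun j _ => ?_
    have h1 : (y : F) - x j ≠ 0 := sub_ne_zero.2 (hne j)
    have h2 : (y : F) - ((x j)⁻¹ : Fˣ) ≠ 0 := sub_ne_zero.2 (hne' j)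
    have hq := q.ne_zero
    have hy := y.ne_zero
    have hx := (x j).ne_zero
    have e1 : (((y : F) + (y⁻¹ : Fˣ)) - ((x j : F) + ((x j)⁻¹ : Fˣ))) =
        (y : F)⁻¹ * ((y - x j) * (y - ((x j)⁻¹ : Fˣ))) := by
      push_cast; field_simp; ring
    rw [e1, show ∀ a b c d f : F, a * (b * c) * (d / b * (f / c)) =
      a * ((b * (d / b)) * (c * (f / c))) by intros; ring, mul_div_cancel₀ _ h1,
      mul_div_cancel₀ _ h2]
    push_cast; field_simp; ring
  rw [h0, hj]
  ring

theorem alt_cons_inv (y : Fˣ) (x : Fin n → Fˣ) (l : Fin (n + 1) → ℤ) :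
    alt (Fin.cons y x) l = -(y : F) * alt (Fin.cons y⁻¹ x) l := by
  have h := alt_update_inv (Fin.cons y x : Fin (n + 1) → Fˣ) l 0
  rw [Fin.cons_zero, Fin.update_cons_zero] at h
  rw [h]
  simp

theorem alt_rho_eq_cons (x : Fin (n + 1) → Fˣ) (i : Fin (n + 1)) :
    alt x (rho (n + 1)) = (-1) ^ (i : ℕ) *
      alt (Fin.cons (x i) (x ∘ i.succAbove)) (rho (n + 1)) := by
  rw [alt_rho_row x i, alt_rho_row (Fin.cons (x i) (x ∘ i.succAbove)) 0]
  have : (Fin.cons (x i) (x ∘ i.succAbove) : Fin (n + 1) → Fˣ) ∘ (0 : Fin (n + 1)).succAbove =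
      x ∘ i.succAbove := by
    ext a; simp
  rw [this]
  simp

theorem prod_intUnits {M : Type*} [CommMonoid M] (f : ℤˣ → M) : ∏ s, f s = f 1 * f (-1) := by
  rw [show (Finset.univ : Finset ℤˣ) = {1, -1} from rfl, Finset.prod_pair (by decide)]

theorem sum_intUnits {M : Type*} [AddCommMonoid M] (f : ℤˣ → M) : ∑ s, f s = f 1 + f (-1) := by
  rw [show (Finset.univ : Finset ℤˣ) = {1, -1} from rfl, Finset.sum_pair (by decide)]

theorem P_eq_prod (q : F) (x : Fin (n + 1) → Fˣ) (i : Fin (n + 1)) (s : ℤˣ) :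
    P q (fun a : Idx (n + 1) => ((x a.1 ^ (a.2 : ℤ) : Fˣ) : F)) (i, s) =
      ∏ j, ((q * ((x i ^ (s : ℤ) : Fˣ) : F) - q⁻¹ * x (i.succAbove j)) /
          (((x i ^ (s : ℤ) : Fˣ) : F) - x (i.succAbove j)) *
        ((q * ((x i ^ (s : ℤ) : Fˣ) : F) - q⁻¹ * ((x (i.succAbove j))⁻¹ : Fˣ)) /
          (((x i ^ (s : ℤ) : Fˣ) : F) - ((x (i.succAbove j))⁻¹ : Fˣ)))) := by
  unfold P
  rw [Finset.prod_filter, Fintype.prod_prod_type, Fin.prod_univ_succAbove _ i]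
  simp only [ne_eq, not_true_eq_false, if_false, Finset.prod_const_one, one_mul,
    Fin.succAbove_ne, not_false_eq_true, if_true, prod_intUnits, Units.val_one, zpow_one,
    Units.val_neg, zpow_neg]

/-- The term of G at y = x_i^s turns the Weyl denominator into q⁻¹ y^k times the one with q²y in
place of y. Expanding the latter in powers of y and returning from y to x_i gives one of the two
terms of the entry x_i^c - x_i^(1-c), c = k - r + n + 1, multiplied by its minor. -/
theorem alt_rho_mul_term (q : Fˣ) (x : Fin (n + 1) → Fˣ) (h1 : ∀ i, (x i : F) ≠ 1)
    (h1' : ∀ i, (x i : F) ≠ -1) (hne : ∀ i j, i ≠ j → x i ≠ x j)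
    (hne' : ∀ i j, i ≠ j → x i ≠ (x j)⁻¹) (k : ℕ) (i : Fin (n + 1)) (s : ℤˣ) :
    alt x (rho (n + 1)) *
      (((q : F) * ((x i ^ (s : ℤ) : Fˣ) : F) - (q : F)⁻¹ * (((x i ^ (s : ℤ) : Fˣ) : F))⁻¹ + q
          - (q : F)⁻¹) / (((x i ^ (s : ℤ) : Fˣ) : F) - (((x i ^ (s : ℤ) : Fˣ) : F))⁻¹) *
        ((x i ^ (s : ℤ) : Fˣ) : F) ^ k *
        P (q : F) (fun a : Idx (n + 1) => ((x a.1 ^ (a.2 : ℤ) : Fˣ) : F)) (i, s)) =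
    ∑ r ∈ Finset.range (2 * (n + 1)), (-1) ^ r *
      ((q ^ (2 * ((n + 1 : ℕ) : ℤ) - 2 * r - 1) : Fˣ) : F) *
        ((-1) ^ (i : ℕ) * (((s : ℤ) : F) * ((x i ^ (if s = 1 then (k : ℤ) - r + (n + 1) else
          1 - ((k : ℤ) - r + (n + 1))) : Fˣ) : F)) *
            alt (x ∘ i.succAbove) (rhoOmit n (rbar (n + 1) r))) := by
  set y : Fˣ := x i ^ (s : ℤ) with hydef
  have hyx : y = x i ∨ y = (x i)⁻¹ := by
    rcases Int.units_eq_one_or s with rfl | rfl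
    · left; simp [hydef]
    · right; simp [hydef]
  have hy1 : (y : F) ≠ 1 := by
    rcases hyx with h | h <;> rw [h]
    · exact h1 i
    · simpa using h1 i
  have hy2 : (y : F) ≠ -1 := by
    rcases hyx with h | h <;> rw [h]
    · exact h1' i
    · intro h2
      apply h1' i
      rw [Units.val_inv_eq_inv_val] at h2
      rw [← inv_inv (x i : F), h2]; norm_num
  have hyj : ∀ j, (y : F) ≠ (x ∘ i.succAbove) j := by
    intro j h
    rw [Units.val_inj] at h
    rcases hyx with h' | h' <;> rw [h'] at h
    · exact hne _ _ (Fin.succAbove_ne i j).symm h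
    · exact hne' _ _ (Fin.succAbove_ne i j) h.symm
  have hyj' : ∀ j, (y : F) ≠ (((x ∘ i.succAbove) j)⁻¹ : Fˣ) := by
    intro j h
    rw [Units.val_inj] at h
    rcases hyx with h' | h' <;> rw [h'] at h
    · exact hne' _ _ (Fin.succAbove_ne i j).symm h
    · exact hne _ _ (Fin.succAbove_ne i j).symm (inv_injective h)
  -- The common factor (y + 1)/y cancels; this is where y ≠ -1 matters.
  have hfac : ((q : F) * y - (q : F)⁻¹ * (y : F)⁻¹ + q - (q : F)⁻¹) / ((y : F) - (y : F)⁻¹) =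
      ((q : F) * y - (q : F)⁻¹) / (y - 1) := by
    have a1 : (y : F) - 1 ≠ 0 := sub_ne_zero.2 hy1
    have a2 : (y : F) + 1 ≠ 0 := fun h => hy2 (eq_neg_of_add_eq_zero_left h)
    have a3 := y.ne_zero
    have a4 := q.ne_zero
    have a5 : (y : F) - (y : F)⁻¹ ≠ 0 := by
      have : (y : F) - (y : F)⁻¹ = (y : F)⁻¹ * ((y - 1) * (y + 1)) := by field_simp; ring
      rw [this]
      exact mul_ne_zero (inv_ne_zero a3) (mul_ne_zero a1 a2)
    rw [div_eq_div_iff a5 a1]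
    field_simp
    ring
  -- Moving row i to the top costs (-1)^i, and inverting its variable when s = -1 costs -x_i.
  have hV : alt x (rho (n + 1)) = (-1) ^ (i : ℕ) * (((s : ℤ) : F) *
      ((x i ^ (if s = 1 then (0 : ℤ) else 1) : Fˣ) : F) *
        alt (Fin.cons y (x ∘ i.succAbove)) (rho (n + 1))) := by
    rw [alt_rho_eq_cons x i]
    rcases Int.units_eq_one_or s with rfl | rfl
    · simp [hydef]
    · rw [alt_cons_inv]
      simp [hydef]
  have hexp := alt_cons_rho_mul_sq q y (x ∘ i.succAbove) hy1 hyj hyj'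
  rw [alt_cons_rho_expand] at hexp
  rw [hfac, hydef, P_eq_prod, ← hydef, hV]
  simp only [Function.comp] at hexp ⊢
  have hq := q.ne_zero
  have key := congrArg (HMul.hMul ((-1) ^ (i : ℕ) * (((s : ℤ) : F) *
    ((x i ^ (if s = 1 then (0 : ℤ) else 1) : Fˣ) : F) * (y : F) ^ k)))
    ((eq_inv_mul_iff_mul_eq₀ hq).2 hexp.symm)
  refine Eq.trans (by ring) (key.trans ?_)
  rw [Finset.mul_sum, Finset.mul_sum]
  refine Finset.sum_congr rfl fun r _ => ?_
  have eq1 : ((q ^ (2 * ((n + 1 : ℕ) : ℤ) - 2 * r - 1) : Fˣ) : F) =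
      (q : F)⁻¹ * (((q ^ 2) ^ ((n : ℤ) + 1 - r) : Fˣ) : F) := by
    rw [← Units.val_inv_eq_inv_val, ← Units.val_mul, ← zpow_natCast q 2, ← zpow_mul,
      ← zpow_neg_one, ← zpow_add]
    congr 2
    push_cast; ring
  have eq2 : ((x i ^ (if s = 1 then (k : ℤ) - r + (n + 1) else
          1 - ((k : ℤ) - r + (n + 1))) : Fˣ) : F) =
      ((x i ^ (if s = 1 then (0 : ℤ) else 1) : Fˣ) : F) * (y : F) ^ k *
        ((y ^ ((n : ℤ) + 1 - r) : Fˣ) : F) := by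
    rw [← Units.val_pow_eq_pow_val, ← Units.val_mul, ← Units.val_mul, hydef, ← zpow_natCast,
      ← zpow_mul, ← zpow_mul, ← zpow_add, ← zpow_add]
    congr 2
    rcases Int.units_eq_one_or s with rfl | rfl
    · simp; ring
    · rw [if_neg (by decide), if_neg (by decide)]; push_cast; ring
  rw [eq1, eq2, mul_zpow, Units.val_mul]
  ring

/-- For fixed r, the terms over (i, 1) and (i, -1) together form the Laplace expansion along the
first column of an alternant with first exponent k - r + n + 1. -/
theorem alt_rho_mul_G (q : Fˣ) (x : Fin (n + 1) → Fˣ) (h1 : ∀ i, (x i : F) ≠ 1)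
    (h1' : ∀ i, (x i : F) ≠ -1) (hne : ∀ i j, i ≠ j → x i ≠ x j)
    (hne' : ∀ i j, i ≠ j → x i ≠ (x j)⁻¹) (k : ℕ) :
    alt x (rho (n + 1)) *
        (G (q : F) (fun a : Idx (n + 1) => ((x a.1 ^ (a.2 : ℤ) : Fˣ) : F)) k - ((q : F) ^ k)⁻¹) =
      ∑ r ∈ Finset.range (2 * (n + 1)), (-1) ^ r *
        ((q ^ (2 * ((n + 1 : ℕ) : ℤ) - 2 * r - 1) : Fˣ) : F) *
          alt x (Fin.cons ((k : ℤ) - r + (n + 1)) (rhoOmit n (rbar (n + 1) r))) := by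
  unfold G
  rw [add_sub_cancel_left, Finset.mul_sum,
    Finset.sum_congr rfl fun a _ => alt_rho_mul_term q x h1 h1' hne hne' k a.1 a.2,
    Finset.sum_comm]
  refine Finset.sum_congr rfl fun r _ => ?_
  rw [← Finset.mul_sum, alt_cons_exponent, Fintype.sum_prod_type]
  congr 1
  refine Finset.sum_congr rfl fun i _ => ?_
  rw [sum_intUnits]
  simp only [if_true, show (-1 : ℤˣ) ≠ 1 by decide, if_false]
  push_cast
  ring

/-! ### Straightening -/

/-- Moving the omitted entry back from the front to position j is a cycle of sign (-1)^j. -/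
theorem alt_cons_rhoOmit (x : Fin (n + 1) → Fˣ) (j : Fin (n + 1)) :
    alt x (Fin.cons (rho (n + 1) j) (rhoOmit n j)) = (-1) ^ (j : ℕ) * alt x (rho (n + 1)) := by
  have : (Fin.cons (rho (n + 1) j) (rhoOmit n j) : Fin (n + 1) → ℤ) =
      rho (n + 1) ∘ j.cycleRange.symm := by
    ext a
    refine Fin.cases ?_ (fun a => ?_) a
    · simp
    · rw [← rho_comp_succAbove]; simp
  rw [this, alt_comp_perm, Equiv.Perm.sign_symm, Fin.sign_cycleRange]
  simp

/-- An alternant with exponents `(c, n + 1, …, 1)`, an entry other than `c` being omitted. -/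
theorem alt_cons_rhoOmit_eq_zero (x : Fin (n + 1) → Fˣ) (c : ℤ) (j : ℕ) (hj : j ≤ n) (hc1 : 1 ≤ c)
    (hc2 : c ≤ n + 1) (hc : c ≠ n + 1 - j) : alt x (Fin.cons c (rhoOmit n j)) = 0 := by
  -- d is the position of c in (n + 1, …, 1). After the entry at j is dropped, c sits at d or at d -
  -- 1 according as d < j or d > j.
  obtain ⟨d, rfl⟩ : ∃ d : ℕ, c = (n : ℤ) + 1 - d := ⟨(n + 1 - c).toNat, by omega⟩
  have hd : d ≠ j := by rintro rfl; exact hc rfl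
  rcases lt_or_gt_of_ne hd with h | h
  · refine alt_eq_zero x _ (Fin.succ_ne_zero ⟨d, by omega⟩).symm ?_
    simp only [Fin.cons_zero, Fin.cons_succ, rhoOmit]
    rw [if_pos h]
  · refine alt_eq_zero x _ (Fin.succ_ne_zero ⟨d - 1, by omega⟩).symm ?_
    simp only [Fin.cons_zero, Fin.cons_succ, rhoOmit]
    rw [if_neg (by omega)]
    omega

theorem alt_cons_one_sub (x : Fin (n + 1) → Fˣ) (c : ℤ) (l : Fin n → ℤ) :
    alt x (Fin.cons c l) = -alt x (Fin.cons (1 - c) l) := by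
  have := alt_update x (Fin.cons c l : Fin (n + 1) → ℤ) 0
  rw [Fin.cons_zero, Fin.update_cons_zero] at this
  rw [this, neg_neg]

/-- For k ≤ r, either the first exponent c or its mirror image 1 - c lies in {1, …, n + 1}. It then
repeats a later exponent unless it is the omitted entry. For c this happens when k = 0 (r ≤ n) or k
+ 2n + 1 = 2r (r > n), and for 1 - c only when k = 0. -/
theorem alt_straighten (x : Fin (n + 1) → Fˣ) (k r : ℕ) (hr : r < 2 * (n + 1)) (hk : k ≤ r) :
    alt x (Fin.cons ((k : ℤ) - r + (n + 1)) (rhoOmit n (rbar (n + 1) r))) =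
      (if k = 0 then (-1) ^ r else if k + 2 * n + 1 = 2 * r then -(-1) ^ r else 0) *
        alt x (rho (n + 1)) := by
  rcases Nat.lt_or_ge r (n + 1) with h | h
  · have hb : rbar (n + 1) r = r := by unfold rbar; omega
    rw [hb]
    rcases Nat.eq_zero_or_pos k with rfl | hk0
    · rw [if_pos rfl]
      have := alt_cons_rhoOmit x (⟨r, h⟩ : Fin (n + 1))
      rw [← this]
      congr 2
      simp [rho]; ring
    · rw [if_neg hk0.ne', if_neg (by omega), zero_mul]
      exact alt_cons_rhoOmit_eq_zero x _ _ (by omega) (by omega) (by omega) (by omega)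
  · have hb : rbar (n + 1) r = 2 * n + 1 - r := by unfold rbar; omega
    have hs : (-1 : F) ^ (2 * n + 1 - r) = -(-1) ^ r := by
      have h2 : (-1 : F) ^ (2 * n + 1 - r) * (-1) ^ r = -1 := by
        rw [← pow_add, show 2 * n + 1 - r + r = 2 * n + 1 by omega, pow_succ, pow_mul]; simp
      have h3 : (-1 : F) ^ r * (-1) ^ r = 1 := by
        rw [← mul_pow]; simp
      linear_combination (-1 : F) ^ r * h2 - (-1) ^ (2 * n + 1 - r) * h3
    have hm := alt_cons_rhoOmit x (⟨2 * n + 1 - r, by omega⟩ : Fin (n + 1))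
    rw [hb]
    simp only [rho] at hm
    rw [hs] at hm
    rcases Nat.eq_zero_or_pos k with rfl | hk0
    · rw [if_pos rfl, alt_cons_one_sub]
      have : 1 - (((0 : ℕ) : ℤ) - r + (n + 1)) = ((n + 1 : ℕ) : ℤ) - ((2 * n + 1 - r : ℕ) : ℤ) := by
        omega
      rw [this, hm]; ring
    · rw [if_neg hk0.ne']
      split_ifs with h2
      · have : (k : ℤ) - r + (n + 1) = ((n + 1 : ℕ) : ℤ) - ((2 * n + 1 - r : ℕ) : ℤ) := by
          omega
        rw [this, hm]
      · rw [zero_mul]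
        rcases le_or_gt 1 ((k : ℤ) - r + (n + 1)) with h3 | h3
        · exact alt_cons_rhoOmit_eq_zero x _ _ (by omega) h3 (by omega) (by omega)
        · rw [alt_cons_one_sub, alt_cons_rhoOmit_eq_zero x _ _ (by omega) (by omega) (by omega)
            (by omega), neg_zero]

end

end TypeB

end

noncomputable section

namespace TypeB

attribute [local instance 100] LieRing.ofAssociativeRing

/-! ### Generators of the Lie algebra of type `B_n` -/

/-- The index set of the standard basis of the vector representation. -/
abbrev Pos (n : ℕ) := Unit ⊕ (Fin n ⊕ Fin n)

variable {n : ℕ}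

/-- The weight of a standard basis vector. -/
def wt : Pos n → Fin n → ℤ := Sum.elim 0 (Sum.elim eps fun i => -eps i)

/-- The index of the dual basis vector with respect to the symmetric form. -/
def bar : Pos n → Pos n := Sum.map id Sum.swap

/-- The nonzero entries of the matrix of the symmetric form. -/
def jc : Pos n → ℂ := Sum.elim 2 1

@[simp] theorem bar_bar (a : Pos n) : bar (bar a) = a := by
  rcases a with a | a | a <;> rfl

@[simp] theorem jc_bar (a : Pos n) : jc (bar a) = jc a := by
  rcases a with a | a | a <;> rfl

@[simp] theorem wt_bar (a : Pos n) : wt (bar a) = -wt a := by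
  rcases a with a | a | a <;> simp [wt, bar]

@[simp] theorem jc_ne_zero (a : Pos n) : jc a ≠ 0 := by
  rcases a with a | a | a <;> simp [jc]

theorem bar_inj {a b : Pos n} : bar a = bar b ↔ a = b :=
  ⟨fun h => by rw [← bar_bar a, h, bar_bar], fun h => by rw [h]⟩

theorem bar_eq_iff {a b : Pos n} : bar a = b ↔ a = bar b :=
  ⟨fun h => by rw [← h, bar_bar], fun h => by rw [h, bar_bar]⟩

theorem eq_bar_comm {a b : Pos n} : a = bar b ↔ b = bar a :=
  ⟨fun h => by rw [h, bar_bar], fun h => by rw [h, bar_bar]⟩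

theorem JB_apply (a b : Pos n) :
    LieAlgebra.Orthogonal.JB (Fin n) ℂ a b = if b = bar a then jc a else 0 := by
  rcases a with a | a | a <;> rcases b with b | b | b <;>
    simp [LieAlgebra.Orthogonal.JB, LieAlgebra.Orthogonal.JD, bar, jc, Matrix.one_apply, eq_comm]

theorem mem_Lie_iff (X : Matrix (Pos n) (Pos n) ℂ) :
    X ∈ Lie n ↔ ∀ a b, jc b * X (bar b) a = -(jc a * X (bar a) b) := by
  rw [Lie, LieAlgebra.Orthogonal.typeB, mem_skewAdjointMatricesLieSubalgebra,
    mem_skewAdjointMatricesSubmodule]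
  unfold Matrix.IsSkewAdjoint Matrix.IsAdjointPair
  rw [← Matrix.ext_iff]
  refine forall₂_congr fun a b => ?_
  simp only [Matrix.mul_apply, Matrix.transpose_apply, JB_apply, Matrix.neg_apply]
  have h1 : ∀ c : Pos n, (b = bar c) = (c = bar b) := fun c => propext eq_bar_comm
  simp [h1, mul_comm]

/-- The matrix of `v ↦ (c, v) a - (a, v) c`, for basis vectors `a` and `c`. -/
def genMatrix (a c : Pos n) : Matrix (Pos n) (Pos n) ℂ :=
  Matrix.single a (bar c) (jc c) - Matrix.single c (bar a) (jc a)

theorem genMatrix_apply (a c d e : Pos n) : genMatrix a c d e =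
    (if a = d ∧ bar c = e then jc c else 0) - (if c = d ∧ bar a = e then jc a else 0) := by
  simp [genMatrix, Matrix.single_apply]

theorem genMatrix_mem (a c : Pos n) : genMatrix a c ∈ Lie n := by
  rw [mem_Lie_iff]
  intro d e
  simp only [genMatrix_apply, bar_eq_iff]
  have hj (x : Pos n) : jc (bar x) = jc x := jc_bar x
  grind

theorem sum_ite_eq_bar {M : Type*} [AddCommMonoid M] (c : Pos n) (f : Pos n → M) :
    ∑ x, (if c = bar x then f x else 0) = f (bar c) := by
  simp only [eq_bar_comm (a := c)]
  rw [Finset.sum_ite_eq']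
  simp

theorem coe_sum_Lie {ι : Type*} (s : Finset ι) (f : ι → Lie n) :
    ((∑ i ∈ s, f i : Lie n) : Matrix (Pos n) (Pos n) ℂ) = ∑ i ∈ s, (f i).1 :=
  map_sum (Lie n).toSubmodule.subtype f s

theorem coe_add_Lie (x y : Lie n) :
    ((x + y : Lie n) : Matrix (Pos n) (Pos n) ℂ) = x.1 + y.1 := rfl

theorem coe_smul_Lie (c : ℂ) (y : Lie n) :
    ((c • y : Lie n) : Matrix (Pos n) (Pos n) ℂ) = c • y.1 := rfl

/-- The matrix `genMatrix a c` as an element of the Lie algebra. -/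
def gen (a c : Pos n) : Lie n := ⟨genMatrix a c, genMatrix_mem a c⟩

theorem gen_self (a : Pos n) : gen a a = 0 := Subtype.ext (by simp [gen, genMatrix])

/-- Under the identification of 𝔰𝔬(V) with Λ²V, `gen a c` is a ∧ c, and the adjoint action is X(a ∧
c) = Xa ∧ c + a ∧ Xc. -/
theorem lie_gen (X : Lie n) (a c : Pos n) :
    ⁅X, gen a c⁆ = ∑ b, X.1 b a • gen b c + ∑ b, X.1 b c • gen a b := by
  have hX := (mem_Lie_iff X.1).1 X.2
  apply Subtype.ext
  rw [LieSubalgebra.coe_bracket, Ring.lie_def]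
  simp only [coe_add_Lie, coe_sum_Lie, coe_smul_Lie, gen]
  ext d e
  simp only [Matrix.sub_apply, Matrix.mul_apply, Matrix.add_apply, Matrix.sum_apply,
    Matrix.smul_apply, genMatrix_apply, smul_eq_mul, mul_sub, sub_mul, Finset.sum_sub_distrib,
    ite_and, mul_ite, ite_mul, mul_zero, zero_mul]
  simp only [bar_eq_iff, sum_ite_eq_bar, Finset.sum_ite_eq, Finset.sum_ite_eq',
    Finset.mem_univ, if_true, Finset.sum_ite_irrel, Finset.sum_const_zero]
  have h1 : jc c * X.1 (bar c) e = -(X.1 (bar e) c * jc e) := by linear_combination hX e c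
  have h2 : jc a * X.1 (bar a) e = -(X.1 (bar e) a * jc e) := by linear_combination hX e a
  rw [h1, h2, jc_bar]
  split_ifs <;> ring

theorem span_gen : Submodule.span ℂ (Set.range fun p : Pos n × Pos n => gen p.1 p.2) = ⊤ := by
  refine eq_top_iff.2 fun X _ => ?_
  have hX := (mem_Lie_iff X.1).1 X.2
  -- The factor 1/2 compensates for `gen a b` and `gen b a` being negatives of each other, so that
  -- each generator is counted twice.
  have key : X = ∑ a, ∑ b, (2⁻¹ * X.1 a (bar b) * (jc b)⁻¹) • gen a b := by
    apply Subtype.ext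
    simp only [coe_sum_Lie, coe_smul_Lie, gen]
    ext d e
    simp only [Matrix.sum_apply, Matrix.smul_apply, genMatrix_apply, smul_eq_mul, mul_sub,
      Finset.sum_sub_distrib, ite_and, mul_ite, mul_zero, bar_eq_iff, Finset.sum_ite_eq',
      Finset.mem_univ, if_true, Finset.sum_ite_irrel,
      Finset.sum_const_zero, bar_bar, jc_bar]
    have h1 : X.1 (bar e) (bar d) * jc e * (jc d)⁻¹ = -X.1 d e := by
      have := hX (bar d) e
      rw [bar_bar, jc_bar] at this
      have hd := jc_ne_zero d
      field_simp
      linear_combination this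
    have he := jc_ne_zero e
    have : X.1 d e * (jc e)⁻¹ * jc e = X.1 d e := by field_simp
    linear_combination (-1 / 2 : ℂ) * this + (1 / 2 : ℂ) * h1
  rw [key]
  exact Submodule.sum_mem _ fun a _ => Submodule.sum_mem _ fun b _ =>
    Submodule.smul_mem _ _ (Submodule.subset_span ⟨(a, b), rfl⟩)

theorem cartan_apply (i : Fin n) (a b : Pos n) :
    (cartan n i).1 a b = if a = b then (wt a i : ℂ) else 0 := by
  simp only [cartan, cartanMatrix, Matrix.diagonal_apply]
  split_ifs with h
  · subst h
    rcases a with a | a | a <;> simp [wt, eps, Pi.single_apply, eq_comm]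
  · rfl

theorem lie_cartan_gen (i : Fin n) (a c : Pos n) :
    ⁅cartan n i, gen a c⁆ = (((wt a + wt c) i : ℤ) : ℂ) • gen a c := by
  rw [lie_gen]
  simp only [cartan_apply, ite_smul, zero_smul, Finset.sum_ite_eq', Finset.mem_univ, if_true]
  rw [← add_smul]
  simp

/-- The generators of weight zero lie in the Cartan subalgebra. -/
theorem gen_bar_self (a : Pos n) : gen a (bar a) = jc a • ∑ i, (wt a i : ℂ) • cartan n i := by
  apply Subtype.ext
  simp only [coe_sum_Lie, coe_smul_Lie, gen]
  ext d e
  simp only [Matrix.sum_apply, Matrix.smul_apply, genMatrix_apply, smul_eq_mul, cartan_apply,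
    bar_bar, jc_bar]
  rcases a with a | a | a <;> rcases d with d | d | d <;> rcases e with e | e | e <;>
    simp [bar, wt, jc, eps, Pi.single_apply] <;> grind

/-- This produces the coroot, up to scaling, for the root `wt a + wt c`. It serves both the
sl₂-triples and the commutators in the Casimir trace. -/
theorem lie_gen_gen_bar {a c : Pos n} (h : a ≠ c) : ⁅gen a c, gen (bar c) (bar a)⁆ =
    (jc a * jc c) • ∑ i, ((wt a i : ℂ) + (wt c i : ℂ)) • cartan n i := by
  have hac : c ≠ a := h.symm
  rw [lie_gen]
  have e1 : ∀ b, (gen a c).1 b (bar c) • gen b (bar a) =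
      (if a = b then jc c • gen b (bar a) else 0) := by
    intro b
    simp only [gen, genMatrix_apply, bar_inj, h, and_false, if_false, sub_zero, and_true]
    split_ifs <;> simp
  have e2 : ∀ b, (gen a c).1 b (bar a) • gen (bar c) b =
      (if c = b then -(jc a • gen (bar c) b) else 0) := by
    intro b
    simp only [gen, genMatrix_apply, bar_inj, hac, and_false, if_false, zero_sub, and_true]
    split_ifs <;> simp
  have e3 : gen (bar c) c = -gen c (bar c) := Subtype.ext (by
    change genMatrix _ _ = -genMatrix _ _
    simp [genMatrix])
  simp only [e1, e2, Finset.sum_ite_eq, Finset.mem_univ, if_true]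
  rw [e3, gen_bar_self, gen_bar_self]
  simp only [add_smul, Finset.sum_add_distrib, smul_neg, neg_neg, smul_add, smul_smul]
  rw [mul_comm (jc c)]

/-- The weight of a generator is zero, a positive root or a negative root. -/
theorem wt_add_wt_cases (a c : Pos n) : a = c ∨ c = bar a ∨ wt a + wt c ∈ posRoots n ∨
    -(wt a + wt c) ∈ posRoots n := by
  rcases a with a | a | a <;> rcases c with c | c | c
  · left; rfl
  · right; right; left; exact Or.inl ⟨c, by simp [wt]⟩
  · right; right; right; exact Or.inl ⟨c, by simp [wt]⟩
  · right; right; left; exact Or.inl ⟨a, by simp [wt]⟩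
  · rcases lt_trichotomy a c with h | rfl | h
    · right; right; left; exact Or.inr ⟨a, c, h, Or.inl (by simp [wt])⟩
    · left; rfl
    · right; right; left; exact Or.inr ⟨c, a, h, Or.inl (by simp [wt, add_comm])⟩
  · rcases lt_trichotomy a c with h | rfl | h
    · right; right; left; exact Or.inr ⟨a, c, h, Or.inr (by simp [wt, sub_eq_add_neg])⟩
    · right; left; rfl
    · right; right; right; exact Or.inr ⟨c, a, h, Or.inr (by simp [wt, sub_eq_add_neg])⟩
  · right; right; right; exact Or.inl ⟨a, by simp [wt]⟩
  · rcases lt_trichotomy a c with h | rfl | h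
    · right; right; right; exact Or.inr ⟨a, c, h, Or.inr (by simp [wt, sub_eq_add_neg, add_comm])⟩
    · right; left; rfl
    · right; right; left; exact Or.inr ⟨c, a, h, Or.inr (by simp [wt, sub_eq_add_neg, add_comm])⟩
  · rcases lt_trichotomy a c with h | rfl | h
    · right; right; right; exact Or.inr ⟨a, c, h, Or.inl (by simp [wt, add_comm])⟩
    · left; rfl
    · right; right; right; exact Or.inr ⟨c, a, h, Or.inl (by simp [wt])⟩

/-- Root vectors of weight `α` shift the weights of the vector representation by `α`. -/
theorem wt_eq_of_apply_ne_zero {X : Lie n} {α : Fin n → ℤ}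
    (h : ∀ i, ⁅cartan n i, X⁆ = (α i : ℂ) • X) {a b : Pos n} (hab : X.1 a b ≠ 0) :
    wt a = wt b + α := by
  ext i
  have h1 := congrArg (fun Y : Lie n => Y.1 a b) (h i)
  simp only [LieSubalgebra.coe_bracket, Ring.lie_def, Matrix.sub_apply, Matrix.mul_apply,
    cartan_apply, coe_smul_Lie, Matrix.smul_apply, smul_eq_mul, ite_mul, mul_ite, zero_mul,
    mul_zero, Finset.sum_ite_eq, Finset.sum_ite_eq', Finset.mem_univ, if_true] at h1
  have h2 : ((wt a i : ℂ) - wt b i - α i) * X.1 a b = 0 := by linear_combination h1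
  have h3 := (mul_eq_zero.1 h2).resolve_right hab
  have h4 : ((wt a i - wt b i - α i : ℤ) : ℂ) = 0 := by push_cast; exact h3
  have h5 : wt a i - wt b i - α i = 0 := by exact_mod_cast h4
  simp only [Pi.add_apply]
  omega

end TypeB

end

noncomputable section

namespace TypeB

attribute [local instance 100] LieRing.ofAssociativeRing

/-! ### Highest weight modules -/

section HighestWeight

variable {n : ℕ}

/-- Induction over the triangular decomposition of the Lie algebra. -/
theorem Lie_induction {p : Lie n → Prop} (h0 : p 0) (hadd : ∀ x y, p x → p y → p (x + y))
    (hsmul : ∀ (c : ℂ) x, p x → p (c • x)) (hcartan : ∀ i, p (cartan n i))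
    (hpos : ∀ x ∈ posRootVectors n, p x)
    (hneg : ∀ α ∈ posRoots n, ∀ y, (∀ i, ⁅cartan n i, y⁆ = (-(α i : ℂ)) • y) → p y)
    (x : Lie n) : p x := by
  have hx : x ∈ Submodule.span ℂ (Set.range fun p : Pos n × Pos n => gen p.1 p.2) := by
    rw [span_gen]; trivial
  refine Submodule.span_induction ?_ h0 (fun x y _ _ => hadd x y) (fun c x _ => hsmul c x) hx
  rintro _ ⟨⟨a, c⟩, rfl⟩
  rcases wt_add_wt_cases a c with rfl | rfl | h | h
  · simpa only [gen_self] using h0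
  · simp only [gen_bar_self]
    refine hsmul _ _ (Finset.sum_induction _ p hadd h0 fun i _ => hsmul _ _ (hcartan i))
  · exact hpos _ ⟨_, h, fun i => lie_cartan_gen i a c⟩
  · refine hneg _ h _ fun i => ?_
    rw [lie_cartan_gen]
    simp

variable {W : Type*} [AddCommGroup W] [Module ℂ W]

/-- `v` is a vector of weight `lam` that is killed by the positive root vectors. -/
def IsHighest (ρ : Lie n →ₗ⁅ℂ⁆ Module.End ℂ W) (lam : Fin n → ℤ) (v : W) : Prop :=
  (∀ x ∈ posRootVectors n, ρ x v = 0) ∧ ∀ i, ρ (cartan n i) v = (lam i : ℂ) • v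

/-- `Descendant ρ v k δ w` says that `w` arises from `v` by applying `k` negative root vectors whose
weights have sum `-δ`. -/
inductive Descendant (ρ : Lie n →ₗ⁅ℂ⁆ Module.End ℂ W) (v : W) : ℕ → (Fin n → ℤ) → W → Prop
  | base : Descendant ρ v 0 0 v
  | step {k : ℕ} {δ α : Fin n → ℤ} {w : W} {y : Lie n} : Descendant ρ v k δ w → α ∈ posRoots n →
      (∀ i, ⁅cartan n i, y⁆ = (-(α i : ℂ)) • y) → Descendant ρ v (k + 1) (δ + α) (ρ y w)

/-- The span of the descendants in at most `k` steps. -/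
def descSpan (ρ : Lie n →ₗ⁅ℂ⁆ Module.End ℂ W) (v : W) (k : ℕ) : Submodule ℂ W :=
  Submodule.span ℂ {w | ∃ j ≤ k, ∃ δ, Descendant ρ v j δ w}

variable {ρ : Lie n →ₗ⁅ℂ⁆ Module.End ℂ W} {lam : Fin n → ℤ} {v : W}

theorem descSpan_mono {j k : ℕ} (h : j ≤ k) : descSpan ρ v j ≤ descSpan ρ v k :=
  Submodule.span_mono fun _ ⟨i, hi, δ, hw⟩ => ⟨i, hi.trans h, δ, hw⟩

theorem neg_mem_descSpan {α : Fin n → ℤ} (hα : α ∈ posRoots n) {y : Lie n}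
    (hy : ∀ i, ⁅cartan n i, y⁆ = (-(α i : ℂ)) • y) {k : ℕ} {w : W} (hw : w ∈ descSpan ρ v k) :
    ρ y w ∈ descSpan ρ v (k + 1) := by
  refine Submodule.span_induction (p := fun w _ => ρ y w ∈ descSpan ρ v (k + 1)) ?_ ?_ ?_ ?_ hw
  · rintro w ⟨j, hj, δ, h⟩
    exact Submodule.subset_span ⟨j + 1, by omega, δ + α, h.step hα hy⟩
  · rw [map_zero]; exact zero_mem _
  · intro x z _ _ hx hz
    rw [map_add]; exact add_mem hx hz
  · intro c x _ hx
    rw [map_smul]; exact Submodule.smul_mem _ c hx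

theorem lie_apply (x y : Lie n) (w : W) : ρ x (ρ y w) = ρ ⁅x, y⁆ w + ρ y (ρ x w) := by
  rw [LieHom.map_lie, Ring.lie_def]
  simp

/-- Moving x past the last lowering operator y leaves ⁅x, y⁆ w with w reached in one step fewer.
Whatever its triangular components are, a negative one costs just the step that is to spare, and the
others preserve the filtration by induction. -/
theorem borel_mem_descSpan (hv : IsHighest ρ lam v) (k : ℕ) {x : Lie n}
    (hx : x ∈ posRootVectors n ∨ ∃ i, x = cartan n i) {w : W} (hw : w ∈ descSpan ρ v k) :
    ρ x w ∈ descSpan ρ v k := by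
  induction k generalizing x w with
  | zero =>
    refine Submodule.span_induction (p := fun w _ => ρ x w ∈ descSpan ρ v 0) ?_ ?_ ?_ ?_ hw
    · rintro w ⟨j, hj, δ, h⟩
      obtain rfl : j = 0 := by omega
      cases h
      rcases hx with hx | ⟨i, rfl⟩
      · rw [hv.1 x hx]; exact zero_mem _
      · rw [hv.2 i]
        exact Submodule.smul_mem _ _ (Submodule.subset_span ⟨0, le_rfl, 0, .base⟩)
    · rw [map_zero]; exact zero_mem _
    · intro x z _ _ hx hz
      rw [map_add]; exact add_mem hx hz
    · intro c x _ hx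
      rw [map_smul]; exact Submodule.smul_mem _ c hx
  | succ k ih =>
    refine Submodule.span_induction (p := fun w _ => ρ x w ∈ descSpan ρ v (k + 1)) ?_ ?_ ?_ ?_ hw
    · rintro w ⟨j, hj, δ, h⟩
      rcases Nat.lt_or_ge j (k + 1) with hj' | hj'
      · exact descSpan_mono (Nat.le_succ k)
          (ih hx (Submodule.subset_span ⟨j, by omega, δ, h⟩))
      obtain rfl : j = k + 1 := by omega
      cases h with
      | @step _ δ α w y h hα hy =>
        have hw : w ∈ descSpan ρ v k := Submodule.subset_span ⟨k, le_rfl, δ, h⟩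
        rw [lie_apply]
        refine add_mem ?_ (neg_mem_descSpan hα hy (ih hx hw))
        refine Lie_induction (p := fun z => ρ z w ∈ descSpan ρ v (k + 1)) ?_ ?_ ?_ ?_ ?_ ?_ ⁅x, y⁆
        · rw [map_zero]; exact zero_mem _
        · intro a b ha hb
          rw [map_add]; exact add_mem ha hb
        · intro c a ha
          rw [map_smul]; exact Submodule.smul_mem _ c ha
        · exact fun i => descSpan_mono (Nat.le_succ k) (ih (Or.inr ⟨i, rfl⟩) hw)
        · exact fun z hz => descSpan_mono (Nat.le_succ k) (ih (Or.inl hz) hw)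
        · exact fun α hα z hz => neg_mem_descSpan hα hz hw
    · rw [map_zero]; exact zero_mem _
    · intro x z _ _ hx hz
      rw [map_add]; exact add_mem hx hz
    · intro c x _ hx
      rw [map_smul]; exact Submodule.smul_mem _ c hx

/-- The span of all descendants of a highest weight vector is a submodule. -/
theorem apply_mem_span_descendant (hv : IsHighest ρ lam v) (x : Lie n) {w : W}
    (hw : w ∈ Submodule.span ℂ {w | ∃ k δ, Descendant ρ v k δ w}) :
    ρ x w ∈ Submodule.span ℂ {w | ∃ k δ, Descendant ρ v k δ w} := by
  have hle : ∀ k, descSpan ρ v k ≤ Submodule.span ℂ {w | ∃ k δ, Descendant ρ v k δ w} :=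
    fun k => Submodule.span_mono fun _ ⟨j, _, δ, h⟩ => ⟨j, δ, h⟩
  refine Submodule.span_induction
    (p := fun w _ => ρ x w ∈ Submodule.span ℂ {w | ∃ k δ, Descendant ρ v k δ w}) ?_ ?_ ?_ ?_ hw
  · rintro w ⟨k, δ, h⟩
    have hw : w ∈ descSpan ρ v k := Submodule.subset_span ⟨k, le_rfl, δ, h⟩
    refine Lie_induction (p := fun z => ρ z w ∈ _) ?_ ?_ ?_ ?_ ?_ ?_ x
    · rw [map_zero]; exact zero_mem _
    · intro a b ha hb
      rw [map_add]; exact add_mem ha hb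
    · intro c a ha
      rw [map_smul]; exact Submodule.smul_mem _ c ha
    · exact fun i => hle k (borel_mem_descSpan hv k (Or.inr ⟨i, rfl⟩) hw)
    · exact fun z hz => hle k (borel_mem_descSpan hv k (Or.inl hz) hw)
    · exact fun α hα z hz => hle (k + 1) (neg_mem_descSpan hα hz hw)
  · rw [map_zero]; exact zero_mem _
  · intro x z _ _ hx hz
    rw [map_add]; exact add_mem hx hz
  · intro c x _ hx
    rw [map_smul]; exact Submodule.smul_mem _ c hx

theorem Descendant.weight (hv : IsHighest ρ lam v) {k : ℕ} {δ : Fin n → ℤ} {w : W}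
    (h : Descendant ρ v k δ w) (i : Fin n) :
    ρ (cartan n i) w = (((lam - δ) i : ℤ) : ℂ) • w := by
  induction h with
  | base => simpa using hv.2 i
  | @step k δ α w y h hα hy ih =>
    rw [lie_apply, ih, hy i, map_smul, map_smul, LinearMap.smul_apply, ← add_smul]
    congr 1
    push_cast [Pi.sub_apply, Pi.add_apply]
    ring

/-! ### The cone spanned by the positive roots -/

/-- The cone spanned by the positive roots. -/
def cone (n : ℕ) : AddSubmonoid (Fin n → ℤ) := AddSubmonoid.closure (posRoots n)

theorem Descendant.mem_cone {k : ℕ} {δ : Fin n → ℤ} {w : W} (h : Descendant ρ v k δ w) :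
    δ ∈ cone n := by
  induction h with
  | base => exact zero_mem _
  | step _ hα _ ih => exact add_mem ih (AddSubmonoid.subset_closure hα)

theorem sum_mul_eps (κ : Fin n → ℤ) (i : Fin n) : ∑ j, κ j * eps i j = κ i := by
  simp [eps, Pi.single_apply]

/-- A strictly dominant functional is positive on the positive roots. -/
theorem pairing_posRoots_pos {κ : Fin n → ℤ} (hκ : StrictAnti κ) (hpos : ∀ i, 0 < κ i)
    {α : Fin n → ℤ} (hα : α ∈ posRoots n) : 0 < ∑ i, κ i * α i := by
  rcases hα with ⟨i, rfl⟩ | ⟨i, j, hij, rfl | rfl⟩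
  · rw [sum_mul_eps]; exact hpos i
  · simp only [Pi.add_apply, mul_add, Finset.sum_add_distrib, sum_mul_eps]
    exact add_pos (hpos i) (hpos j)
  · simp only [Pi.sub_apply, mul_sub, Finset.sum_sub_distrib, sum_mul_eps]
    exact sub_pos.2 (hκ hij)

/-- This shows that the cone is pointed. With κ = `rho n` it serves as a height; in the character
formula it is applied to a sum of two strictly dominant exponents. -/
theorem pairing_cone {κ : Fin n → ℤ} (hκ : StrictAnti κ) (hpos : ∀ i, 0 < κ i)
    {δ : Fin n → ℤ} (hδ : δ ∈ cone n) : δ = 0 ∨ 0 < ∑ i, κ i * δ i := by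
  unfold cone at hδ
  induction hδ using AddSubmonoid.closure_induction with
  | mem α hα => exact Or.inr (pairing_posRoots_pos hκ hpos hα)
  | zero => exact Or.inl rfl
  | add x y _ _ hx hy =>
    rcases hx with rfl | hx <;> rcases hy with rfl | hy
    · left; simp
    · right; simpa using hy
    · right; simpa using hx
    · right
      simp only [Pi.add_apply, mul_add, Finset.sum_add_distrib]
      exact add_pos hx hy

theorem rho_strictAnti (n : ℕ) : StrictAnti (rho n) := fun i j h => by
  have : (i : ℕ) < j := h
  simp only [rho]; omega

theorem rho_pos (i : Fin n) : 0 < rho n i := by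
  have := i.isLt
  simp only [rho]; omega

theorem Descendant.height {k : ℕ} {δ : Fin n → ℤ} {w : W} (h : Descendant ρ v k δ w) :
    δ = 0 ∧ w = v ∨ 0 < ∑ i, rho n i * δ i := by
  cases h with
  | base => exact Or.inl ⟨rfl, rfl⟩
  | step h hα hy =>
    right
    simp only [Pi.add_apply, mul_add, Finset.sum_add_distrib]
    have h1 := pairing_posRoots_pos (rho_strictAnti n) rho_pos hα
    rcases pairing_cone (rho_strictAnti n) rho_pos h.mem_cone with h2 | h2
    · simpa [h2] using h1
    · exact add_pos h2 h1

end HighestWeight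

end TypeB

end

noncomputable section

namespace TypeB

attribute [local instance 100] LieRing.ofAssociativeRing

/-! ### The Verma module and its simple quotient -/

section Verma

variable {n : ℕ}

/-- By the universal property, the identity of the enveloping algebra factors through the subalgebra
generated by the Lie algebra. -/
theorem adjoin_range_toEnv : Algebra.adjoin ℂ (Set.range (toEnv n)) = ⊤ := by
  set S := Algebra.adjoin ℂ (Set.range (toEnv n)) with hS
  have hmem : ∀ x, toEnv n x ∈ S := fun x => Algebra.subset_adjoin ⟨x, rfl⟩
  let f : Lie n →ₗ⁅ℂ⁆ S :=
    { toFun := fun x => ⟨toEnv n x, hmem x⟩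
      map_add' := fun x y => Subtype.ext (map_add (UniversalEnvelopingAlgebra.ι ℂ) x y)
      map_smul' := fun c x => Subtype.ext (map_smul (UniversalEnvelopingAlgebra.ι ℂ) c x)
      map_lie' := fun {x y} => Subtype.ext (LieHom.map_lie (UniversalEnvelopingAlgebra.ι ℂ) x y) }
  have hid : S.val.comp (UniversalEnvelopingAlgebra.lift ℂ f) = AlgHom.id ℂ (Env n) := by
    apply UniversalEnvelopingAlgebra.hom_ext
    ext x
    simp [f, toEnv]
  refine eq_top_iff.2 fun u _ => ?_
  have := congrArg (fun g : Env n →ₐ[ℂ] Env n => g u) hid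
  simp only [AlgHom.comp_apply, AlgHom.id_apply] at this
  rw [← this]
  exact Subtype.property _

section EnvModule

variable (n) (W : Type*) [AddCommGroup W] [Module ℂ W] [Module (Env n) W]
  [IsScalarTower ℂ (Env n) W]

/-- The action of the Lie algebra on a module over its enveloping algebra. -/
def envRep : Lie n →ₗ⁅ℂ⁆ Module.End ℂ W :=
  (AlgHom.toLieHom (Algebra.lsmul ℂ ℂ W : Env n →ₐ[ℂ] Module.End ℂ W)).comp
    (UniversalEnvelopingAlgebra.ι ℂ)

@[simp] theorem envRep_apply (x : Lie n) (w : W) : envRep n W x w = toEnv n x • w := rfl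

variable {n W}

theorem env_smul_mem {p : Submodule ℂ W} (hp : ∀ (x : Lie n), ∀ w ∈ p, toEnv n x • w ∈ p)
    (u : Env n) {w : W} (hw : w ∈ p) : u • w ∈ p := by
  have hu : u ∈ Algebra.adjoin ℂ (Set.range (toEnv n)) := by rw [adjoin_range_toEnv]; trivial
  induction hu using Algebra.adjoin_induction generalizing w with
  | mem u hu => obtain ⟨x, rfl⟩ := hu; exact hp x w hw
  | algebraMap c => rw [algebraMap_smul]; exact p.smul_mem c hw
  | add a b _ _ ha hb => rw [add_smul]; exact add_mem (ha hw) (hb hw)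
  | mul a b _ _ ha hb => rw [mul_smul]; exact ha (hb hw)

theorem span_descendant_eq_top {lam : Fin n → ℤ} {v : W} (hv : IsHighest (envRep n W) lam v)
    (hgen : Submodule.span (Env n) {v} = ⊤) :
    Submodule.span ℂ {w | ∃ k δ, Descendant (envRep n W) v k δ w} = ⊤ := by
  refine eq_top_iff.2 fun w _ => ?_
  have hw : w ∈ Submodule.span (Env n) {v} := by rw [hgen]; trivial
  obtain ⟨u, rfl⟩ := Submodule.mem_span_singleton.1 hw
  refine env_smul_mem (fun x w hw => ?_) u (Submodule.subset_span ⟨0, 0, .base⟩)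
  exact apply_mem_span_descendant hv x hw

end EnvModule

variable (lam : Fin n → ℤ)

/-- The canonical generator of the Verma module. -/
def vermaGen : Verma lam := Submodule.Quotient.mk 1

theorem smul_vermaGen (u : Env n) : u • vermaGen lam = Submodule.Quotient.mk u := by
  rw [vermaGen, ← Submodule.Quotient.mk_smul, smul_eq_mul, mul_one]

theorem span_vermaGen : Submodule.span (Env n) {vermaGen lam} = ⊤ := by
  refine eq_top_iff.2 fun w _ => ?_
  obtain ⟨u, rfl⟩ := Submodule.Quotient.mk_surjective _ w
  rw [← smul_vermaGen]
  exact Submodule.smul_mem _ _ (Submodule.mem_span_singleton_self _)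

theorem isHighest_vermaGen : IsHighest (envRep n (Verma lam)) lam (vermaGen lam) := by
  refine ⟨fun x hx => ?_, fun i => ?_⟩
  · rw [envRep_apply, smul_vermaGen, Submodule.Quotient.mk_eq_zero]
    exact Submodule.subset_span (Or.inl ⟨x, hx, rfl⟩)
  · rw [envRep_apply, smul_vermaGen, ← sub_eq_zero]
    have : (lam i : ℂ) • vermaGen lam = algebraMap ℂ (Env n) (lam i : ℂ) • vermaGen lam := by
      rw [algebraMap_smul]
    rw [this, smul_vermaGen, ← Submodule.Quotient.mk_sub, Submodule.Quotient.mk_eq_zero]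
    exact Submodule.subset_span (Or.inr ⟨i, rfl⟩)

/-- The image in the simple quotient of the generator of the Verma module. -/
def simpleGen : Simple lam := Submodule.Quotient.mk (vermaGen lam)

theorem isHighest_simpleGen : IsHighest (envRep n (Simple lam)) lam (simpleGen lam) := by
  have h := isHighest_vermaGen lam
  refine ⟨fun x hx => ?_, fun i => ?_⟩
  · have := h.1 x hx
    rw [envRep_apply] at this ⊢
    rw [simpleGen, ← Submodule.Quotient.mk_smul, this, Submodule.Quotient.mk_zero]
  · have := h.2 i
    rw [envRep_apply] at this ⊢
    rw [simpleGen, ← Submodule.Quotient.mk_smul, this]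
    rfl

theorem span_simpleGen : Submodule.span (Env n) {simpleGen lam} = ⊤ := by
  refine eq_top_iff.2 fun w _ => ?_
  obtain ⟨w, rfl⟩ := Submodule.Quotient.mk_surjective _ w
  obtain ⟨u, rfl⟩ := Submodule.Quotient.mk_surjective _ w
  rw [← smul_vermaGen, Submodule.Quotient.mk_smul]
  exact Submodule.smul_mem _ _ (Submodule.mem_span_singleton_self _)

/-- Let f be the Cartan element paired with `rho n`. Every vector is c v + y with y in the span K of
descendants of positive height, and a polynomial in f kills y but not v. A submodule containing such
a vector with c ≠ 0 therefore contains v and is everything, so all proper submodules lie in K, which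
misses v. -/
theorem vermaRadical_ne_top (h0 : vermaGen lam ≠ 0) : vermaRadical lam ≠ ⊤ := by
  set ρ := envRep n (Verma lam) with hρ
  set v := vermaGen lam with hvdef
  have hv : IsHighest ρ lam v := isHighest_vermaGen lam
  let f : Module.End ℂ (Verma lam) := ρ (∑ i, (rho n i : ℂ) • cartan n i)
  set Λ : ℂ := ∑ i, (rho n i : ℂ) * lam i with hΛ
  let K : Submodule ℂ (Verma lam) :=
    Submodule.span ℂ {w | ∃ k δ, Descendant ρ v k δ w ∧ 0 < ∑ i, rho n i * δ i}
  have hf : ∀ {k δ w}, Descendant ρ v k δ w → f w = (Λ - ((∑ i, rho n i * δ i : ℤ) : ℂ)) • w := by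
    intro k δ w h
    simp only [f, map_sum, map_smul, LinearMap.sum_apply, LinearMap.smul_apply, h.weight hv,
      smul_smul]
    rw [← Finset.sum_smul, hΛ]
    push_cast
    rw [← Finset.sum_sub_distrib]
    congr 1
    refine Finset.sum_congr rfl fun i _ => ?_
    push_cast [Pi.sub_apply]
    ring
  have hfv : f v = Λ • v := by simpa using hf (.base)
  -- a polynomial in `f` that kills a given element of `K` but not the generator
  have hK : ∀ w ∈ K, ∃ p : Polynomial ℂ, p.eval Λ ≠ 0 ∧ Polynomial.aeval f p w = 0 := by
    intro w hw
    refine Submodule.span_induction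
      (p := fun w _ => ∃ p : Polynomial ℂ, p.eval Λ ≠ 0 ∧ Polynomial.aeval f p w = 0) ?_ ?_ ?_ ?_ hw
    · rintro w ⟨k, δ, h, hδ⟩
      refine ⟨Polynomial.X - Polynomial.C (Λ - ((∑ i, rho n i * δ i : ℤ) : ℂ)), ?_, ?_⟩
      · simp only [Polynomial.eval_sub, Polynomial.eval_X, Polynomial.eval_C, sub_sub_cancel]
        exact_mod_cast hδ.ne'
      · rw [map_sub, Polynomial.aeval_X, Polynomial.aeval_C, LinearMap.sub_apply, hf h,
          Module.algebraMap_end_apply, sub_self]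
    · exact ⟨1, by simp, by simp⟩
    · rintro x y _ _ ⟨p, hp, hpx⟩ ⟨r, hr, hry⟩
      refine ⟨p * r, by rw [Polynomial.eval_mul]; exact mul_ne_zero hp hr, ?_⟩
      rw [map_add, map_mul, Module.End.mul_apply, Module.End.mul_apply, hry, map_zero, add_zero,
        ← Module.End.mul_apply, ← map_mul, mul_comm, map_mul, Module.End.mul_apply, hpx, map_zero]
    · rintro c x _ ⟨p, hp, hpx⟩
      exact ⟨p, hp, by rw [map_smul, hpx, smul_zero]⟩
  have hpv : ∀ p : Polynomial ℂ, Polynomial.aeval f p v = p.eval Λ • v := by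
    intro p
    by_cases h : v = 0
    · rw [h]; simp
    · exact Module.End.aeval_apply_of_hasEigenvector
        ⟨Module.End.mem_eigenspace_iff.2 hfv, h⟩
  have hvK : v ∉ K := by
    intro h
    obtain ⟨p, hp, hpv'⟩ := hK v h
    rw [hpv] at hpv'
    exact (smul_ne_zero hp h0) hpv'
  have hdecomp : ∀ w : Verma lam, ∃ c : ℂ, ∃ y ∈ K, w = c • v + y := by
    intro w
    have hw : w ∈ Submodule.span ℂ {w | ∃ k δ, Descendant ρ v k δ w} := by
      rw [span_descendant_eq_top hv (span_vermaGen lam)]; trivial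
    refine Submodule.span_induction (p := fun w _ => ∃ c : ℂ, ∃ y ∈ K, w = c • v + y) ?_ ?_ ?_ ?_ hw
    · rintro w ⟨k, δ, h⟩
      rcases h.height with ⟨_, rfl⟩ | h'
      · exact ⟨1, 0, zero_mem _, by simp⟩
      · exact ⟨0, w, Submodule.subset_span ⟨k, δ, h, h'⟩, by simp⟩
    · exact ⟨0, 0, zero_mem _, by simp⟩
    · rintro x z _ _ ⟨c, y, hy, rfl⟩ ⟨c', y', hy', rfl⟩
      exact ⟨c + c', y + y', add_mem hy hy', by rw [add_smul]; abel⟩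
    · rintro a x _ ⟨c, y, hy, rfl⟩
      exact ⟨a * c, a • y, K.smul_mem a hy, by rw [smul_add, mul_smul]⟩
  have hfN : ∀ (N : Submodule (Env n) (Verma lam)) (p : Polynomial ℂ), ∀ w ∈ N,
      Polynomial.aeval f p w ∈ N := by
    intro N p w hw
    induction p using Polynomial.induction_on' with
    | add p r hp hr => rw [map_add]; exact add_mem hp hr
    | monomial k a =>
      rw [Polynomial.aeval_monomial, Module.End.mul_apply, Module.algebraMap_end_apply]
      refine N.smul_of_tower_mem a ?_
      induction k with
      | zero => simpa using hw
      | succ k ih =>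
        rw [pow_succ', Module.End.mul_apply]
        exact N.smul_mem (toEnv n (∑ i, (rho n i : ℂ) • cartan n i)) ih
  have hN : ∀ N : Submodule (Env n) (Verma lam), N ≠ ⊤ → ∀ w ∈ N, w ∈ K := by
    intro N hN w hw
    obtain ⟨c, y, hy, rfl⟩ := hdecomp w
    rcases eq_or_ne c 0 with rfl | hc
    · simpa using hy
    · exfalso
      apply hN
      obtain ⟨p, hp, hpy⟩ := hK y hy
      have h1 := hfN N p _ hw
      rw [map_add, hpy, add_zero, map_smul, hpv, smul_smul] at h1
      have h2 : v ∈ N := by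
        have := N.smul_of_tower_mem (c * p.eval Λ)⁻¹ h1
        rwa [smul_smul, inv_mul_cancel₀ (mul_ne_zero hc hp), one_smul] at this
      rw [eq_top_iff, ← span_vermaGen lam, Submodule.span_le]
      simpa using h2
  -- K is only a complex subspace; the supremum of submodules is bounded by the largest submodule
  -- inside K.
  let K' : Submodule (Env n) (Verma lam) :=
    { carrier := {w | ∀ u : Env n, u • w ∈ K}
      zero_mem' := fun u => by rw [smul_zero]; exact zero_mem _
      add_mem' := fun ha hb u => by rw [smul_add]; exact add_mem (ha u) (hb u)
      smul_mem' := fun r w hw u => by rw [← mul_smul]; exact hw _ }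
  have hle : vermaRadical lam ≤ K' := sSup_le fun N hN' w hw u => hN N hN' _ (N.smul_mem u hw)
  intro htop
  have : v ∈ K' := hle (htop ▸ Submodule.mem_top)
  exact hvK (by simpa using this 1)

theorem simpleGen_ne_zero (h0 : vermaGen lam ≠ 0) : simpleGen lam ≠ 0 := by
  intro h
  apply vermaRadical_ne_top lam h0
  rw [simpleGen, Submodule.Quotient.mk_eq_zero] at h
  rw [eq_top_iff, ← span_vermaGen lam, Submodule.span_le]
  simpa using h

/-- If there is a finite-dimensional representation with a highest weight vector of weight `lam`,
then the Verma module is nonzero and `L(lam)` is finite-dimensional. -/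
theorem finiteDimensional_simple {W : Type*} [AddCommGroup W] [Module ℂ W] [FiniteDimensional ℂ W]
    {lam : Fin n → ℤ} {ρ : Lie n →ₗ⁅ℂ⁆ Module.End ℂ W} {v : W} (hv : IsHighest ρ lam v)
    (hv0 : v ≠ 0) : vermaGen lam ≠ 0 ∧ FiniteDimensional ℂ (Simple lam) := by
  let A : Env n →ₐ[ℂ] Module.End ℂ W := UniversalEnvelopingAlgebra.lift ℂ ρ
  have hA : ∀ x, A (toEnv n x) = ρ x := fun x => UniversalEnvelopingAlgebra.lift_ι_apply ℂ ρ x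
  let I : Submodule (Env n) (Env n) :=
    { carrier := {u | A u v = 0}
      zero_mem' := by simp
      add_mem' := fun {a b} ha hb => by
        have ha' : A a v = 0 := ha
        have hb' : A b v = 0 := hb
        simp [ha', hb']
      smul_mem' := fun r u hu => by
        have hu' : A u v = 0 := hu
        simp [hu'] }
  have hI : vermaIdeal lam ≤ I := by
    refine Submodule.span_le.2 ?_
    rintro _ (⟨x, hx, rfl⟩ | ⟨i, rfl⟩)
    · change A _ v = 0
      rw [hA, hv.1 x hx]
    · change A _ v = 0
      rw [map_sub, hA, LinearMap.sub_apply, hv.2, AlgHom.commutes, Module.algebraMap_end_apply,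
        sub_self]
  have hI1 : (1 : Env n) ∉ I := by
    intro h
    have h' : A 1 v = 0 := h
    rw [map_one] at h'
    exact hv0 h'
  refine ⟨fun h => hI1 (hI ((Submodule.Quotient.mk_eq_zero _).1 h)), ?_⟩
  let N : Submodule (Env n) (Verma lam) := I.map (vermaIdeal lam).mkQ
  have hN : N ≠ ⊤ := by
    intro h
    have h1 : vermaGen lam ∈ N := h ▸ Submodule.mem_top
    obtain ⟨u, hu, hu1⟩ := h1
    have h2 : u - 1 ∈ vermaIdeal lam := (Submodule.Quotient.eq _).1 hu1
    exact hI1 (by simpa using sub_mem hu (hI h2))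
  have hNle : N ≤ vermaRadical lam := le_sSup hN
  let φ : Env n →ₗ[ℂ] W := (LinearMap.applyₗ v).comp A.toLinearMap
  let ψ : Env n →ₗ[ℂ] Simple lam :=
    ((vermaRadical lam).mkQ.restrictScalars ℂ).comp ((vermaIdeal lam).mkQ.restrictScalars ℂ)
  have hψ : Function.Surjective ψ :=
    ((vermaRadical lam).mkQ_surjective).comp ((vermaIdeal lam).mkQ_surjective)
  -- What annihilates v in W also vanishes in `Simple lam`, because the image of the annihilator in
  -- the Verma module is a proper submodule. So `Simple lam` is a quotient of the cyclic submodule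
  -- generated by v.
  have hker : LinearMap.ker φ ≤ LinearMap.ker ψ := by
    intro u hu
    have hu' : u ∈ I := hu
    have : (vermaIdeal lam).mkQ u ∈ vermaRadical lam := hNle ⟨u, hu', rfl⟩
    exact (Submodule.Quotient.mk_eq_zero _).2 this
  have h1 : FiniteDimensional ℂ (Env n ⧸ LinearMap.ker φ) :=
    LinearEquiv.finiteDimensional φ.quotKerEquivRange.symm
  refine Module.Finite.of_surjective ((LinearMap.ker φ).liftQ ψ hker) fun w => ?_
  obtain ⟨u, rfl⟩ := hψ w
  exact ⟨Submodule.Quotient.mk u, rfl⟩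

end Verma

end TypeB

end

noncomputable section

namespace TypeB

attribute [local instance 100] LieRing.ofAssociativeRing

/-! ### Finite-dimensional representations with given highest weight -/

section FiniteDimensionalRep

variable {n : ℕ}

open TensorProduct

/-- `lam` is the weight of a highest weight vector of a finite-dimensional representation. -/
def IsFDWeight (lam : Fin n → ℤ) : Prop :=
  ∃ (W : Type) (_ : AddCommGroup W) (_ : Module ℂ W) (_ : FiniteDimensional ℂ W)
    (ρ : Lie n →ₗ⁅ℂ⁆ Module.End ℂ W) (v : W), IsHighest ρ lam v ∧ v ≠ 0

/-- The tensor product of two representations. -/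
def tensorRep {W W' : Type*} [AddCommGroup W] [Module ℂ W] [AddCommGroup W'] [Module ℂ W']
    (ρ : Lie n →ₗ⁅ℂ⁆ Module.End ℂ W) (ρ' : Lie n →ₗ⁅ℂ⁆ Module.End ℂ W') :
    Lie n →ₗ⁅ℂ⁆ Module.End ℂ (W ⊗[ℂ] W') where
  toFun x := TensorProduct.map (ρ x) LinearMap.id + TensorProduct.map LinearMap.id (ρ' x)
  map_add' x y := by
    rw [map_add, map_add, TensorProduct.map_add_left, TensorProduct.map_add_right]
    abel
  map_smul' c x := by
    rw [map_smul, map_smul, TensorProduct.map_smul_left, TensorProduct.map_smul_right]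
    simp
  map_lie' {x y} := by
    apply TensorProduct.ext'
    intro a b
    simp only [LieHom.map_lie, Ring.lie_def, LinearMap.add_apply, TensorProduct.map_tmul,
      LinearMap.id_apply, LinearMap.sub_apply, Module.End.mul_apply, map_add,
      TensorProduct.sub_tmul, TensorProduct.tmul_sub]
    abel

theorem IsFDWeight.add {lam lam' : Fin n → ℤ} (h : IsFDWeight lam) (h' : IsFDWeight lam') :
    IsFDWeight (lam + lam') := by
  obtain ⟨W, _, _, _, ρ, v, hv, hv0⟩ := h
  obtain ⟨W', _, _, _, ρ', v', hv', hv0'⟩ := h'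
  refine ⟨W ⊗[ℂ] W', inferInstance, inferInstance, inferInstance, tensorRep ρ ρ', v ⊗ₜ v',
    ⟨fun x hx => ?_, fun i => ?_⟩, ?_⟩
  · change TensorProduct.map (ρ x) LinearMap.id (v ⊗ₜ v') +
      TensorProduct.map LinearMap.id (ρ' x) (v ⊗ₜ v') = 0
    simp [hv.1 x hx, hv'.1 x hx]
  · change TensorProduct.map (ρ _) LinearMap.id (v ⊗ₜ v') +
      TensorProduct.map LinearMap.id (ρ' _) (v ⊗ₜ v') = _
    rw [TensorProduct.map_tmul, TensorProduct.map_tmul, hv.2, hv'.2, LinearMap.id_apply,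
      LinearMap.id_apply, TensorProduct.tmul_smul, ← TensorProduct.smul_tmul', ← add_smul]
    push_cast [Pi.add_apply]
    rfl
  -- A pair of functionals not vanishing on v and v' detects v ⊗ v'.
  · intro h
    obtain ⟨φ, hφ⟩ := not_forall.1 (mt (Module.forall_dual_apply_eq_zero_iff ℂ v).1 hv0)
    obtain ⟨ψ, hψ⟩ := not_forall.1 (mt (Module.forall_dual_apply_eq_zero_iff ℂ v').1 hv0')
    have h1 := congrArg (LinearMap.mul' ℂ ℂ ∘ₗ TensorProduct.map φ ψ) h
    simp only [LinearMap.comp_apply, TensorProduct.map_tmul, LinearMap.mul'_apply,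
      map_zero] at h1
    exact mul_ne_zero hφ hψ h1

theorem IsFDWeight.nsmul {lam : Fin n → ℤ} (h : IsFDWeight lam) (m : ℕ) :
    IsFDWeight ((m + 1) • lam) := by
  induction m with
  | zero => simpa using h
  | succ m ih => rw [succ_nsmul]; exact ih.add h

/-! ### Exterior powers inside tensor powers of the vector representation -/

/-- The action of a matrix on the `t`-th tensor factor, in coordinates. -/
def factorAct {s : ℕ} (t : Fin s) (X : Matrix (Pos n) (Pos n) ℂ) :
    Module.End ℂ ((Fin s → Pos n) → ℂ) where
  toFun f := fun i => ∑ b, X (i t) b * f (Function.update i t b)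
  map_add' f g := by
    ext i
    simp only [Pi.add_apply, mul_add, Finset.sum_add_distrib]
  map_smul' c f := by
    ext i
    simp only [Pi.smul_apply, smul_eq_mul, RingHom.id_apply, Finset.mul_sum]
    exact Finset.sum_congr rfl fun b _ => by ring

theorem factorAct_apply {s : ℕ} (t : Fin s) (X : Matrix (Pos n) (Pos n) ℂ)
    (f : (Fin s → Pos n) → ℂ) (i : Fin s → Pos n) :
    factorAct t X f i = ∑ b, X (i t) b * f (Function.update i t b) := rfl

theorem factorAct_mul {s : ℕ} (t : Fin s) (X Y : Matrix (Pos n) (Pos n) ℂ) :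
    factorAct t (X * Y) = factorAct t X * factorAct t Y := by
  refine LinearMap.ext fun f => funext fun i => ?_
  simp only [factorAct_apply, Module.End.mul_apply, Matrix.mul_apply,
    Function.update_self, Function.update_idem, Finset.mul_sum, Finset.sum_mul]
  rw [Finset.sum_comm]
  exact Finset.sum_congr rfl fun b _ => Finset.sum_congr rfl fun c _ => by ring

theorem factorAct_comm {s : ℕ} {t u : Fin s} (htu : t ≠ u) (X Y : Matrix (Pos n) (Pos n) ℂ) :
    factorAct t X * factorAct u Y = factorAct u Y * factorAct t X := by
  refine LinearMap.ext fun f => funext fun i => ?_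
  simp only [factorAct_apply, Module.End.mul_apply,
    Function.update_of_ne htu, Function.update_of_ne htu.symm, Finset.mul_sum]
  rw [Finset.sum_comm]
  refine Finset.sum_congr rfl fun b _ => Finset.sum_congr rfl fun c _ => ?_
  rw [Function.update_comm htu]
  ring

/-- The `s`-th tensor power of the vector representation, in coordinates. -/
def tensorPowRep (n s : ℕ) : Lie n →ₗ⁅ℂ⁆ Module.End ℂ ((Fin s → Pos n) → ℂ) where
  toFun X := ∑ t, factorAct t X.1
  map_add' X Y := by
    rw [← Finset.sum_add_distrib]
    refine Finset.sum_congr rfl fun t _ => ?_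
    refine LinearMap.ext fun f => funext fun i => ?_
    simp only [coe_add_Lie, factorAct_apply, LinearMap.add_apply,
      Pi.add_apply, Matrix.add_apply, add_mul, Finset.sum_add_distrib]
  map_smul' c X := by
    rw [RingHom.id_apply, Finset.smul_sum]
    refine Finset.sum_congr rfl fun t _ => ?_
    refine LinearMap.ext fun f => funext fun i => ?_
    simp only [coe_smul_Lie, factorAct_apply, LinearMap.smul_apply,
      Pi.smul_apply, Matrix.smul_apply, smul_eq_mul, Finset.mul_sum, mul_assoc]
  map_lie' {X Y} := by
    rw [Ring.lie_def, Finset.sum_mul_sum, Finset.sum_mul_sum, Finset.sum_comm (s := Finset.univ)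
      (t := Finset.univ) (f := fun i j => factorAct i Y.1 * factorAct j X.1),
      ← Finset.sum_sub_distrib]
    refine Finset.sum_congr rfl fun t _ => ?_
    rw [← Finset.sum_sub_distrib, Finset.sum_eq_single t]
    · rw [← factorAct_mul, ← factorAct_mul]
      refine LinearMap.ext fun f => funext fun i => ?_
      simp only [LieSubalgebra.coe_bracket, Ring.lie_def, factorAct_apply,
        LinearMap.sub_apply, Pi.sub_apply, Matrix.sub_apply, sub_mul,
        Finset.sum_sub_distrib]
    · intro u _ hu
      rw [factorAct_comm hu.symm, sub_self]
    · simp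

/-- The antisymmetric tensor `e_1 ∧ ⋯ ∧ e_s`, in coordinates. -/
def wedgeVec {s : ℕ} (hs : s ≤ n) (i : Fin s → Pos n) : ℂ :=
  Matrix.det (Matrix.of fun t j : Fin s =>
    if i t = Sum.inr (Sum.inl (Fin.castLE hs j)) then (1 : ℂ) else 0)

/-- Jacobi's formula: the derivative of det at A in the direction A C is tr(A C adj A) = tr C · det
A. -/
theorem sum_det_updateRow {s : ℕ} (A C : Matrix (Fin s) (Fin s) ℂ) :
    ∑ t, (A.updateRow t ((A * C) t)).det = C.trace * A.det := by
  have h : ∀ t, (A.updateRow t ((A * C) t)).det = ∑ j, (A * C) t j * A.adjugate j t := by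
    intro t
    rw [← Matrix.det_transpose, ← Matrix.updateCol_transpose, ← Matrix.cramer_apply,
      Matrix.cramer_eq_adjugate_mulVec, ← Matrix.adjugate_transpose]
    simp only [Matrix.mulVec, dotProduct, Matrix.transpose_apply]
    exact Finset.sum_congr rfl fun j _ => mul_comm _ _
  have h2 : ∑ t, (A.updateRow t ((A * C) t)).det = (A * C * A.adjugate).trace := by
    simp only [h, Matrix.trace, Matrix.diag_apply, Matrix.mul_apply (M := A * C)]
  rw [h2, Matrix.trace_mul_comm, ← Matrix.mul_assoc, Matrix.adjugate_mul, Matrix.smul_mul,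
    one_mul, Matrix.trace_smul, smul_eq_mul, mul_comm]

/-- The hypothesis says that X preserves the span of e_1, …, e_s with matrix C there, so X acts on
e_1 ∧ ⋯ ∧ e_s by tr C. Acting on one tensor factor replaces one row of the determinant. -/
theorem tensorPowRep_wedgeVec {s : ℕ} (hs : s ≤ n) (X : Lie n) (C : Matrix (Fin s) (Fin s) ℂ)
    (hC : ∀ a j, X.1 a (Sum.inr (Sum.inl (Fin.castLE hs j))) =
      ∑ l, (if a = Sum.inr (Sum.inl (Fin.castLE hs l)) then (1 : ℂ) else 0) * C l j) :
    tensorPowRep n s X (wedgeVec hs) = C.trace • wedgeVec hs := by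
  ext i
  change (∑ t, factorAct t X.1) (wedgeVec hs) i = _
  rw [LinearMap.sum_apply, Finset.sum_apply, Pi.smul_apply, smul_eq_mul]
  conv_rhs => rw [wedgeVec]
  rw [← sum_det_updateRow]
  refine Finset.sum_congr rfl fun t _ => ?_
  change ∑ b, X.1 (i t) b * wedgeVec hs (Function.update i t b) = _
  set A : Matrix (Fin s) (Fin s) ℂ := Matrix.of fun t j : Fin s =>
    if i t = Sum.inr (Sum.inl (Fin.castLE hs j)) then (1 : ℂ) else 0 with hA
  have h1 : ∀ b, wedgeVec hs (Function.update i t b) = (A.updateRow t fun j =>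
      if b = Sum.inr (Sum.inl (Fin.castLE hs j)) then (1 : ℂ) else 0).det := by
    intro b
    rw [wedgeVec]
    congr 1
    ext u j
    by_cases hu : u = t
    · subst hu; simp
    · simp [hu, hA]
  have h2 : (A * C) t = ∑ b, X.1 (i t) b • fun j =>
      if b = Sum.inr (Sum.inl (Fin.castLE hs j)) then (1 : ℂ) else 0 := by
    ext j
    rw [Finset.sum_apply]
    simp only [Pi.smul_apply, smul_eq_mul, mul_ite, mul_one, mul_zero, Finset.sum_ite_eq',
      Finset.mem_univ, if_true]
    rw [hC, Matrix.mul_apply]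
    simp [hA]
  rw [h2]
  have h3 : ∀ (S : Finset (Pos n)) (c : Pos n → ℂ) (r : Pos n → Fin s → ℂ),
      (A.updateRow t (∑ b ∈ S, c b • r b)).det = ∑ b ∈ S, c b * (A.updateRow t (r b)).det := by
    intro S c r
    induction S using Finset.cons_induction with
    | empty => simpa using Matrix.det_updateRow_smul A t 0 0
    | cons a S ha ih =>
      rw [Finset.sum_cons, Matrix.det_updateRow_add, Matrix.det_updateRow_smul, ih,
        Finset.sum_cons]
  rw [h3]
  exact Finset.sum_congr rfl fun b _ => by rw [h1]

/-- The coordinates of `wt a` add up to at most 1 and those of `eps j` to 1, so α must be a root ε_i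
- ε_l; comparing coordinates gives l = j and a = i. -/
theorem eq_of_wt_eq_eps_add {a : Pos n} {j : Fin n} {α : Fin n → ℤ} (hα : α ∈ posRoots n)
    (h : wt a = eps j + α) : ∃ l < j, a = Sum.inr (Sum.inl l) := by
  have heps : ∀ i : Fin n, ∑ k, eps i k = 1 := fun i => by simp [eps]
  have hsum := congrArg (fun μ : Fin n → ℤ => ∑ k, μ k) h
  have hwt : ∑ k, wt a k ≤ 1 := by
    rcases a with a | a | a <;> simp [wt, heps]
  rcases hα with ⟨i, rfl⟩ | ⟨i, l, hil, rfl | rfl⟩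
  · simp only [Pi.add_apply, Finset.sum_add_distrib, heps] at hsum
    omega
  · simp only [Pi.add_apply, Finset.sum_add_distrib, heps] at hsum
    omega
  · simp only [Pi.add_apply, Pi.sub_apply, Finset.sum_add_distrib, Finset.sum_sub_distrib,
      heps] at hsum
    rcases a with a | a | a
    · simp [wt] at hsum
    · have h1 := congrFun h l
      simp only [wt, eps, Sum.elim_inr, Sum.elim_inl, Pi.add_apply, Pi.sub_apply,
        Pi.single_apply, if_true] at h1
      rw [if_neg hil.ne'] at h1
      have hlj : l = j := by
        by_contra hlj
        rw [if_neg hlj] at h1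
        split_ifs at h1 <;> omega
      subst hlj
      have h2 := congrFun h i
      simp only [wt, eps, Sum.elim_inr, Sum.elim_inl, Pi.add_apply, Pi.sub_apply,
        Pi.single_apply, if_true, hil.ne, if_false] at h2
      refine ⟨i, hil, ?_⟩
      congr 2
      by_contra hai
      rw [if_neg (Ne.symm hai)] at h2
      omega
    · simp only [wt, Sum.elim_inr, Pi.neg_apply, Finset.sum_neg_distrib, heps] at hsum
      omega

/-- A positive root vector sends e_j into the span of the e_l with l < j, so its trace on the span
of e_1, …, e_s is zero, while h_i has trace 1 or 0 there. -/
theorem isFDWeight_wedge {s : ℕ} (hs : s ≤ n) :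
    IsFDWeight (fun i : Fin n => if (i : ℕ) < s then (1 : ℤ) else 0) := by
  refine ⟨(Fin s → Pos n) → ℂ, inferInstance, inferInstance, inferInstance, tensorPowRep n s,
    wedgeVec hs, ⟨fun x hx => ?_, fun i => ?_⟩, ?_⟩
  · obtain ⟨α, hα, hx⟩ := hx
    have hx' : ∀ a (j : Fin s), x.1 a (Sum.inr (Sum.inl (Fin.castLE hs j))) ≠ 0 →
        ∃ l < Fin.castLE hs j, a = Sum.inr (Sum.inl l) := fun a j h =>
      eq_of_wt_eq_eps_add hα (wt_eq_of_apply_ne_zero hx h)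
    rw [tensorPowRep_wedgeVec hs x (Matrix.of fun l j => x.1 (Sum.inr (Sum.inl (Fin.castLE hs l)))
      (Sum.inr (Sum.inl (Fin.castLE hs j))))]
    · have : Matrix.trace (Matrix.of fun l j : Fin s => x.1 (Sum.inr (Sum.inl (Fin.castLE hs l)))
          (Sum.inr (Sum.inl (Fin.castLE hs j)))) = 0 := by
        refine Finset.sum_eq_zero fun j _ => ?_
        by_contra h
        obtain ⟨l, hl, h2⟩ := hx' _ _ h
        simp only [Sum.inr.injEq, Sum.inl.injEq] at h2
        exact absurd h2 hl.ne'
      rw [this, zero_smul]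
    · intro a j
      by_cases h : x.1 a (Sum.inr (Sum.inl (Fin.castLE hs j))) = 0
      · rw [h]
        symm
        refine Finset.sum_eq_zero fun l _ => ?_
        split_ifs with h2
        · subst h2; simp [h]
        · simp
      · obtain ⟨l, hl, rfl⟩ := hx' _ _ h
        have hls : (l : ℕ) < s := lt_of_lt_of_le (Fin.lt_def.1 hl) (by simp [j.isLt.le])
        rw [Finset.sum_eq_single ⟨l, hls⟩]
        · simp
        · intro b _ hb
          rw [if_neg, zero_mul]
          intro h2
          simp only [Sum.inr.injEq, Sum.inl.injEq] at h2
          exact hb (Fin.ext (by simp [h2]))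
        · simp
  · rw [tensorPowRep_wedgeVec hs _ (Matrix.diagonal fun j => if Fin.castLE hs j = i then 1 else 0)]
    · congr 1
      rw [Matrix.trace_diagonal]
      change _ = (((if (i : ℕ) < s then (1 : ℤ) else 0) : ℤ) : ℂ)
      split_ifs with h
      · rw [Finset.sum_eq_single ⟨i, h⟩]
        · simp
        · intro b _ hb
          rw [if_neg]
          rintro rfl
          exact hb (Fin.ext (by simp))
        · simp
      · rw [Finset.sum_eq_zero]
        · simp
        · intro j _
          rw [if_neg]
          rintro rfl
          exact h (by simp)
    · intro a j
      rw [cartan_apply, Finset.sum_eq_single j]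
      · simp only [Matrix.diagonal_apply_eq]
        split_ifs with h1 h2 h2
        · subst h1; simp [wt, eps, h2]
        · subst h1; simp [wt, eps, Ne.symm h2]
        · simp
        · simp
      · intro b _ hb
        rw [Matrix.diagonal_apply_ne _ hb, mul_zero]
      · simp
  · intro h
    have := congrFun h fun t => Sum.inr (Sum.inl (Fin.castLE hs t))
    rw [wedgeVec] at this
    have h1 : (Matrix.of fun t j : Fin s => if (Sum.inr (Sum.inl (Fin.castLE hs t)) : Pos n) =
        Sum.inr (Sum.inl (Fin.castLE hs j)) then (1 : ℂ) else 0) = 1 := by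
      ext t j
      simp [Matrix.one_apply]
    rw [h1, Matrix.det_one] at this
    exact one_ne_zero this

end FiniteDimensionalRep

end TypeB

end

noncomputable section

namespace TypeB

/-! ### Laurent polynomials -/

section Laurent

variable (R : Type*) [CommRing R] {n : ℕ}

/-- The group algebra of the weight lattice. -/
abbrev Laurent (R : Type*) [CommRing R] (n : ℕ) := AddMonoidAlgebra R (Fin n → ℤ)

/-- The unit `e^{ε_i}` of the group algebra. -/
def xU (i : Fin n) : (Laurent R n)ˣ :=
  (AddMonoidAlgebra.of R (Fin n → ℤ)).toHomUnits (Multiplicative.ofAdd (eps i))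

theorem val_xU_zpow (i : Fin n) (m : ℤ) :
    ((xU R i ^ m : (Laurent R n)ˣ) : Laurent R n) = AddMonoidAlgebra.single (m • eps i) 1 := by
  rw [xU, ← map_zpow, ← ofAdd_zsmul]
  rfl

theorem val_xU (i : Fin n) :
    (xU R i : Laurent R n) = AddMonoidAlgebra.single (eps i) 1 := rfl

theorem val_xU_inv (i : Fin n) :
    (((xU R i)⁻¹ : (Laurent R n)ˣ) : Laurent R n) = AddMonoidAlgebra.single (-eps i) 1 := by
  have := val_xU_zpow R i (-1)
  simpa using this

/-- One of `l` and `1 - l`, according to a sign. -/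
def flip (l : ℤ) (s : ℤˣ) : ℤ := if s = 1 then l else 1 - l

/-- The exponent of the monomial of an alternant that belongs to a signed permutation. -/
def altExp (l : Fin n → ℤ) (σ : Equiv.Perm (Fin n)) (p : Fin n → ℤˣ) : Fin n → ℤ :=
  fun a => flip (l (σ.symm a)) (p (σ.symm a))

theorem sum_zsmul_eps (c : Fin n → ℤ) : ∑ i, c i • eps i = c := by
  ext k
  simp [eps, Finset.sum_apply, Pi.single_apply]

/-- Each matrix entry is a sum over a sign, so the determinant becomes a sum over signed
permutations, that is, over the Weyl group. -/
theorem alt_xU_eq_sum (l : Fin n → ℤ) : alt (xU R) l =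
    ∑ σ : Equiv.Perm (Fin n), ∑ p : Fin n → ℤˣ, AddMonoidAlgebra.single (altExp l σ p)
      (((Equiv.Perm.sign σ : ℤ) : R) * ∏ i, ((p i : ℤ) : R)) := by
  unfold alt
  rw [Matrix.det_apply]
  refine Finset.sum_congr rfl fun σ _ => ?_
  have h1 : ∀ i, (Matrix.of fun i j => ((xU R i ^ l j : (Laurent R n)ˣ) : Laurent R n) -
      ((xU R i ^ (1 - l j) : (Laurent R n)ˣ) : Laurent R n)) (σ i) i =
      ∑ s : ℤˣ, AddMonoidAlgebra.single (flip (l i) s • eps (σ i)) (((s : ℤ) : R)) := by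
    intro i
    simp only [Matrix.of_apply, val_xU_zpow]
    rw [sum_intUnits, sub_eq_add_neg]
    congr 1
    · simp [flip]
    · rw [← AddMonoidAlgebra.single_neg]
      simp [flip]
  rw [Finset.prod_congr rfl fun i _ => h1 i, Finset.prod_univ_sum, Fintype.piFinset_univ,
    Finset.smul_sum]
  refine Finset.sum_congr rfl fun p _ => ?_
  rw [AddMonoidAlgebra.prod_single, Units.smul_def, AddMonoidAlgebra.smul_single]
  have h2 : ∑ i, flip (l i) (p i) • eps (σ i) = altExp l σ p := by
    rw [← sum_zsmul_eps (altExp l σ p), ← Equiv.sum_comp σ (fun a => altExp l σ p a • eps a)]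
    exact Finset.sum_congr rfl fun i _ => by simp [altExp]
  rw [h2, zsmul_eq_mul]

theorem coeff_alt (l ν : Fin n → ℤ) : (alt (xU R) l).coeff ν =
    ∑ σ : Equiv.Perm (Fin n), ∑ p : Fin n → ℤˣ, if altExp l σ p = ν then
      (((Equiv.Perm.sign σ : ℤ) : R) * ∏ i, ((p i : ℤ) : R)) else 0 := by
  simp only [alt_xU_eq_sum, AddMonoidAlgebra.coeff_sum, Finsupp.finsetSum_apply,
    AddMonoidAlgebra.coeff_single, Finsupp.single_apply]

/-- The quadratic form `|ν|²` for the shifted exponents, up to a constant. -/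
def quad (ν : Fin n → ℤ) : ℤ := ∑ i, (ν i * ν i - ν i)

theorem quad_altExp (l : Fin n → ℤ) (σ : Equiv.Perm (Fin n)) (p : Fin n → ℤˣ) :
    quad (altExp l σ p) = quad l := by
  unfold quad
  rw [← Equiv.sum_comp σ]
  refine Finset.sum_congr rfl fun i _ => ?_
  simp only [altExp, Equiv.symm_apply_apply, flip]
  split_ifs
  · rfl
  · ring

theorem coeff_alt_of_quad_ne {l ν : Fin n → ℤ} (h : quad ν ≠ quad l) :
    (alt (xU R) l).coeff ν = 0 := by
  rw [coeff_alt]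
  refine Finset.sum_eq_zero fun σ _ => Finset.sum_eq_zero fun p _ => if_neg ?_
  rintro rfl
  exact h (quad_altExp l σ p)

/-- A strictly dominant orbit element has trivial stabilizer and is the only one in its orbit. If
l_i ≥ 1 then 1 - l_i ≤ 0, which excludes sign changes; strictly decreasing vectors with the same
entries coincide, which excludes permutations. -/
theorem coeff_alt_dominant {l ν : Fin n → ℤ} (hl : StrictAnti l) (hl1 : ∀ i, 1 ≤ l i)
    (hν : StrictAnti ν) (hν1 : ∀ i, 1 ≤ ν i) :
    (alt (xU R) l).coeff ν = if l = ν then 1 else 0 := by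
  have key : ∀ σ p, altExp l σ p = ν → σ = 1 ∧ p = 1 := by
    intro σ p h
    have hp : p = 1 := by
      ext1 i
      have h1 := hν1 (σ i)
      rw [← h] at h1
      simp only [altExp, Equiv.symm_apply_apply, flip] at h1
      by_contra hpi
      rw [Pi.one_apply] at hpi
      rw [if_neg hpi] at h1
      have := hl1 i
      omega
    subst hp
    refine ⟨?_, rfl⟩
    have h2 : l ∘ σ.symm = ν := by
      rw [← h]; ext a; simp [altExp, flip]
    have h3 : l ∘ σ.symm = l := by
      have : (fun i => -(l ∘ σ.symm) i) = fun i => -l i := by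
        refine (StrictMono.range_inj (fun i j hij => ?_) (fun i j hij => neg_lt_neg (hl hij))).1 ?_
        · rw [h2]; exact neg_lt_neg (hν hij)
        · ext z
          constructor
          · rintro ⟨i, rfl⟩; exact ⟨σ.symm i, rfl⟩
          · rintro ⟨i, rfl⟩; exact ⟨σ i, by simp⟩
      ext i
      have := congrFun this i
      simpa using this
    ext1 i
    have h4 := congrFun h3 (σ i)
    simp only [Function.comp, Equiv.symm_apply_apply] at h4
    simpa using (hl.injective h4).symm
  rw [coeff_alt, Finset.sum_eq_single 1, Finset.sum_eq_single 1]
  · have : altExp l 1 1 = l := by ext a; simp [altExp, flip, ← Equiv.Perm.inv_def]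
    simp [this]
  · intro p _ hp
    exact if_neg fun h => hp (key 1 p h).2
  · simp
  · intro σ _ hσ
    exact Finset.sum_eq_zero fun p _ => if_neg fun h => hσ (key σ p h).1
  · simp

/-! ### The Weyl group action -/

/-- The permutation of two coordinates of the weight lattice. -/
def swapWt (i j : Fin n) : (Fin n → ℤ) ≃+ (Fin n → ℤ) where
  toFun ν := ν ∘ Equiv.swap i j
  invFun ν := ν ∘ Equiv.swap i j
  left_inv ν := by ext; simp
  right_inv ν := by ext; simp
  map_add' _ _ := rfl

/-- The change of sign of a coordinate of the weight lattice. -/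
def negWt (i : Fin n) : (Fin n → ℤ) ≃+ (Fin n → ℤ) where
  toFun ν := Function.update ν i (-ν i)
  invFun ν := Function.update ν i (-ν i)
  left_inv ν := by ext; simp
  right_inv ν := by ext; simp
  map_add' μ ν := by
    ext k
    by_cases h : k = i
    · subst h; simp; ring
    · simp [h]

theorem swapWt_eps (i j k : Fin n) : swapWt i j (eps k) = eps (Equiv.swap i j k) := by
  ext a
  simp only [swapWt, AddEquiv.coe_mk, Equiv.coe_fn_mk, Function.comp, eps, Pi.single_apply]
  congr 1
  rw [eq_iff_iff, Equiv.swap_apply_eq_iff]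

theorem negWt_eps (i k : Fin n) : negWt i (eps k) = if k = i then -eps k else eps k := by
  ext a
  simp only [negWt, AddEquiv.coe_mk, Equiv.coe_fn_mk, eps]
  split_ifs with h
  · subst h
    by_cases ha : a = k
    · subst ha; simp
    · simp [ha]
  · by_cases ha : a = i
    · subst ha; simp [Ne.symm h]
    · simp [ha]

variable {R}

theorem domCongr_swap_alt {i j : Fin n} (hij : i ≠ j) (l : Fin n → ℤ) :
    AddMonoidAlgebra.domCongr R R (swapWt i j) (alt (xU R) l) = -alt (xU R) l := by
  have h := map_alt (AddMonoidAlgebra.domCongr R R (swapWt i j) : Laurent R n →+* Laurent R n)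
    (xU R) l
  have h2 : (fun k => Units.map ((AddMonoidAlgebra.domCongr R R (swapWt i j) :
      Laurent R n →+* Laurent R n) : Laurent R n →* Laurent R n) (xU R k)) =
      xU R ∘ Equiv.swap i j := by
    ext1 k
    apply Units.ext
    change AddMonoidAlgebra.domCongr R R (swapWt i j) (xU R k : Laurent R n) = _
    rw [val_xU, AddMonoidAlgebra.domCongr_single, swapWt_eps]
    rfl
  rw [h2, alt_perm_comp, Equiv.Perm.sign_swap hij] at h
  refine Eq.trans h ?_
  simp

theorem domCongr_neg_alt (i : Fin n) (l : Fin n → ℤ) :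
    AddMonoidAlgebra.domCongr R R (negWt i) (alt (xU R) l) =
      -(((xU R i)⁻¹ : (Laurent R n)ˣ) : Laurent R n) * alt (xU R) l := by
  have h := map_alt (AddMonoidAlgebra.domCongr R R (negWt i) : Laurent R n →+* Laurent R n)
    (xU R) l
  have h2 : (fun k => Units.map ((AddMonoidAlgebra.domCongr R R (negWt i) :
      Laurent R n →+* Laurent R n) : Laurent R n →* Laurent R n) (xU R k)) =
      Function.update (xU R) i (xU R i)⁻¹ := by
    ext1 k
    apply Units.ext
    change AddMonoidAlgebra.domCongr R R (negWt i) (xU R k : Laurent R n) = _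
    rw [val_xU, AddMonoidAlgebra.domCongr_single, negWt_eps]
    split_ifs with hk
    · subst hk; rw [Function.update_self, val_xU_inv]
    · rw [Function.update_of_ne hk, val_xU]
  rw [h2, alt_update_inv] at h
  exact h

/-- Take an exponent in the support with maximal pairing with `rho n`. Its reflections are also in
the support, so maximality makes it decreasing with entries at least 1; two equal entries would make
its coefficient its own negative. It is thus strictly dominant, against `hdom`. -/
theorem eq_zero_of_antisymm [NoZeroDivisors R] [CharZero R] (f : Laurent R n)
    (hswap : ∀ i j, i ≠ j → AddMonoidAlgebra.domCongr R R (swapWt i j) f = -f)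
    (hneg : ∀ i, AddMonoidAlgebra.domCongr R R (negWt i) f =
      -(((xU R i)⁻¹ : (Laurent R n)ˣ) : Laurent R n) * f)
    (hdom : ∀ ν, StrictAnti ν → (∀ i, 1 ≤ ν i) → f.coeff ν = 0) : f = 0 := by
  have hs : ∀ i j, i ≠ j → ∀ ν, f.coeff (ν ∘ Equiv.swap i j) = -f.coeff ν := by
    intro i j hij ν
    have := congrArg (fun g : Laurent R n => g.coeff ν) (hswap i j hij)
    simp only [AddMonoidAlgebra.coeff_domCongr, AddMonoidAlgebra.coeff_neg, Finsupp.neg_apply] at this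
    exact this
  have hn : ∀ i ν, f.coeff (Function.update ν i (1 - ν i)) = -f.coeff ν := by
    intro i ν
    -- Reading the coefficient at ν - ε_i absorbs the factor e^(-ε_i) and turns ν_i ↦ -ν_i into ν_i
    -- ↦ 1 - ν_i.
    have := congrArg (fun g : Laurent R n => g.coeff (ν - eps i)) (hneg i)
    simp only [AddMonoidAlgebra.coeff_domCongr, neg_mul, AddMonoidAlgebra.coeff_neg,
      Finsupp.neg_apply, val_xU_inv,
      AddMonoidAlgebra.coeff_single_mul_apply, neg_neg, add_sub_cancel, one_mul] at this
    rw [← this]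
    congr 1
    change _ = Function.update (ν - eps i) i (-(ν - eps i) i)
    ext k
    by_cases hk : k = i
    · subst hk; simp [eps]
    · simp [hk, eps]
  by_contra hf
  have hne : f.coeff.support.Nonempty := by
    rw [Finsupp.support_nonempty_iff]
    simpa using hf
  obtain ⟨ν, hν, hmax⟩ := Finset.exists_max_image f.coeff.support
    (fun ν => ∑ i, rho n i * ν i) hne
  rw [Finsupp.mem_support_iff] at hν
  have hge : ∀ i, 1 ≤ ν i := by
    intro i
    by_contra h
    have h1 : Function.update ν i (1 - ν i) ∈ f.coeff.support := by
      rw [Finsupp.mem_support_iff, hn, neg_ne_zero]; exact hν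
    have h2 := hmax _ h1
    have h3 : ∑ k, rho n k * Function.update ν i (1 - ν i) k =
        ∑ k, rho n k * ν k + rho n i * (1 - ν i - ν i) := by
      rw [← sub_eq_iff_eq_add', ← Finset.sum_sub_distrib, Finset.sum_eq_single i]
      · simp; ring
      · intro k _ hk; simp [hk]
      · simp
    have h4 := rho_pos i
    have h5 : 0 < rho n i * (1 - ν i - ν i) := mul_pos h4 (by omega)
    omega
  have hanti : StrictAnti ν := by
    intro i j hij
    by_contra h
    rcases (not_lt.1 h).eq_or_lt with h | h
    · have h1 := hs i j hij.ne ν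
      have h2 : ν ∘ Equiv.swap i j = ν := by
        ext k
        simp only [Function.comp, Equiv.swap_apply_def]
        split_ifs with h1 h2
        · rw [h1, h]
        · rw [h2, h]
        · rfl
      rw [h2] at h1
      exact hν (self_eq_neg.1 h1)
    · have h1 : ν ∘ Equiv.swap i j ∈ f.coeff.support := by
        rw [Finsupp.mem_support_iff, hs i j hij.ne, neg_ne_zero]; exact hν
      have h2 := hmax _ h1
      have h3 : ∑ k, rho n k * (ν ∘ Equiv.swap i j) k =
          ∑ k, rho n k * ν k + (rho n i - rho n j) * (ν j - ν i) := by
        rw [← sub_eq_iff_eq_add', ← Finset.sum_sub_distrib,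
          Finset.sum_eq_add_of_mem i j (Finset.mem_univ i) (Finset.mem_univ j) hij.ne]
        · simp; ring
        · intro k _ hk
          simp [Equiv.swap_apply_of_ne_of_ne hk.1 hk.2]
      have h4 : 0 < (rho n i - rho n j) * (ν j - ν i) :=
        mul_pos (sub_pos.2 (rho_strictAnti n hij)) (sub_pos.2 h)
      omega
  exact hν (hdom ν hanti hge)

end Laurent

end TypeB

end

noncomputable section

namespace TypeB

/-! ### Formal exponentials in the fraction field -/

section FormalExp

variable {K : Type*} [Field K] {n : ℕ}

theorem fexp_add (μ ν : Fin n → ℤ) : fexp K (μ + ν) = fexp K μ * fexp K ν := by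
  unfold fexp
  rw [← map_mul, AddMonoidAlgebra.single_mul_single, one_mul]

theorem fexp_zero : fexp K (0 : Fin n → ℤ) = 1 := by
  unfold fexp
  rw [← AddMonoidAlgebra.one_def, map_one]

theorem fexp_injective : Function.Injective (fexp K : (Fin n → ℤ) → CharField K n) := by
  intro μ ν h
  have h1 := IsFractionRing.injective (AddMonoidAlgebra K (Fin n → ℤ)) (CharField K n) h
  have h2 := congrArg (fun f : AddMonoidAlgebra K (Fin n → ℤ) => f.coeff μ) h1
  simp only [AddMonoidAlgebra.coeff_single, Finsupp.single_apply, if_true] at h2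
  by_contra hne
  rw [if_neg (Ne.symm hne)] at h2
  exact one_ne_zero h2

theorem fexp_ne_zero (μ : Fin n → ℤ) : fexp K μ ≠ 0 := by
  intro h
  have := fexp_add (K := K) μ (-μ)
  rw [h, add_neg_cancel, fexp_zero, zero_mul] at this
  exact one_ne_zero this

theorem fexp_neg (μ : Fin n → ℤ) : fexp K (-μ) = (fexp K μ)⁻¹ := by
  refine eq_inv_of_mul_eq_one_left ?_
  rw [← fexp_add, neg_add_cancel, fexp_zero]

theorem fexp_ne_one {μ : Fin n → ℤ} (h : μ ≠ 0) : fexp K μ ≠ 1 := by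
  rw [← fexp_zero]
  exact fun h' => h (fexp_injective h')

theorem fexp_ne_neg_one [CharZero K] {μ : Fin n → ℤ} (h : μ ≠ 0) : fexp K μ ≠ -1 := by
  intro h'
  refine fexp_ne_one (K := K) (μ := μ + μ) (fun h2 => h ?_) ?_
  · ext i
    have := congrFun h2 i
    simp only [Pi.add_apply, Pi.zero_apply] at this ⊢
    omega
  · rw [fexp_add, h', neg_mul_neg, one_mul]

end FormalExp

/-! ### Derivations of the ring of Laurent polynomials -/

section Derivations

variable {n : ℕ}

/-- The derivation with `∂_k e^μ = μ_k e^μ`. -/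
def der (k : Fin n) : Derivation ℂ (Laurent ℂ n) (Laurent ℂ n) :=
  Derivation.mk' ((Finsupp.lsum ℂ fun μ : Fin n → ℤ =>
      (μ k : ℂ) • AddMonoidAlgebra.lsingle (R := ℂ) (S := ℂ) μ).comp
    (AddMonoidAlgebra.coeffLinearEquiv ℂ).toLinearMap) (by
  intro f g
  induction f using AddMonoidAlgebra.induction_linear with
  | zero => simp
  | add f f' hf hf' => simp only [add_mul, map_add, hf, hf', add_smul, smul_add]; abel
  | single μ c =>
    induction g using AddMonoidAlgebra.induction_linear with
    | zero => simp
    | add g g' hg hg' => simp only [mul_add, map_add, hg, hg', add_smul, smul_add]; abel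
    | single ν d =>
      simp only [AddMonoidAlgebra.single_mul_single, LinearMap.comp_apply,
        LinearEquiv.coe_coe, smul_eq_mul]
      have : ∀ (μ : Fin n → ℤ) (c : ℂ), Finsupp.lsum ℂ (fun μ : Fin n → ℤ =>
          (μ k : ℂ) • AddMonoidAlgebra.lsingle (R := ℂ) (S := ℂ) μ)
          (AddMonoidAlgebra.coeffLinearEquiv ℂ (AddMonoidAlgebra.single μ c)) =
          AddMonoidAlgebra.single μ ((μ k : ℂ) * c) := by
        intro μ c
        change Finsupp.lsum ℂ _ (Finsupp.single μ c) = _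
        rw [Finsupp.lsum_single, LinearMap.smul_apply, AddMonoidAlgebra.lsingle_apply,
          AddMonoidAlgebra.smul_single, smul_eq_mul]
      rw [this, this, this, AddMonoidAlgebra.single_mul_single, AddMonoidAlgebra.single_mul_single,
        add_comm ν μ, ← AddMonoidAlgebra.single_add]
      congr 1
      push_cast [Pi.add_apply]
      ring)

theorem der_single (k : Fin n) (μ : Fin n → ℤ) (c : ℂ) :
    der k (AddMonoidAlgebra.single μ c) = AddMonoidAlgebra.single μ ((μ k : ℂ) * c) := by
  change Finsupp.lsum ℂ _ (Finsupp.single μ c) = _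
  rw [Finsupp.lsum_single, LinearMap.smul_apply, AddMonoidAlgebra.lsingle_apply,
    AddMonoidAlgebra.smul_single, smul_eq_mul]

theorem coeff_der (k : Fin n) (f : Laurent ℂ n) (μ : Fin n → ℤ) :
    (der k f).coeff μ = (μ k : ℂ) * f.coeff μ := by
  induction f using AddMonoidAlgebra.induction_linear with
  | zero => simp
  | add f g hf hg => simp [hf, hg, mul_add]
  | single ν c =>
    rw [der_single, AddMonoidAlgebra.coeff_single, AddMonoidAlgebra.coeff_single,
      Finsupp.single_apply, Finsupp.single_apply]
    split_ifs with h
    · rw [h]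
    · simp

/-- The embedding of the Laurent polynomials into their field of fractions. -/
abbrev toFrac (n : ℕ) : Laurent ℂ n →+* CharField ℂ n := algebraMap _ _

/-- `s` is the logarithmic derivative of `f`. -/
def HasLogDer (k : Fin n) (f : Laurent ℂ n) (s : CharField ℂ n) : Prop :=
  toFrac n (der k f) = s * toFrac n f

theorem HasLogDer.mul {k : Fin n} {f g : Laurent ℂ n} {s t : CharField ℂ n}
    (hf : HasLogDer k f s) (hg : HasLogDer k g t) : HasLogDer k (f * g) (s + t) := by
  unfold HasLogDer at *
  rw [Derivation.leibniz, map_add, smul_eq_mul, smul_eq_mul, map_mul, map_mul, map_mul, hf, hg]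
  ring

theorem HasLogDer.prod {ι : Type*} {k : Fin n} (S : Finset ι) {f : ι → Laurent ℂ n}
    {s : ι → CharField ℂ n} (h : ∀ i ∈ S, HasLogDer k (f i) (s i)) :
    HasLogDer k (∏ i ∈ S, f i) (∑ i ∈ S, s i) := by
  classical
  induction S using Finset.induction_on with
  | empty => simp [HasLogDer]
  | insert a S ha ih =>
    rw [Finset.prod_insert ha, Finset.sum_insert ha]
    exact (h a (Finset.mem_insert_self a S)).mul
      (ih fun i hi => h i (Finset.mem_insert_of_mem hi))

theorem toFrac_xU (i : Fin n) : toFrac n (xU ℂ i) = fexp ℂ (eps i) := rfl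

theorem toFrac_xU_inv (i : Fin n) :
    toFrac n ((xU ℂ i)⁻¹ : (Laurent ℂ n)ˣ) = (fexp ℂ (eps i))⁻¹ := by
  rw [val_xU_inv, ← fexp_neg]
  rfl

theorem eps_ne_zero (i : Fin n) : (eps i : Fin n → ℤ) ≠ 0 := by
  intro h
  have := congrFun h i
  simp [eps] at this

theorem eps_injective : Function.Injective (eps : Fin n → Fin n → ℤ) := by
  intro i j h
  by_contra hne
  have := congrFun h i
  simp [eps, hne] at this

theorem eps_add_eps_ne_zero (i j : Fin n) : (eps i + eps j : Fin n → ℤ) ≠ 0 := by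
  intro h
  have := congrFun h i
  simp only [eps, Pi.add_apply, Pi.single_apply, Pi.zero_apply] at this
  split_ifs at this <;> omega

theorem der_xU (k i : Fin n) : der k (xU ℂ i : Laurent ℂ n) =
    if i = k then (xU ℂ i : Laurent ℂ n) else 0 := by
  rw [val_xU, der_single]
  split_ifs with h
  · subst h; simp [eps]
  · simp [eps, Ne.symm h]

theorem der_xU_inv (k i : Fin n) : der k (((xU ℂ i)⁻¹ : (Laurent ℂ n)ˣ) : Laurent ℂ n) =
    if i = k then -(((xU ℂ i)⁻¹ : (Laurent ℂ n)ˣ) : Laurent ℂ n) else 0 := by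
  rw [val_xU_inv, der_single]
  split_ifs with h
  · subst h; simp [eps, AddMonoidAlgebra.single_neg]
  · simp [eps, Ne.symm h]

/-- Only the factors of the product formula involving x_k contribute, and ∂_k(x_k + x_k⁻¹) = x_k -
x_k⁻¹. -/
theorem hasLogDer_alt_rho (k : Fin n) : HasLogDer k (alt (xU ℂ) (rho n))
    (fexp ℂ (eps k) / (fexp ℂ (eps k) - 1) + ∑ j with j ≠ k,
      (fexp ℂ (eps k) - (fexp ℂ (eps k))⁻¹) / (fexp ℂ (eps k) + (fexp ℂ (eps k))⁻¹ -
        (fexp ℂ (eps j) + (fexp ℂ (eps j))⁻¹))) := by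
  set x : Fin n → CharField ℂ n := fun i => fexp ℂ (eps i) with hx
  have hx0 : ∀ i, x i ≠ 0 := fun i => fexp_ne_zero _
  have hx1 : ∀ i, x i - 1 ≠ 0 := fun i => sub_ne_zero.2 (fexp_ne_one (eps_ne_zero i))
  have hu : ∀ i j, i ≠ j → x i + (x i)⁻¹ - (x j + (x j)⁻¹) ≠ 0 := by
    intro i j hij h
    have h1 : (x i - x j) * (x i * x j - 1) = 0 := by
      have hi := hx0 i
      have hj := hx0 j
      field_simp at h
      linear_combination h
    rcases mul_eq_zero.1 h1 with h2 | h2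
    · exact hij (eps_injective (fexp_injective (sub_eq_zero.1 h2)))
    · refine fexp_ne_one (K := ℂ) (eps_add_eps_ne_zero i j) ?_
      rw [fexp_add]
      exact sub_eq_zero.1 h2
  have h1 : HasLogDer k (((Equiv.Perm.sign (Fin.revPerm : Equiv.Perm (Fin n)) : ℤ) :
      Laurent ℂ n)) 0 := by
    unfold HasLogDer
    simp
  have h2 : HasLogDer k (∏ i : Fin n, ((xU ℂ i : Laurent ℂ n) - 1))
      (∑ i, if i = k then x k / (x k - 1) else 0) := by
    refine HasLogDer.prod _ fun i _ => ?_
    unfold HasLogDer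
    rw [map_sub, Derivation.map_one_eq_zero, sub_zero, der_xU, map_sub, toFrac_xU, map_one]
    split_ifs with h
    · subst h
      rw [toFrac_xU]
      exact (div_mul_cancel₀ _ (hx1 i)).symm
    · simp
  have h3 : HasLogDer k (Matrix.vandermonde fun i => (xU ℂ i : Laurent ℂ n) +
      ((xU ℂ i)⁻¹ : (Laurent ℂ n)ˣ)).det
      (∑ i, ∑ j ∈ Finset.Ioi i, ((if i = k then (x k - (x k)⁻¹) /
          (x k + (x k)⁻¹ - (x j + (x j)⁻¹)) else 0) + (if j = k then (x k - (x k)⁻¹) /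
          (x k + (x k)⁻¹ - (x i + (x i)⁻¹)) else 0))) := by
    rw [Matrix.det_vandermonde]
    refine HasLogDer.prod _ fun i _ => HasLogDer.prod _ fun j hj => ?_
    have hij : i < j := Finset.mem_Ioi.1 hj
    unfold HasLogDer
    rw [map_sub, map_add, map_add, der_xU, der_xU, der_xU_inv, der_xU_inv, map_sub, map_add,
      map_add, map_sub, map_add, map_add, toFrac_xU, toFrac_xU, toFrac_xU_inv, toFrac_xU_inv]
    by_cases hi : i = k
    · subst hi
      have := hu i j hij.ne
      rw [if_pos rfl, if_pos rfl, if_neg hij.ne', if_neg hij.ne', map_zero, map_neg, toFrac_xU,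
        toFrac_xU_inv, if_pos rfl, if_neg hij.ne']
      change _ = _ * (x j + (x j)⁻¹ - (x i + (x i)⁻¹))
      rw [add_zero ((_ : CharField ℂ n) / _), ← neg_sub (x i + (x i)⁻¹), mul_neg, div_mul_cancel₀ _ this]
      simp only [hx]
      ring
    · by_cases hj' : j = k
      · subst hj'
        have := hu j i hij.ne'
        rw [if_pos rfl, if_pos rfl, if_neg hi, if_neg hi, map_zero, map_neg, toFrac_xU,
          toFrac_xU_inv, if_pos rfl, if_neg hi]
        change _ = _ * (x j + (x j)⁻¹ - (x i + (x i)⁻¹))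
        rw [zero_add ((_ : CharField ℂ n) / _), div_mul_cancel₀ _ this]
        simp only [hx]
        ring
      · simp [hi, hj']
  rw [alt_rho]
  have h4 := h1.mul (h2.mul h3)
  convert h4 using 1
  rw [zero_add, Finset.sum_ite_eq' Finset.univ k, if_pos (Finset.mem_univ k)]
  congr 1
  simp only [Finset.sum_add_distrib, Finset.sum_ite_irrel, Finset.sum_const_zero]
  rw [Finset.sum_ite_eq' Finset.univ k, if_pos (Finset.mem_univ k)]
  have h5 : ∀ i, (∑ j ∈ Finset.Ioi i, if j = k then (x k - (x k)⁻¹) /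
      (x k + (x k)⁻¹ - (x i + (x i)⁻¹)) else 0) = if i < k then (x k - (x k)⁻¹) /
      (x k + (x k)⁻¹ - (x i + (x i)⁻¹)) else 0 := by
    intro i
    rw [Finset.sum_ite_eq']
    simp
  rw [Finset.sum_congr rfl fun i _ => h5 i, ← Finset.sum_filter, ← Finset.sum_union]
  · refine Finset.sum_congr ?_ fun _ _ => rfl
    ext j
    simp [eq_comm]
  · rw [Finset.disjoint_left]
    intro j hj hj'
    simp at hj hj'
    omega

theorem wt_inl (u : Unit) : wt (Sum.inl u : Pos n) = 0 := rfl
theorem wt_inr_inl (j : Fin n) : wt (Sum.inr (Sum.inl j) : Pos n) = eps j := rfl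
theorem wt_inr_inr (j : Fin n) : wt (Sum.inr (Sum.inr j) : Pos n) = -eps j := rfl

/-- The sum of `(e^α + 1) / (e^α - 1)` over the roots `α` with `α_k = 1`, times the Weyl
denominator. -/
theorem sum_cot_mul_alt_rho (k : Fin n) :
    (∑ c : Pos n with wt c k = 0,
      (fexp ℂ (eps k + wt c) + 1) / (fexp ℂ (eps k + wt c) - 1)) *
      toFrac n (alt (xU ℂ) (rho n)) =
      2 * toFrac n (der k (alt (xU ℂ) (rho n))) - toFrac n (alt (xU ℂ) (rho n)) := by
  rw [hasLogDer_alt_rho k, ← mul_assoc, ← sub_one_mul]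
  congr 1
  set x : Fin n → CharField ℂ n := fun i => fexp ℂ (eps i) with hx
  have hx0 : ∀ i, x i ≠ 0 := fun i => fexp_ne_zero _
  have hx1 : ∀ i, x i - 1 ≠ 0 := fun i => sub_ne_zero.2 (fexp_ne_one (eps_ne_zero i))
  have e : ∀ j : Fin n, (eps j k = 0) = (j ≠ k) := by
    intro j
    by_cases h : j = k
    · subst h; simp [eps]
    · simp [eps, h, Ne.symm h]
  rw [Finset.sum_filter, Fintype.sum_sum_type, Fintype.sum_sum_type]
  simp only [wt_inl, wt_inr_inl, wt_inr_inr, Pi.neg_apply, neg_eq_zero, e, fexp_add, fexp_neg,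
    fexp_zero, Pi.zero_apply, if_true, mul_one, Finset.univ_unique, Finset.sum_singleton]
  rw [← Finset.sum_filter, ← Finset.sum_filter, ← Finset.sum_add_distrib, mul_add, Finset.mul_sum,
    add_sub_right_comm]
  congr 1
  · have := hx1 k
    change (x k + 1) / (x k - 1) = 2 * (x k / (x k - 1)) - 1
    field_simp
    ring
  · refine Finset.sum_congr rfl fun j hj => ?_
    have hjk : j ≠ k := (Finset.mem_filter.1 hj).2
    -- The two roots ε_k + ε_j and ε_k - ε_j together match one Vandermonde factor.
    change (x k * x j + 1) / (x k * x j - 1) + (x k * (x j)⁻¹ + 1) / (x k * (x j)⁻¹ - 1) =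
      2 * ((x k - (x k)⁻¹) / (x k + (x k)⁻¹ - (x j + (x j)⁻¹)))
    have h1 : x k * x j - 1 ≠ 0 := by
      simp only [hx, ← fexp_add]
      exact sub_ne_zero.2 (fexp_ne_one (eps_add_eps_ne_zero k j))
    have h2 : x k - x j ≠ 0 := sub_ne_zero.2 fun h => hjk (eps_injective (fexp_injective h)).symm
    have hk0 := hx0 k
    have hj0 := hx0 j
    have h3 : x k * (x j)⁻¹ - 1 ≠ 0 := by
      intro h
      apply h2
      field_simp at h
      simpa using h
    have h4 : x k + (x k)⁻¹ - (x j + (x j)⁻¹) = (x k - x j) * (x k * x j - 1) / (x k * x j) := by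
      field_simp
      ring
    have h5 : (x k * (x j)⁻¹ + 1) / (x k * (x j)⁻¹ - 1) = (x k + x j) / (x k - x j) := by
      rw [div_eq_div_iff h3 h2]
      field_simp
    rw [h4, h5]
    field_simp
    ring

end Derivations

end TypeB

end

noncomputable section

namespace TypeB

attribute [local instance 100] LieRing.ofAssociativeRing

/-! ### Formal traces -/

section FormalTrace

variable {n : ℕ} {ι : Type*} [Fintype ι]

/-- The formal trace of a matrix whose rows are graded by weights. -/
def ftr (w : ι → Fin n → ℤ) : Matrix ι ι ℂ →ₗ[ℂ] Laurent ℂ n where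
  toFun X := ∑ i, AddMonoidAlgebra.single (w i) (X i i)
  map_add' X Y := by
    simp only [Matrix.add_apply, AddMonoidAlgebra.single_add, Finset.sum_add_distrib]
  map_smul' c X := by
    simp only [Matrix.smul_apply, ← AddMonoidAlgebra.smul_single, Finset.smul_sum,
      RingHom.id_apply]

theorem ftr_apply (w : ι → Fin n → ℤ) (X : Matrix ι ι ℂ) :
    ftr w X = ∑ i, AddMonoidAlgebra.single (w i) (X i i) := rfl

/-- The formal character of a family of weights. -/
def fchar (w : ι → Fin n → ℤ) : Laurent ℂ n := ∑ i, AddMonoidAlgebra.single (w i) 1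

theorem ftr_diagonal [DecidableEq ι] (w : ι → Fin n → ℤ) (d : ι → ℂ) :
    ftr w (Matrix.diagonal d) = ∑ i, AddMonoidAlgebra.single (w i) (d i) := by
  simp [ftr_apply]

theorem ftr_one [DecidableEq ι] (w : ι → Fin n → ℤ) : ftr w 1 = fchar w := by
  rw [← Matrix.diagonal_one, ftr_diagonal]
  rfl

theorem der_fchar (w : ι → Fin n → ℤ) (k : Fin n) :
    der k (fchar w) = ∑ i, AddMonoidAlgebra.single (w i) (w i k : ℂ) := by
  simp only [fchar, map_sum, der_single, mul_one]

theorem der_der_fchar (w : ι → Fin n → ℤ) (k : Fin n) :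
    der k (der k (fchar w)) = ∑ i, AddMonoidAlgebra.single (w i) ((w i k : ℂ) * w i k) := by
  simp only [der_fchar, map_sum, der_single]

/-- A shifts weights by α, so the cyclicity of the trace holds up to the weight of the row at which
the cycle is cut. -/
theorem ftr_mul_comm {w : ι → Fin n → ℤ} {A : Matrix ι ι ℂ} {α : Fin n → ℤ}
    (hA : ∀ i j, A i j ≠ 0 → w i = w j + α) (B : Matrix ι ι ℂ) :
    ftr w (A * B) = AddMonoidAlgebra.single α 1 * ftr w (B * A) := by
  have hsum : ∀ (μ : Fin n → ℤ) (f : ι → ℂ), AddMonoidAlgebra.single μ (∑ i, f i) =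
      ∑ i, AddMonoidAlgebra.single μ (f i) := by
    intro μ f
    simp only [← AddMonoidAlgebra.lsingle_apply (R := ℂ), map_sum]
  simp only [ftr_apply, Matrix.mul_apply, hsum, Finset.mul_sum,
    AddMonoidAlgebra.single_mul_single, one_mul]
  rw [Finset.sum_comm]
  refine Finset.sum_congr rfl fun j _ => Finset.sum_congr rfl fun i _ => ?_
  by_cases h : A i j = 0
  · simp [h]
  · rw [hA i j h, add_comm α, mul_comm]

variable [DecidableEq ι] {R : Lie n →ₗ⁅ℂ⁆ Matrix ι ι ℂ} {w : ι → Fin n → ℤ}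

theorem weight_eq_of_apply_ne_zero
    (hw : ∀ k, R (cartan n k) = Matrix.diagonal fun i => (w i k : ℂ)) {X : Lie n}
    {α : Fin n → ℤ} (hX : ∀ k, ⁅cartan n k, X⁆ = (α k : ℂ) • X) (i j : ι) (h : R X i j ≠ 0) :
    w i = w j + α := by
  ext k
  have h1 := congrArg (fun Y => R Y i j) (hX k)
  simp only [LieHom.map_lie, Ring.lie_def, hw, Matrix.sub_apply, Matrix.diagonal_mul,
    Matrix.mul_diagonal, map_smul, Matrix.smul_apply, smul_eq_mul] at h1
  have h2 : ((w i k : ℂ) - w j k - α k) * R X i j = 0 := by linear_combination h1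
  have h3 := (mul_eq_zero.1 h2).resolve_right h
  have h4 : ((w i k - w j k - α k : ℤ) : ℂ) = 0 := by push_cast; exact h3
  have h5 : w i k - w j k - α k = 0 := by exact_mod_cast h4
  simp only [Pi.add_apply]
  omega

theorem ftr_cartan (hw : ∀ k, R (cartan n k) = Matrix.diagonal fun i => (w i k : ℂ)) (k : Fin n) :
    ftr w (R (cartan n k)) = der k (fchar w) := by
  rw [hw, ftr_diagonal, der_fchar]

/-- Twisted cyclicity makes the left side the formal trace of a commutator, which lies in the Cartan
subalgebra; there the formal trace is a derivative of the character. This is the mechanism of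
Freudenthal's formula. -/
theorem ftr_gen_mul (hw : ∀ k, R (cartan n k) = Matrix.diagonal fun i => (w i k : ℂ))
    {a c : Pos n} (h : a ≠ c) :
    (1 - AddMonoidAlgebra.single (-(wt a + wt c)) 1) *
      ftr w (R (gen a c) * R (gen (bar c) (bar a))) =
      (jc a * jc c) • ∑ k, ((wt a k : ℂ) + (wt c k : ℂ)) • der k (fchar w) := by
  have h1 := weight_eq_of_apply_ne_zero hw (X := gen (bar c) (bar a)) (α := -(wt a + wt c))
    (fun k => by rw [lie_cartan_gen, wt_bar, wt_bar, neg_add_rev])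
  rw [sub_mul, one_mul, ← ftr_mul_comm h1, ← map_sub, ← Ring.lie_def, ← LieHom.map_lie,
    lie_gen_gen_bar h]
  simp only [map_smul, map_sum, ftr_cartan hw]

theorem ftr_gen_bar_mul (hw : ∀ k, R (cartan n k) = Matrix.diagonal fun i => (w i k : ℂ))
    (a : Pos n) : ftr w (R (gen a (bar a)) * R (gen (bar (bar a)) (bar a))) =
      (jc a * jc a) • ∑ k, ((wt a k : ℂ) * (wt a k : ℂ)) • der k (der k (fchar w)) := by
  have h1 : R (gen a (bar a)) =
      Matrix.diagonal fun i => jc a * ∑ k, (wt a k : ℂ) * (w i k : ℂ) := by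
    rw [gen_bar_self]
    simp only [map_smul, map_sum, hw]
    ext i j
    simp only [Matrix.smul_apply, Matrix.sum_apply, Matrix.diagonal_apply, smul_eq_mul]
    split_ifs <;> simp
  -- `wt a` has at most one nonzero coordinate, so there are no cross terms.
  have h2 : ∀ u : Fin n → ℤ, (∑ k, (wt a k : ℂ) * (u k : ℂ)) * (∑ k, (wt a k : ℂ) * (u k : ℂ)) =
      ∑ k, ((wt a k : ℂ) * (wt a k : ℂ)) * ((u k : ℂ) * u k) := by
    intro u
    rcases a with a | a | a <;> simp [wt, eps, Pi.single_apply]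
  rw [bar_bar, h1, Matrix.diagonal_mul_diagonal, ftr_diagonal]
  simp only [der_der_fchar, Finset.smul_sum, AddMonoidAlgebra.smul_single, smul_eq_mul]
  rw [Finset.sum_comm]
  refine Finset.sum_congr rfl fun i _ => ?_
  rw [mul_mul_mul_comm, h2, Finset.mul_sum]
  simp only [← AddMonoidAlgebra.lsingle_apply (R := ℂ), map_sum]

/-- The coefficient of the formal trace of a product of root vectors. -/
def rootCoeff (a c : Pos n) : CharField ℂ n :=
  if a = c ∨ c = bar a then 0 else (1 - fexp ℂ (-(wt a + wt c)))⁻¹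

theorem rootCoeff_comm (a c : Pos n) : rootCoeff a c = rootCoeff c a := by
  unfold rootCoeff
  simp only [add_comm (wt a), eq_comm (a := a) (b := c), eq_bar_comm (a := c) (b := a)]

theorem wt_add_wt_ne_zero {a c : Pos n} (h1 : a ≠ c) (h2 : c ≠ bar a) : wt a + wt c ≠ 0 := by
  intro h
  have hpos : ∀ α ∈ posRoots n, α ≠ 0 := by
    rintro α hα rfl
    simpa using pairing_posRoots_pos (rho_strictAnti n) rho_pos hα
  rcases wt_add_wt_cases a c with h3 | h3 | h3 | h3
  · exact h1 h3
  · exact h2 h3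
  · exact hpos _ h3 h
  · exact hpos _ h3 (by rw [h, neg_zero])

/-- In the fraction field one may divide by 1 - e^(-α), which treats generators of zero and of
nonzero weight in one formula, ready to be summed over all pairs. -/
theorem toFrac_ftr_gen_mul (hw : ∀ k, R (cartan n k) = Matrix.diagonal fun i => (w i k : ℂ))
    (a c : Pos n) :
    toFrac n (ftr w ((jc a * jc c)⁻¹ • (R (gen a c) * R (gen (bar c) (bar a))))) =
      (if c = bar a then ∑ k, ((wt a k : ℂ) * (wt a k : ℂ)) • toFrac n (der k (der k (fchar w)))
        else 0) +
      ∑ k, (((wt a k : ℤ) : CharField ℂ n) + ((wt c k : ℤ) : CharField ℂ n)) * rootCoeff a c *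
        toFrac n (der k (fchar w)) := by
  have hj : jc a * jc c ≠ 0 := mul_ne_zero (jc_ne_zero a) (jc_ne_zero c)
  have hsm : ∀ (z : ℂ) (f : Laurent ℂ n), toFrac n (z • f) = z • toFrac n f := fun z f =>
    map_smul (Algebra.linearMap (Laurent ℂ n) (CharField ℂ n) |>.restrictScalars ℂ) z f
  have hcast : ∀ (m : ℤ) (f : CharField ℂ n), (m : ℂ) • f = (m : CharField ℂ n) * f := by
    intro m f
    rw [Int.cast_smul_eq_zsmul, zsmul_eq_mul]
  by_cases h2 : c = bar a
  · subst h2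
    rw [map_smul, ftr_gen_bar_mul hw, jc_bar, smul_smul,
      inv_mul_cancel₀ (mul_ne_zero (jc_ne_zero a) (jc_ne_zero a)), one_smul, if_pos rfl]
    simp only [map_sum, hsm, rootCoeff, or_true, if_true, mul_zero, zero_mul,
      Finset.sum_const_zero, add_zero]
  rw [if_neg h2, zero_add]
  by_cases h1 : a = c
  · subst h1
    simp [rootCoeff, gen_self]
  · have h3 := wt_add_wt_ne_zero h1 h2
    have h4 : (1 : CharField ℂ n) - fexp ℂ (-(wt a + wt c)) ≠ 0 :=
      sub_ne_zero.2 (fexp_ne_one (neg_ne_zero.2 h3)).symm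
    have h5 := congrArg (toFrac n) (ftr_gen_mul hw h1)
    rw [map_mul, map_sub, map_one] at h5
    change (1 - fexp ℂ (-(wt a + wt c))) * _ = _ at h5
    rw [map_smul, hsm, ← inv_mul_cancel_left₀ h4 (toFrac n (ftr w _)), h5, hsm, mul_smul_comm,
      smul_smul, inv_mul_cancel₀ hj, one_smul, map_sum, Finset.mul_sum]
    refine Finset.sum_congr rfl fun k _ => ?_
    rw [hsm, rootCoeff, if_neg (not_or.2 ⟨h1, h2⟩), add_smul, hcast, hcast]
    ring

/-- Only a = ±ε_k contributes. Each root α with α_k = 1 is paired with -α, and 1/(1 - e^(-α)) - 1/(1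
- e^α) = (e^α + 1)/(e^α - 1). -/
theorem sum_wt_mul_rootCoeff (k : Fin n) :
    ∑ a : Pos n, ∑ c : Pos n, ((wt a k : ℤ) : CharField ℂ n) * rootCoeff a c =
      ∑ c : Pos n with wt c k = 0,
        (fexp ℂ (eps k + wt c) + 1) / (fexp ℂ (eps k + wt c) - 1) := by
  simp only [← Finset.mul_sum]
  rw [Fintype.sum_sum_type, Fintype.sum_sum_type]
  simp only [wt_inl, wt_inr_inl, wt_inr_inr, Pi.zero_apply, Int.cast_zero, zero_mul,
    Finset.sum_const_zero, zero_add, Pi.neg_apply, Int.cast_neg, neg_mul, Finset.sum_neg_distrib,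
    eps, Pi.single_apply, Int.cast_ite, Int.cast_one, ite_mul, one_mul,
    Finset.sum_ite_eq, Finset.mem_univ, if_true]
  have hbar : Function.Involutive (bar : Pos n → Pos n) := bar_bar
  rw [← sub_eq_add_neg, ← Equiv.sum_comp hbar.toPerm (fun c => rootCoeff (Sum.inr (Sum.inr k)) c),
    ← Finset.sum_sub_distrib, Finset.sum_filter]
  refine Finset.sum_congr rfl fun c _ => ?_
  change rootCoeff _ _ - rootCoeff (bar (Sum.inr (Sum.inl k))) (bar c) = _
  have hc : wt c k = 0 ↔ ¬(Sum.inr (Sum.inl k) = c ∨ c = bar (Sum.inr (Sum.inl k))) := by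
    rcases c with c | c | c
    · simp [wt, bar]
    · simp [wt, bar, eps, Pi.single_apply]
    · simp [wt, bar, eps, Pi.single_apply, eq_comm]
  unfold rootCoeff
  simp only [bar_inj]
  by_cases h : Sum.inr (Sum.inl k) = c ∨ c = bar (Sum.inr (Sum.inl k))
  · rw [if_pos h, if_pos h, if_neg (fun h' => hc.1 h' h), sub_zero]
  · rw [if_neg h, if_neg h, if_pos (hc.2 h)]
    obtain ⟨h1, h2⟩ := not_or.1 h
    have h3 := wt_add_wt_ne_zero h1 h2
    rw [wt_bar, wt_bar, ← neg_add, neg_neg, fexp_neg]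
    change _ = (fexp ℂ (wt (Sum.inr (Sum.inl k)) + wt c) + 1) /
      (fexp ℂ (wt (Sum.inr (Sum.inl k)) + wt c) - 1)
    set y : CharField ℂ n := fexp ℂ (wt (Sum.inr (Sum.inl k)) + wt c)
    have hy0 : y ≠ 0 := fexp_ne_zero _
    have e1 : (1 - y⁻¹)⁻¹ = y / (y - 1) := by
      have h6 : 1 - y⁻¹ = (y - 1) / y := by field_simp
      rw [h6, inv_div]
    have e2 : (1 - y)⁻¹ = -(1 / (y - 1)) := by
      rw [← neg_sub y 1, inv_neg, one_div]
    rw [e1, e2, sub_neg_eq_add, ← add_div]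

/-- The product of the Weyl denominator and the character is an eigenvector of the shifted
Laplacian. -/
theorem laplacian_alt_rho_mul_fchar
    (hw : ∀ k, R (cartan n k) = Matrix.diagonal fun i => (w i k : ℂ)) {κ : ℂ}
    (hC : ∑ a, ∑ c, (jc a * jc c)⁻¹ • (R (gen a c) * R (gen (bar c) (bar a))) = κ • 1) :
    ∑ k, (der k (der k (alt (xU ℂ) (rho n) * fchar w)) - der k (alt (xU ℂ) (rho n) * fchar w)) =
      (κ / 2 + (quad (rho n) : ℂ)) • (alt (xU ℂ) (rho n) * fchar w) := by
  set A : Laurent ℂ n := alt (xU ℂ) (rho n) with hA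
  -- The denominator itself is an eigenvector, since its exponents form one Weyl orbit and `quad` is
  -- constant on it.
  have hLA : ∑ k, (der k (der k A) - der k A) = (quad (rho n) : ℂ) • A := by
    apply AddMonoidAlgebra.ext
    ext ν
    simp only [AddMonoidAlgebra.coeff_sum, Finsupp.finsetSum_apply, AddMonoidAlgebra.coeff_sub,
      Finsupp.sub_apply, coeff_der, AddMonoidAlgebra.coeff_smul, Finsupp.smul_apply, smul_eq_mul]
    by_cases h : quad ν = quad (rho n)
    · rw [← h, quad]
      push_cast
      rw [Finset.sum_mul]
      exact Finset.sum_congr rfl fun k _ => by ring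
    · rw [hA, coeff_alt_of_quad_ne ℂ h]
      simp
  have hsm : ∀ (z : ℂ) (f : Laurent ℂ n), toFrac n (z • f) = z • toFrac n f := fun z f =>
    map_smul (Algebra.linearMap (Laurent ℂ n) (CharField ℂ n) |>.restrictScalars ℂ) z f
  have h1 := congrArg (fun M => toFrac n (ftr w M)) hC
  simp only [map_sum] at h1
  simp only [toFrac_ftr_gen_mul hw] at h1
  rw [map_smul, ftr_one, hsm] at h1
  simp only [Finset.sum_add_distrib, Finset.sum_ite_eq', Finset.mem_univ, if_true] at h1
  -- For each k exactly the two weights ±ε_k contribute, hence the 2.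
  have h2 : ∑ a : Pos n, ∑ k, ((wt a k : ℂ) * (wt a k : ℂ)) •
      toFrac n (der k (der k (fchar w))) = 2 * ∑ k, toFrac n (der k (der k (fchar w))) := by
    rw [Finset.sum_comm, Finset.mul_sum]
    refine Finset.sum_congr rfl fun k _ => ?_
    rw [← Finset.sum_smul]
    have : ∑ a : Pos n, (wt a k : ℂ) * (wt a k : ℂ) = 2 := by
      rw [Fintype.sum_sum_type, Fintype.sum_sum_type]
      simp [wt, eps, Pi.single_apply]
      norm_num
    rw [this, two_smul, two_mul]
  have h3 : ∑ a : Pos n, ∑ c : Pos n, ∑ k, (((wt a k : ℤ) : CharField ℂ n) +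
      ((wt c k : ℤ) : CharField ℂ n)) * rootCoeff a c * toFrac n (der k (fchar w)) =
      2 * ∑ k, (∑ a : Pos n, ∑ c : Pos n, ((wt a k : ℤ) : CharField ℂ n) * rootCoeff a c) *
        toFrac n (der k (fchar w)) := by
    have e1 : ∀ k : Fin n, ∑ a : Pos n, ∑ c : Pos n, ((wt c k : ℤ) : CharField ℂ n) *
        rootCoeff a c = ∑ a : Pos n, ∑ c : Pos n, ((wt a k : ℤ) : CharField ℂ n) *
        rootCoeff a c := by
      intro k
      rw [Finset.sum_comm]
      exact Finset.sum_congr rfl fun a _ => Finset.sum_congr rfl fun c _ => by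
        rw [rootCoeff_comm]
    rw [Finset.sum_congr rfl fun a _ => Finset.sum_comm, Finset.sum_comm, Finset.mul_sum]
    refine Finset.sum_congr rfl fun k _ => ?_
    simp only [add_mul, Finset.sum_add_distrib, ← Finset.sum_mul]
    rw [e1]
    ring
  rw [h2, h3] at h1
  apply IsFractionRing.injective (Laurent ℂ n) (CharField ℂ n)
  change toFrac n _ = toFrac n _
  -- By Leibniz. Since 2 ∂_k A - A is A times the sum of the root quotients, the first two summands
  -- are A times half of the Casimir trace; the last one is a multiple of A·ch by `hLA`.
  have h4 : ∑ k, (der k (der k (A * fchar w)) - der k (A * fchar w)) =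
      A * ∑ k, der k (der k (fchar w)) + ∑ k, (2 * der k A - A) * der k (fchar w) +
        (∑ k, (der k (der k A) - der k A)) * fchar w := by
    rw [Finset.mul_sum, Finset.sum_mul, ← Finset.sum_add_distrib, ← Finset.sum_add_distrib]
    refine Finset.sum_congr rfl fun k _ => ?_
    simp only [Derivation.leibniz, map_add, smul_eq_mul]
    ring
  have h5 : toFrac n (A * ∑ k, der k (der k (fchar w)) +
      ∑ k, (2 * der k A - A) * der k (fchar w)) = (κ / 2) • toFrac n (A * fchar w) := by
    simp only [map_add, map_mul, map_sum, map_sub, map_ofNat, ← sum_cot_mul_alt_rho,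
      hA]
    simp only [sum_wt_mul_rootCoeff] at h1
    have h6 : (κ / 2) • toFrac n (fchar w) = ∑ k, toFrac n (der k (der k (fchar w))) +
        ∑ k, (∑ c : Pos n with wt c k = 0, (fexp ℂ (eps k + wt c) + 1) /
          (fexp ℂ (eps k + wt c) - 1)) * toFrac n (der k (fchar w)) := by
      rw [div_eq_inv_mul, mul_smul, ← h1, ← mul_add, two_mul, ← two_smul ℂ, smul_smul,
        inv_mul_cancel₀ two_ne_zero, one_smul]
    rw [← mul_smul_comm, h6, mul_add, Finset.mul_sum, Finset.mul_sum]
    congr 1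
    exact Finset.sum_congr rfl fun k _ => by ring
  rw [h4, map_add, h5, hLA, add_smul, map_add, hsm, hsm, smul_mul_assoc, hsm]

/-- The exponents of the product of the Weyl denominator and the character lie on a sphere. -/
theorem quad_eq_of_coeff_ne_zero
    (hw : ∀ k, R (cartan n k) = Matrix.diagonal fun i => (w i k : ℂ)) {κ : ℂ}
    (hC : ∑ a, ∑ c, (jc a * jc c)⁻¹ • (R (gen a c) * R (gen (bar c) (bar a))) = κ • 1)
    {μ ν : Fin n → ℤ} (hμ : (alt (xU ℂ) (rho n) * fchar w).coeff μ ≠ 0)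
    (hν : (alt (xU ℂ) (rho n) * fchar w).coeff ν ≠ 0) : quad μ = quad ν := by
  have key : ∀ ν : Fin n → ℤ, (alt (xU ℂ) (rho n) * fchar w).coeff ν ≠ 0 →
      (quad ν : ℂ) = κ / 2 + (quad (rho n) : ℂ) := by
    intro ν hν
    have h := congrArg (fun f : Laurent ℂ n => f.coeff ν) (laplacian_alt_rho_mul_fchar hw hC)
    simp only [AddMonoidAlgebra.coeff_sum, Finsupp.finsetSum_apply, AddMonoidAlgebra.coeff_sub,
      Finsupp.sub_apply, coeff_der, AddMonoidAlgebra.coeff_smul, Finsupp.smul_apply,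
      smul_eq_mul] at h
    refine mul_right_cancel₀ hν ?_
    rw [← h, quad]
    push_cast
    rw [Finset.sum_mul]
    exact Finset.sum_congr rfl fun k _ => by ring
  have := (key μ hμ).trans (key ν hν).symm
  exact_mod_cast this

end FormalTrace

end TypeB

end

noncomputable section

namespace TypeB

attribute [local instance 100] LieRing.ofAssociativeRing

/-! ### Representations of `𝔰𝔩₂` -/

section SlTwo

variable {V : Type*} [AddCommGroup V] [Module ℂ V] {E F H : Module.End ℂ V}

theorem sl2_H_pow (hHF : ∀ v, H (F v) = F (H v) - (2 : ℂ) • F v) {c : ℂ} {w : V}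
    (hw : H w = c • w) (m : ℕ) : H ((F ^ m) w) = (c - 2 * m) • (F ^ m) w := by
  induction m with
  | zero => simpa using hw
  | succ m ih =>
    rw [pow_succ', Module.End.mul_apply, hHF, ih, map_smul, ← sub_smul]
    congr 1
    push_cast
    ring

theorem sl2_E_pow (hEF : ∀ v, E (F v) = F (E v) + H v)
    (hHF : ∀ v, H (F v) = F (H v) - (2 : ℂ) • F v) {c : ℂ} {w : V}
    (hw : H w = c • w) (m : ℕ) :
    E ((F ^ (m + 1)) w) = (F ^ (m + 1)) (E w) + ((m + 1) * (c - m)) • (F ^ m) w := by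
  induction m with
  | zero => simp [hEF, hw]
  | succ m ih =>
    rw [pow_succ' F (m + 1), Module.End.mul_apply, hEF, ih, map_add, map_smul,
      sl2_H_pow hHF hw, ← Module.End.mul_apply, ← Module.End.mul_apply, ← Module.End.mul_apply,
      ← pow_succ' F m, add_assoc, ← add_smul]
    congr 2
    push_cast
    ring

/-- If `P` is a space of vectors of weight `k ≥ 0`, then `F ^ k` is injective on `P`. -/
theorem sl2_pow_injective [FiniteDimensional ℂ V] (hEF : ∀ v, E (F v) = F (E v) + H v)
    (hHE : ∀ v, H (E v) = E (H v) + (2 : ℂ) • E v)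
    (hHF : ∀ v, H (F v) = F (H v) - (2 : ℂ) • F v) {k : ℕ} {P : Submodule ℂ V}
    (hP : ∀ v ∈ P, H v = (k : ℂ) • v) (hFE : ∀ v ∈ P, F (E v) ∈ P)
    (hnil : ∀ v ∈ P, ∃ m, (E ^ m) v = 0) {v : V} (hv : v ∈ P) (h0 : (F ^ k) v = 0) : v = 0 := by
  rcases k with _ | k
  · simpa using h0
  -- If the kernel W is nonzero, the operator F E, which preserves it, has an eigenvector w there.
  -- Its eigenvalue c is negative by the string of powers of F and nonnegative by the string of
  -- powers of E.
  let W : Submodule ℂ V := P ⊓ LinearMap.ker (F ^ (k + 1))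
  have hW : ∀ x ∈ W, (F * E) x ∈ W := by
    rintro x ⟨hx, hx0⟩
    refine ⟨hFE x hx, ?_⟩
    rw [SetLike.mem_coe, LinearMap.mem_ker] at hx0 ⊢
    have h1 := sl2_E_pow hEF hHF (hP x hx) k
    rw [hx0, map_zero] at h1
    have h2 := congrArg F h1
    rw [map_zero, map_add, map_smul, ← Module.End.mul_apply F (F ^ k), ← pow_succ', hx0,
      smul_zero, add_zero, ← Module.End.mul_apply, ← pow_succ'] at h2
    rw [Module.End.mul_apply, ← Module.End.mul_apply, ← pow_succ]
    exact h2.symm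
  by_contra hne
  have hnt : Nontrivial W := ⟨⟨⟨v, hv, h0⟩, 0, fun h => hne (congrArg Subtype.val h)⟩⟩
  obtain ⟨c, hc⟩ := Module.End.exists_eigenvalue ((F * E).restrict hW)
  obtain ⟨⟨w, hwP, hwk⟩, hw⟩ := hc.exists_hasEigenvector
  have hw0 : w ≠ 0 := fun h => hw.2 (Subtype.ext h)
  have hFEw : F (E w) = c • w := congrArg Subtype.val hw.apply_eq_smul
  have hHw := hP w hwP
  -- the smallest power of `F` that kills `w` determines `c`
  have hex : ∃ p, (F ^ p) w = 0 := ⟨_, hwk⟩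
  classical
  obtain ⟨p, hp⟩ : ∃ p, Nat.find hex = p + 1 := by
    refine Nat.exists_eq_succ_of_ne_zero fun h => hw0 ?_
    have := Nat.find_spec hex
    rwa [h] at this
  have hpk : p ≤ k := by
    have := Nat.find_min' hex hwk
    omega
  have hp0 : (F ^ (p + 1)) w = 0 := hp ▸ Nat.find_spec hex
  have hp1 : (F ^ p) w ≠ 0 := Nat.find_min hex (by omega)
  have hc1 : c = -((p + 1) * ((k - p : ℕ) + 1)) := by
    have h1 := sl2_E_pow hEF hHF hHw p
    rw [hp0, map_zero, pow_succ, Module.End.mul_apply, hFEw, map_smul, ← add_smul] at h1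
    have h2 := (smul_eq_zero.1 h1.symm).resolve_right hp1
    push_cast [Nat.cast_sub hpk] at h2 ⊢
    linear_combination h2
  -- and so does the smallest power of `E`
  have hex' := hnil w hwP
  obtain ⟨r, hr⟩ : ∃ r, Nat.find hex' = r + 1 := by
    refine Nat.exists_eq_succ_of_ne_zero fun h => hw0 ?_
    have := Nat.find_spec hex'
    rwa [h] at this
  have hr0 : (E ^ (r + 1)) w = 0 := hr ▸ Nat.find_spec hex'
  have hr1 : (E ^ r) w ≠ 0 := Nat.find_min hex' (by omega)
  have hc2 : c = r * (k + r + 2) := by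
    have h1 : F ((E ^ (r + 1)) w) = (c - r * (k + r + 2)) • (E ^ r) w := by
      rcases r with _ | r
      · simp [hFEw]
      -- The same commutation formula with E and F exchanged and H negated, applied to E w, which
      -- has weight k + 3 for H.
      · have h2 := sl2_E_pow (E := F) (F := E) (H := -H) (c := -((k + 1 : ℕ) + 2)) (w := E w)
          (fun v => by rw [LinearMap.neg_apply, hEF]; abel)
          (fun v => by rw [LinearMap.neg_apply, LinearMap.neg_apply, hHE, map_neg]; abel)
          (by rw [LinearMap.neg_apply, hHE, hHw, map_smul, ← add_smul, neg_smul]) r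
        rw [hFEw, map_smul, ← Module.End.mul_apply (E ^ r), ← pow_succ, ← add_smul] at h2
        rw [pow_succ, Module.End.mul_apply, h2]
        congr 1
        push_cast
        ring
    rw [hr0, map_zero] at h1
    exact sub_eq_zero.1 ((smul_eq_zero.1 h1.symm).resolve_right hr1)
  have h3 : ((r * (k + r + 2) + (p + 1) * ((k - p) + 1) : ℕ) : ℂ) = 0 := by
    push_cast
    linear_combination hc1 - hc2
  have h4 : r * (k + r + 2) + (p + 1) * ((k - p) + 1) = 0 := by exact_mod_cast h3
  have h5 : 0 < (p + 1) * ((k - p) + 1) := by positivity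
  omega

end SlTwo

/-! ### Weight spaces -/

section WeightSpaces

variable {n : ℕ} {V : Type*} [AddCommGroup V] [Module ℂ V]

/-- The weight space of weight `μ`. -/
def wtSpace (ρ : Lie n →ₗ⁅ℂ⁆ Module.End ℂ V) (μ : Fin n → ℤ) : Submodule ℂ V where
  carrier := {v | ∀ i, ρ (cartan n i) v = (μ i : ℂ) • v}
  zero_mem' := by intro i; rw [map_zero, smul_zero]
  add_mem' := by intro a b ha hb i; rw [map_add, smul_add, ha i, hb i]
  smul_mem' := by intro c a ha i; rw [map_smul, ha i, smul_comm]

variable {ρ : Lie n →ₗ⁅ℂ⁆ Module.End ℂ V}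

theorem apply_mem_wtSpace {α μ : Fin n → ℤ} {x : Lie n}
    (hx : ∀ i, ⁅cartan n i, x⁆ = (α i : ℂ) • x) {v : V} (hv : v ∈ wtSpace ρ μ) :
    ρ x v ∈ wtSpace ρ (μ + α) := by
  intro i
  rw [lie_apply, hx, hv i, map_smul, map_smul, LinearMap.smul_apply, ← add_smul]
  congr 1
  push_cast [Pi.add_apply]
  ring

theorem pow_apply_mem_wtSpace {α μ : Fin n → ℤ} {x : Lie n}
    (hx : ∀ i, ⁅cartan n i, x⁆ = (α i : ℂ) • x) {v : V} (hv : v ∈ wtSpace ρ μ) (m : ℕ) :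
    (ρ x ^ m) v ∈ wtSpace ρ (μ + m • α) := by
  induction m with
  | zero => simpa using hv
  | succ m ih =>
    rw [pow_succ', Module.End.mul_apply, succ_nsmul, ← add_assoc]
    exact apply_mem_wtSpace hx ih

variable {ι : Type*} [Fintype ι] {b : Module.Basis ι ℂ V} {w : ι → Fin n → ℤ}

theorem wtSpace_eq_span (hb : ∀ i, b i ∈ wtSpace ρ (w i)) (μ : Fin n → ℤ) :
    wtSpace ρ μ = Submodule.span ℂ (Set.range fun i : {i // w i = μ} => b i) := by
  refine le_antisymm (fun v hv => ?_) (Submodule.span_le.2 ?_)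
  · have h1 : ∀ i, b.repr v i ≠ 0 → w i = μ := by
      intro i hi
      ext k
      have h2 := congrArg (fun u => b.repr u i) (hv k)
      have h3 : ρ (cartan n k) v = ∑ j, b.repr v j • ((w j k : ℂ) • b j) := by
        conv_lhs => rw [← b.sum_repr v]
        simp only [map_sum, map_smul, hb _ k]
      simp only [h3, map_sum, map_smul, Finsupp.finsetSum_apply, Finsupp.smul_apply,
        b.repr_self, smul_eq_mul] at h2
      rw [Finset.sum_eq_single i (fun j _ hj => by simp [hj]) (by simp), Finsupp.single_eq_same,
        mul_one, mul_comm] at h2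
      have h4 : (w i k : ℂ) = μ k := mul_right_cancel₀ hi h2
      exact_mod_cast h4
    rw [← b.sum_repr v]
    refine Submodule.sum_mem _ fun i _ => ?_
    by_cases hi : b.repr v i = 0
    · rw [hi, zero_smul]; exact zero_mem _
    · exact Submodule.smul_mem _ _ (Submodule.subset_span ⟨⟨i, h1 i hi⟩, rfl⟩)
  · rintro _ ⟨⟨i, rfl⟩, rfl⟩
    exact hb i

theorem finrank_wtSpace (hb : ∀ i, b i ∈ wtSpace ρ (w i)) (μ : Fin n → ℤ) :
    Module.finrank ℂ (wtSpace ρ μ) = Fintype.card {i // w i = μ} := by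
  rw [wtSpace_eq_span hb, finrank_span_eq_card]
  exact b.linearIndependent.comp _ Subtype.val_injective

theorem wtSpace_eq_bot (hb : ∀ i, b i ∈ wtSpace ρ (w i)) {μ : Fin n → ℤ} (h : ∀ i, w i ≠ μ) :
    wtSpace ρ μ = ⊥ := by
  have : IsEmpty {i // w i = μ} := ⟨fun i => h i.1 i.2⟩
  rw [wtSpace_eq_span hb, Set.range_eq_empty, Submodule.span_empty]

/-- There are finitely many weights, while the weights μ + m α are pairwise distinct. -/
theorem exists_pow_apply_eq_zero (hb : ∀ i, b i ∈ wtSpace ρ (w i)) {α μ : Fin n → ℤ}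
    (hα : α ≠ 0) {x : Lie n} (hx : ∀ i, ⁅cartan n i, x⁆ = (α i : ℂ) • x) {v : V}
    (hv : v ∈ wtSpace ρ μ) : ∃ m, (ρ x ^ m) v = 0 := by
  by_contra! h
  have h1 : ∀ m : ℕ, ∃ i, w i = μ + m • α := by
    intro m
    by_contra! h2
    have h3 := pow_apply_mem_wtSpace hx hv m
    rw [wtSpace_eq_bot hb h2] at h3
    exact h m h3
  choose f hf using h1
  obtain ⟨k, hk⟩ := Function.ne_iff.1 hα
  refine not_injective_infinite_finite f fun m m' hmm => ?_
  have h2 := (hf m).symm.trans ((congrArg w hmm).trans (hf m'))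
  have h3 := congrFun h2 k
  simp only [Pi.add_apply, Pi.smul_apply, add_right_inj] at h3
  rw [nsmul_eq_mul, nsmul_eq_mul] at h3
  exact_mod_cast mul_right_cancel₀ hk h3

/-- The k-th power of the lowering operator embeds the weight space of μ into that of its
reflection. The normalization in `hlen` makes the multiple `jc a * jc c` of the root the coroot, for
long and short roots alike. -/
theorem finrank_wtSpace_le (hb : ∀ i, b i ∈ wtSpace ρ (w i)) {a c : Pos n} (hac : a ≠ c)
    (hlen : jc a * jc c * ∑ i, ((wt a i : ℂ) + wt c i) * ((wt a i : ℂ) + wt c i) = 2)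
    {μ : Fin n → ℤ} {k : ℕ} (hk : jc a * jc c * ∑ i, ((wt a i : ℂ) + wt c i) * μ i = k) :
    Module.finrank ℂ (wtSpace ρ μ) ≤ Module.finrank ℂ (wtSpace ρ (μ - k • (wt a + wt c))) := by
  have hfd : FiniteDimensional ℂ V := Module.Finite.of_basis b
  set α := wt a + wt c with hα
  have hα0 : α ≠ 0 := by
    intro h
    have h1 : ∀ i, (wt a i : ℂ) + wt c i = 0 := fun i => by
      have := congrFun h i
      rw [hα, Pi.add_apply, Pi.zero_apply] at this
      exact_mod_cast this
    simp [h1] at hlen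
  set e := gen a c
  set f := gen (bar c) (bar a)
  have he : ∀ i, ⁅cartan n i, e⁆ = (α i : ℂ) • e := fun i => lie_cartan_gen i a c
  have hf : ∀ i, ⁅cartan n i, f⁆ = ((-α) i : ℂ) • f := fun i => by
    rw [lie_cartan_gen, wt_bar, wt_bar, ← neg_add_rev]
  set h : Lie n := (jc a * jc c) • ∑ i, ((wt a i : ℂ) + (wt c i : ℂ)) • cartan n i with hh
  have hef : ⁅e, f⁆ = h := lie_gen_gen_bar hac
  have hact : ∀ (β : Fin n → ℤ) (x : Lie n), (∀ i, ⁅cartan n i, x⁆ = (β i : ℂ) • x) →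
      ⁅h, x⁆ = (jc a * jc c * ∑ i, ((wt a i : ℂ) + wt c i) * β i) • x := by
    intro β x hx
    rw [hh, smul_lie, sum_lie]
    simp only [smul_lie, hx, smul_smul]
    rw [← Finset.sum_smul, smul_smul]
  have hhe : ⁅h, e⁆ = (2 : ℂ) • e := by
    rw [hact α e he, ← hlen]
    simp [hα]
  have hhf : ⁅h, f⁆ = -((2 : ℂ) • f) := by
    rw [hact (-α) f hf, ← hlen, ← neg_smul]
    congr 1
    simp [hα, mul_neg, Finset.sum_neg_distrib, -neg_add_rev]
  have hF : ∀ x ∈ wtSpace ρ μ, (ρ f ^ k) x ∈ wtSpace ρ (μ - k • α) := by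
    intro x hx
    have := pow_apply_mem_wtSpace hf hx k
    rwa [smul_neg, ← sub_eq_add_neg] at this
  refine LinearMap.finrank_le_finrank_of_injective (f := (ρ f ^ k).restrict hF) ?_
  rw [← LinearMap.ker_eq_bot, LinearMap.ker_eq_bot']
  rintro ⟨x, hx⟩ hx0
  have hx0' : (ρ f ^ k) x = 0 := congrArg Subtype.val hx0
  refine Subtype.ext (sl2_pow_injective (E := ρ e) (F := ρ f) (H := ρ h) (P := wtSpace ρ μ)
    ?_ ?_ ?_ ?_ ?_ ?_ hx hx0')
  · intro v
    rw [lie_apply, hef, add_comm]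
  · intro v
    rw [lie_apply, hhe, map_smul, add_comm]
    rfl
  · intro v
    rw [lie_apply, hhf, map_neg, map_smul, add_comm, sub_eq_add_neg]
    rfl
  · intro v hv
    rw [hh]
    simp only [map_smul, map_sum, LinearMap.smul_apply, LinearMap.sum_apply, hv _, smul_smul]
    rw [← Finset.sum_smul, smul_smul, hk]
  · intro v hv
    have := apply_mem_wtSpace hf (apply_mem_wtSpace he hv)
    rwa [add_neg_cancel_right] at this
  · intro v hv
    exact exists_pow_apply_eq_zero hb hα0 he hv

theorem finrank_wtSpace_le_swap (hb : ∀ i, b i ∈ wtSpace ρ (w i)) {i j : Fin n} (hij : i ≠ j)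
    {μ : Fin n → ℤ} (h : μ j ≤ μ i) :
    Module.finrank ℂ (wtSpace ρ μ) ≤ Module.finrank ℂ (wtSpace ρ (swapWt i j μ)) := by
  obtain ⟨k, hk⟩ := Int.eq_ofNat_of_zero_le (sub_nonneg.2 h)
  have hsum : ∀ ν : Fin n → ℤ, ∑ k, ((eps i k : ℂ) + ((-eps j) k : ℤ)) * ν k = ν i - ν j := by
    intro ν
    simp [eps, Pi.single_apply, add_mul, Finset.sum_add_distrib, sub_eq_add_neg]
  have h1 := finrank_wtSpace_le (ρ := ρ) hb (a := Sum.inr (Sum.inl i)) (c := Sum.inr (Sum.inr j))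
    (by simp) (μ := μ) (k := k) ?_ ?_
  · refine h1.trans_eq (congrArg (fun ν => Module.finrank ℂ (wtSpace ρ ν)) ?_)
    ext a
    simp only [wt_inr_inl, wt_inr_inr, eps, swapWt, AddEquiv.coe_mk, Equiv.coe_fn_mk,
      Function.comp, Pi.sub_apply, Pi.smul_apply, Pi.add_apply, Pi.neg_apply,
      Pi.single_apply, Equiv.swap_apply_def]
    have hk' : (k : ℤ) = μ i - μ j := hk.symm
    rw [nsmul_eq_mul, hk']
    split_ifs with h1 h2 h2
    · exact absurd (h1.symm.trans h2) hij
    · subst h1; ring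
    · subst h2; ring
    · ring
  · have := hsum (eps i - eps j)
    simp only [wt_inr_inl, wt_inr_inr, jc, Sum.elim_inr, Pi.one_apply, one_mul]
    refine Eq.trans ?_ (this.trans ?_)
    · refine Finset.sum_congr rfl fun k _ => ?_
      push_cast [Pi.sub_apply, Pi.neg_apply]
      ring
    · simp [eps, hij, hij.symm]
      norm_num
  · simp only [wt_inr_inl, wt_inr_inr, jc, Sum.elim_inr, Pi.one_apply, one_mul]
    rw [hsum]
    exact_mod_cast hk

theorem swapWt_swapWt (i j : Fin n) (μ : Fin n → ℤ) : swapWt i j (swapWt i j μ) = μ :=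
  (swapWt i j).left_inv μ

theorem negWt_negWt (i : Fin n) (μ : Fin n → ℤ) : negWt i (negWt i μ) = μ :=
  (negWt i).left_inv μ

theorem swapWt_comm (i j : Fin n) : swapWt i j = swapWt j i := by
  ext μ a
  simp [swapWt, Equiv.swap_comm]

theorem finrank_wtSpace_swap (hb : ∀ i, b i ∈ wtSpace ρ (w i)) {i j : Fin n} (hij : i ≠ j)
    (μ : Fin n → ℤ) :
    Module.finrank ℂ (wtSpace ρ (swapWt i j μ)) = Module.finrank ℂ (wtSpace ρ μ) := by
  have key : ∀ μ : Fin n → ℤ,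
      Module.finrank ℂ (wtSpace ρ μ) ≤ Module.finrank ℂ (wtSpace ρ (swapWt i j μ)) := by
    intro μ
    rcases le_total (μ j) (μ i) with h | h
    · exact finrank_wtSpace_le_swap hb hij h
    · rw [swapWt_comm]
      exact finrank_wtSpace_le_swap hb hij.symm h
  refine le_antisymm ?_ (key μ)
  have := key (swapWt i j μ)
  rwa [swapWt_swapWt] at this

theorem finrank_wtSpace_neg (hb : ∀ i, b i ∈ wtSpace ρ (w i)) (i : Fin n) (μ : Fin n → ℤ) :
    Module.finrank ℂ (wtSpace ρ (negWt i μ)) = Module.finrank ℂ (wtSpace ρ μ) := by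
  have hsum : ∀ ν : Fin n → ℤ, ∑ k, (eps i k : ℂ) * ν k = ν i := by
    intro ν
    simp [eps, Pi.single_apply]
  have hsum' : ∑ k, (eps i k : ℂ) * eps i k = 1 := by
    rw [hsum]; simp [eps]
  have key : ∀ μ : Fin n → ℤ,
      Module.finrank ℂ (wtSpace ρ μ) ≤ Module.finrank ℂ (wtSpace ρ (negWt i μ)) := by
    intro μ
    rcases le_total 0 (μ i) with h | h
    · obtain ⟨k, hk⟩ := Int.eq_ofNat_of_zero_le h
      -- The coroot of the short root ε_i is 2 h_i, so its pairing with μ is 2 μ_i.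
      have h1 := finrank_wtSpace_le (ρ := ρ) hb (a := Sum.inr (Sum.inl i)) (c := Sum.inl ())
        (by simp) (μ := μ) (k := 2 * k) ?_ ?_
      · refine h1.trans_eq (congrArg (fun ν => Module.finrank ℂ (wtSpace ρ ν)) ?_)
        ext a
        simp only [wt_inr_inl, wt_inl, negWt, AddEquiv.coe_mk, Equiv.coe_fn_mk]
        by_cases ha : a = i
        · subst ha
          simp [eps, hk]; ring
        · simp [eps, ha]
      · simp [wt_inr_inl, wt_inl, jc, hsum']
      · simp [wt_inr_inl, wt_inl, jc, hsum, hk]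
    · obtain ⟨k, hk⟩ := Int.eq_ofNat_of_zero_le (neg_nonneg.2 h)
      have hk' : μ i = -k := by omega
      have h1 := finrank_wtSpace_le (ρ := ρ) hb (a := Sum.inr (Sum.inr i)) (c := Sum.inl ())
        (by simp) (μ := μ) (k := 2 * k) ?_ ?_
      · refine h1.trans_eq (congrArg (fun ν => Module.finrank ℂ (wtSpace ρ ν)) ?_)
        ext a
        simp only [wt_inr_inr, wt_inl, negWt, AddEquiv.coe_mk, Equiv.coe_fn_mk]
        by_cases ha : a = i
        · subst ha
          simp [eps, hk']; ring
        · simp [eps, ha]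
      · simp [wt_inr_inr, wt_inl, jc, hsum']
      · simp [wt_inr_inr, wt_inl, jc, hsum, hk', Finset.sum_neg_distrib]
  refine le_antisymm ?_ (key μ)
  have := key (negWt i μ)
  rwa [negWt_negWt] at this

/-! ### Weyl invariance of formal characters -/

theorem coeff_fchar (w : ι → Fin n → ℤ) (μ : Fin n → ℤ) :
    (fchar w).coeff μ = (Fintype.card {i // w i = μ} : ℂ) := by
  classical
  simp only [fchar, AddMonoidAlgebra.coeff_sum, Finsupp.finsetSum_apply,
    AddMonoidAlgebra.coeff_single, Finsupp.single_apply]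
  rw [Finset.sum_boole, Fintype.card_subtype]

theorem domCongr_swap_fchar (hb : ∀ i, b i ∈ wtSpace ρ (w i)) {i j : Fin n} (hij : i ≠ j) :
    AddMonoidAlgebra.domCongr ℂ ℂ (swapWt i j) (fchar w) = fchar w := by
  apply AddMonoidAlgebra.ext
  ext μ
  rw [AddMonoidAlgebra.coeff_domCongr, coeff_fchar, coeff_fchar, ← finrank_wtSpace hb,
    ← finrank_wtSpace hb]
  congr 1
  exact finrank_wtSpace_swap hb hij μ

theorem domCongr_neg_fchar (hb : ∀ i, b i ∈ wtSpace ρ (w i)) (i : Fin n) :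
    AddMonoidAlgebra.domCongr ℂ ℂ (negWt i) (fchar w) = fchar w := by
  apply AddMonoidAlgebra.ext
  ext μ
  rw [AddMonoidAlgebra.coeff_domCongr, coeff_fchar, coeff_fchar, ← finrank_wtSpace hb,
    ← finrank_wtSpace hb]
  congr 1
  exact finrank_wtSpace_neg hb i μ

end WeightSpaces

end TypeB

end

noncomputable section

namespace TypeB

attribute [local instance 100] LieRing.ofAssociativeRing

/-! ### The Casimir operator -/

section Casimir

variable {n : ℕ} {V : Type*} [AddCommGroup V] [Module ℂ V]

/-- The Casimir operator of a representation. -/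
def casimir (ρ : Lie n →ₗ⁅ℂ⁆ Module.End ℂ V) : Module.End ℂ V :=
  ∑ a, ∑ c, (jc a * jc c)⁻¹ • (ρ (gen a c) * ρ (gen (bar c) (bar a)))

theorem sum_bar {M : Type*} [AddCommMonoid M] (f : Pos n → M) : ∑ b, f (bar b) = ∑ b, f b :=
  Equiv.sum_comp (Function.Involutive.toPerm bar bar_bar) f

/-- The Leibniz rule gives four sums, in which X acts on a, on c, on the dual of c and on the dual
of a. Skew-adjointness of X makes the sums for an index and its dual cancel after reindexing by
`bar`. -/
theorem casimir_comm (ρ : Lie n →ₗ⁅ℂ⁆ Module.End ℂ V) (X : Lie n) :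
    ρ X * casimir ρ = casimir ρ * ρ X := by
  have hX := (mem_Lie_iff X.1).1 X.2
  have hX' : ∀ a b : Pos n, (jc b)⁻¹ * X.1 (bar a) (bar b) = -((jc a)⁻¹ * X.1 b a) := by
    intro a b
    have h1 := hX (bar b) a
    rw [bar_bar, jc_bar] at h1
    have ha := jc_ne_zero a
    have hb := jc_ne_zero b
    field_simp
    linear_combination h1
  have hlie : ∀ Y Z : Module.End ℂ V, ρ X * (Y * Z) - Y * Z * ρ X = ⁅ρ X, Y⁆ * Z + Y * ⁅ρ X, Z⁆ := by
    intro Y Z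
    simp only [Ring.lie_def]
    noncomm_ring
  rw [← sub_eq_zero, casimir, Finset.mul_sum, Finset.sum_mul, ← Finset.sum_sub_distrib]
  simp only [Finset.mul_sum, Finset.sum_mul, ← Finset.sum_sub_distrib, mul_smul_comm,
    smul_mul_assoc, ← smul_sub, hlie, ← LieHom.map_lie, lie_gen, map_add, map_sum, map_smul,
    add_mul, mul_add, smul_add, Finset.smul_sum, smul_smul, Finset.sum_add_distrib]
  have h14 : ∑ a, ∑ c, ∑ b, ((jc a * jc c)⁻¹ * X.1 b a) •
        (ρ (gen b c) * ρ (gen (bar c) (bar a))) +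
      ∑ a, ∑ c, ∑ b, ((jc a * jc c)⁻¹ * X.1 b (bar a)) •
        (ρ (gen a c) * ρ (gen (bar c) b)) = 0 := by
    have e : ∑ a, ∑ c, ∑ b, ((jc a * jc c)⁻¹ * X.1 b (bar a)) •
        (ρ (gen a c) * ρ (gen (bar c) b)) =
        ∑ a, ∑ c, ∑ b, ((jc b * jc c)⁻¹ * X.1 (bar a) (bar b)) •
          (ρ (gen b c) * ρ (gen (bar c) (bar a))) := by
      simp only [← sum_bar fun b => ((jc _ * jc _)⁻¹ * X.1 b _) •
        (ρ (gen _ _) * ρ (gen (bar _) b))]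
      rw [Finset.sum_comm]
      conv_rhs => rw [Finset.sum_comm]
      refine Finset.sum_congr rfl fun c _ => ?_
      rw [Finset.sum_comm]
    rw [e, ← Finset.sum_add_distrib]
    refine Finset.sum_eq_zero fun a _ => ?_
    rw [← Finset.sum_add_distrib]
    refine Finset.sum_eq_zero fun c _ => ?_
    rw [← Finset.sum_add_distrib]
    refine Finset.sum_eq_zero fun b _ => ?_
    rw [← add_smul, mul_inv, mul_inv]
    have : (jc a)⁻¹ * (jc c)⁻¹ * X.1 b a + (jc b)⁻¹ * (jc c)⁻¹ * X.1 (bar a) (bar b) = 0 := by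
      linear_combination (jc c)⁻¹ * hX' a b
    rw [this, zero_smul]
  have h23 : ∑ a, ∑ c, ∑ b, ((jc a * jc c)⁻¹ * X.1 b c) •
        (ρ (gen a b) * ρ (gen (bar c) (bar a))) +
      ∑ a, ∑ c, ∑ b, ((jc a * jc c)⁻¹ * X.1 b (bar c)) •
        (ρ (gen a c) * ρ (gen b (bar a))) = 0 := by
    have e : ∑ a, ∑ c, ∑ b, ((jc a * jc c)⁻¹ * X.1 b (bar c)) •
        (ρ (gen a c) * ρ (gen b (bar a))) =
        ∑ a, ∑ c, ∑ b, ((jc a * jc b)⁻¹ * X.1 (bar c) (bar b)) •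
          (ρ (gen a b) * ρ (gen (bar c) (bar a))) := by
      simp only [← sum_bar fun b => ((jc _ * jc _)⁻¹ * X.1 b _) •
        (ρ (gen _ _) * ρ (gen b (bar _)))]
      refine Finset.sum_congr rfl fun a _ => ?_
      rw [Finset.sum_comm]
    rw [e, ← Finset.sum_add_distrib]
    refine Finset.sum_eq_zero fun a _ => ?_
    rw [← Finset.sum_add_distrib]
    refine Finset.sum_eq_zero fun c _ => ?_
    rw [← Finset.sum_add_distrib]
    refine Finset.sum_eq_zero fun b _ => ?_
    rw [← add_smul, mul_inv, mul_inv]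
    have : (jc a)⁻¹ * (jc c)⁻¹ * X.1 b c + (jc a)⁻¹ * (jc b)⁻¹ * X.1 (bar c) (bar b) = 0 := by
      linear_combination (jc a)⁻¹ * hX' c b
    rw [this, zero_smul]
  have h := congrArg₂ (· + ·) h14 h23
  simp only [add_zero] at h
  rw [← h]
  abel

end Casimir

/-! ### Weight bases of highest weight modules -/

section WeightBasis

variable {n : ℕ} {V : Type*} [AddCommGroup V] [Module ℂ V]
  {ρ : Lie n →ₗ⁅ℂ⁆ Module.End ℂ V} {lam : Fin n → ℤ} {v : V}

/-- A basis is chosen among the descendants of v, which are weight vectors. All but v itself have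
positive height, so the weight `lam` occurs once. -/
theorem exists_weight_basis [FiniteDimensional ℂ V] (hv : IsHighest ρ lam v) (hv0 : v ≠ 0)
    (hspan : Submodule.span ℂ {w | ∃ k δ, Descendant ρ v k δ w} = ⊤) :
    ∃ (ι : Type) (_ : Fintype ι) (b : Module.Basis ι ℂ V) (w : ι → Fin n → ℤ),
      (∀ i, b i ∈ wtSpace ρ (w i)) ∧ (∀ i, lam - w i ∈ cone n) ∧
        Fintype.card {i // w i = lam} = 1 := by
  obtain ⟨s, hs, hspan', hli⟩ := exists_linearIndependent ℂ {w | ∃ k δ, Descendant ρ v k δ w}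
  let b₀ : Module.Basis s ℂ V := Module.Basis.mk hli (by
    rw [Subtype.range_coe, hspan', hspan])
  have hfin : Finite s := Module.Finite.finite_basis b₀
  obtain ⟨N, ⟨e⟩⟩ := Finite.exists_equiv_fin s
  let b : Module.Basis (Fin N) ℂ V := b₀.reindex e
  have hb : ∀ i, ∃ k δ, Descendant ρ v k δ (b i) := by
    intro i
    have h1 : b i = (e.symm i : s).1 := by simp [b, b₀]
    rw [h1]
    exact hs (e.symm i).2
  choose k δ hδ using hb
  have hmem : ∀ i, b i ∈ wtSpace ρ (lam - δ i) := fun i j => (hδ i).weight hv j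
  refine ⟨Fin N, inferInstance, b, fun i => lam - δ i, hmem, fun i => ?_, ?_⟩
  · rw [sub_sub_cancel]
    exact (hδ i).mem_cone
  · rw [Fintype.card_eq_one_iff]
    have hex : ∃ i, lam - δ i = lam := by
      by_contra! h
      have h1 := wtSpace_eq_bot hmem h
      have h2 : v ∈ wtSpace ρ lam := hv.2
      rw [h1] at h2
      exact hv0 h2
    have hval : ∀ i, lam - δ i = lam → b i = v := by
      intro i hi
      rcases (hδ i).height with h | h
      · exact h.2
      · have : δ i = 0 := by simpa using hi
        rw [this] at h
        simp at h
    obtain ⟨i, hi⟩ := hex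
    refine ⟨⟨i, hi⟩, fun j => Subtype.ext (b.injective ?_)⟩
    rw [hval i hi, hval j.1 j.2]

/-- The Casimir operator preserves the line of weight `lam`, and the scalar found there spreads to
all descendants because it commutes with the lowering operators. -/
theorem casimir_eq_smul {ι : Type*} [Fintype ι] {b : Module.Basis ι ℂ V} {w : ι → Fin n → ℤ}
    (hv : IsHighest ρ lam v) (hv0 : v ≠ 0)
    (hspan : Submodule.span ℂ {w | ∃ k δ, Descendant ρ v k δ w} = ⊤)
    (hb : ∀ i, b i ∈ wtSpace ρ (w i)) (hone : Fintype.card {i // w i = lam} = 1) :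
    ∃ κ : ℂ, casimir ρ = κ • 1 := by
  have hvm : v ∈ wtSpace ρ lam := hv.2
  have hcv : casimir ρ v ∈ wtSpace ρ lam := by
    intro i
    rw [← Module.End.mul_apply, casimir_comm, Module.End.mul_apply, hv.2, map_smul]
  have hdim : Module.finrank ℂ (wtSpace ρ lam) = 1 := by rw [finrank_wtSpace hb, hone]
  obtain ⟨κ, hκ⟩ := (finrank_eq_one_iff_of_nonzero' (⟨v, hvm⟩ : wtSpace ρ lam)
    (fun h => hv0 (congrArg Subtype.val h))).1 hdim ⟨_, hcv⟩
  have hκ' : casimir ρ v = κ • v := (congrArg Subtype.val hκ).symm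
  refine ⟨κ, ?_⟩
  have hdesc : ∀ k δ w, Descendant ρ v k δ w → casimir ρ w = κ • w := by
    intro k δ w h
    induction h with
    | base => exact hκ'
    | @step k δ α w y _ _ _ ih =>
      rw [← Module.End.mul_apply, ← casimir_comm, Module.End.mul_apply, ih, map_smul]
  refine LinearMap.ext_on_range (v := fun x : {w | ∃ k δ, Descendant ρ v k δ w} => x.1)
    (by rw [Subtype.range_coe, hspan]) ?_
  rintro ⟨w, k, δ, h⟩
  exact hdesc k δ w h

end WeightBasis

/-! ### Leading terms -/

section LeadingTerm

variable {n : ℕ}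

/-- All exponents of `f` lie below `c` in the dominance order. -/
def Below (c : Fin n → ℤ) (f : Laurent ℂ n) : Prop := ∀ ν, f.coeff ν ≠ 0 → c - ν ∈ cone n

theorem Below.add {c : Fin n → ℤ} {f g : Laurent ℂ n} (hf : Below c f) (hg : Below c g) :
    Below c (f + g) := by
  intro ν h
  rw [AddMonoidAlgebra.coeff_add, Finsupp.add_apply] at h
  by_cases h1 : f.coeff ν = 0
  · rw [h1, zero_add] at h
    exact hg ν h
  · exact hf ν h1

theorem Below.sub {c : Fin n → ℤ} {f g : Laurent ℂ n} (hf : Below c f) (hg : Below c g) :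
    Below c (f - g) := by
  intro ν h
  rw [AddMonoidAlgebra.coeff_sub, Finsupp.sub_apply] at h
  by_cases h1 : f.coeff ν = 0
  · rw [h1, zero_sub, neg_ne_zero] at h
    exact hg ν h
  · exact hf ν h1

theorem below_single {c μ : Fin n → ℤ} (h : c - μ ∈ cone n) (z : ℂ) :
    Below c (AddMonoidAlgebra.single μ z) := by
  intro ν hν
  rw [AddMonoidAlgebra.coeff_single, Finsupp.single_apply] at hν
  split_ifs at hν with h1
  · rwa [← h1]
  · exact absurd rfl hν

theorem Below.mul {c d : Fin n → ℤ} {f g : Laurent ℂ n} (hf : Below c f) (hg : Below d g) :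
    Below (c + d) (f * g) := by
  intro ν h
  by_contra hν
  apply h
  rw [AddMonoidAlgebra.coeff_mul]
  refine Finset.sum_eq_zero fun a ha => Finset.sum_eq_zero fun b hb => if_neg ?_
  rintro rfl
  apply hν
  rw [add_sub_add_comm]
  exact add_mem (hf a (Finsupp.mem_support_iff.1 ha)) (hg b (Finsupp.mem_support_iff.1 hb))

theorem Below.prod {ι : Type*} (S : Finset ι) {c : ι → Fin n → ℤ} {f : ι → Laurent ℂ n}
    (h : ∀ i ∈ S, Below (c i) (f i)) : Below (∑ i ∈ S, c i) (∏ i ∈ S, f i) := by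
  classical
  induction S using Finset.induction_on with
  | empty =>
    rw [Finset.sum_empty, Finset.prod_empty, AddMonoidAlgebra.one_def]
    exact below_single (by rw [sub_zero]; exact zero_mem _) 1
  | insert a S ha ih =>
    rw [Finset.prod_insert ha, Finset.sum_insert ha]
    exact (h a (Finset.mem_insert_self a S)).mul
      (ih fun i hi => h i (Finset.mem_insert_of_mem hi))

/-- In the product formula the factor e^(ε_i) - 1 and each Vandermonde factor for i < j are bounded
above by ε_i, and these bounds add up to `rho n`. -/
theorem below_alt_rho : Below (rho n) (alt (xU ℂ) (rho n)) := by
  have hroot : ∀ {α : Fin n → ℤ}, α ∈ posRoots n → α ∈ cone n :=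
    fun h => AddSubmonoid.subset_closure h
  have heps : ∀ i : Fin n, eps i ∈ cone n := fun i => hroot (Or.inl ⟨i, rfl⟩)
  have hself : ∀ i : Fin n, Below (eps i) (xU ℂ i : Laurent ℂ n) := fun i => by
    rw [val_xU]
    exact below_single (by rw [sub_self]; exact zero_mem _) 1
  rw [alt_rho, Matrix.det_vandermonde]
  have h1 : Below (0 : Fin n → ℤ) ((Equiv.Perm.sign (Fin.revPerm : Equiv.Perm (Fin n)) : ℤ) :
      Laurent ℂ n) := by
    rw [← map_intCast (algebraMap ℂ (Laurent ℂ n)), AddMonoidAlgebra.coe_algebraMap]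
    exact below_single (by rw [sub_zero]; exact zero_mem _) _
  have h2 : Below (∑ i : Fin n, eps i) (∏ i : Fin n, ((xU ℂ i : Laurent ℂ n) - 1)) :=
    Below.prod _ fun i _ => (hself i).sub (by
      rw [AddMonoidAlgebra.one_def]
      exact below_single (by rw [sub_zero]; exact heps i) 1)
  have h3 : Below (∑ i : Fin n, ∑ _j ∈ Finset.Ioi i, eps i) (∏ i : Fin n, ∏ j ∈ Finset.Ioi i,
      ((xU ℂ j : Laurent ℂ n) + ((xU ℂ j)⁻¹ : (Laurent ℂ n)ˣ) -
        ((xU ℂ i : Laurent ℂ n) + ((xU ℂ i)⁻¹ : (Laurent ℂ n)ˣ)))) := by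
    refine Below.prod _ fun i _ => Below.prod _ fun j hj => ?_
    have hij : i < j := Finset.mem_Ioi.1 hj
    refine Below.sub (Below.add ?_ ?_) (Below.add (hself i) ?_)
    · rw [val_xU]
      exact below_single (hroot (Or.inr ⟨i, j, hij, Or.inr rfl⟩)) 1
    · rw [val_xU_inv]
      exact below_single (by
        rw [sub_neg_eq_add]; exact hroot (Or.inr ⟨i, j, hij, Or.inl rfl⟩)) 1
    · rw [val_xU_inv]
      exact below_single (by rw [sub_neg_eq_add]; exact add_mem (heps i) (heps i)) 1
  have h4 := h1.mul (h2.mul h3)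
  convert h4 using 1
  rw [zero_add, ← Finset.sum_add_distrib, ← sum_zsmul_eps (rho n)]
  refine Finset.sum_congr rfl fun i _ => ?_
  -- One ε_i comes from e^(ε_i) - 1 and n - 1 - i of them come from the pairs i < j.
  have h5 : rho n i = 1 + ((n - 1 - i : ℕ) : ℤ) := by
    have := i.isLt
    simp only [rho]
    omega
  rw [Finset.sum_const, Fin.card_Ioi, h5, add_zsmul, one_zsmul, natCast_zsmul]

theorem cone_eq_zero_of_add_eq_zero {δ δ' : Fin n → ℤ} (h : δ ∈ cone n) (h' : δ' ∈ cone n)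
    (h0 : δ + δ' = 0) : δ = 0 := by
  rcases pairing_cone (rho_strictAnti n) rho_pos h with h1 | h1
  · exact h1
  · exfalso
    have h2 : ∑ i, rho n i * δ i + ∑ i, rho n i * δ' i = 0 := by
      rw [← Finset.sum_add_distrib]
      refine Finset.sum_eq_zero fun i _ => ?_
      rw [← mul_add, ← Pi.add_apply, h0, Pi.zero_apply, mul_zero]
    rcases pairing_cone (rho_strictAnti n) rho_pos h' with h3 | h3
    · subst h3
      simp only [Pi.zero_apply, mul_zero, Finset.sum_const_zero] at h2
      omega
    · omega

/-- With l and ν strictly dominant, l + ν - 1 is strictly decreasing and positive, so the right side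
detects whether an element l - ν of the cone is zero. -/
theorem quad_sub_quad (l ν : Fin n → ℤ) :
    quad l - quad ν = ∑ i, (l i + ν i - 1) * (l - ν) i := by
  unfold quad
  rw [← Finset.sum_sub_distrib]
  refine Finset.sum_congr rfl fun i _ => ?_
  rw [Pi.sub_apply]
  ring

end LeadingTerm

end TypeB

end

noncomputable section

namespace TypeB

attribute [local instance 100] LieRing.ofAssociativeRing

/-! ### The Weyl character formula -/

section WeylCharacter

variable {n : ℕ} {V : Type*} [AddCommGroup V] [Module ℂ V]
  {ρ : Lie n →ₗ⁅ℂ⁆ Module.End ℂ V} {lam : Fin n → ℤ} {v : V}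

theorem toMatrix_cartan {ι : Type*} [Fintype ι] [DecidableEq ι] {b : Module.Basis ι ℂ V}
    {w : ι → Fin n → ℤ} (hb : ∀ i, b i ∈ wtSpace ρ (w i)) (k : Fin n) :
    LinearMap.toMatrixAlgEquiv b (ρ (cartan n k)) = Matrix.diagonal fun i => (w i k : ℂ) := by
  ext i j
  rw [LinearMap.toMatrixAlgEquiv_apply, hb j k, map_smul, b.repr_self, Matrix.diagonal_apply]
  simp only [Finsupp.smul_apply, smul_eq_mul, Finsupp.single_apply]
  split_ifs with h1 h2 h2
  · rw [mul_one, h1]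
  · exact absurd h1.symm h2
  · exact absurd h2.symm h1
  · rw [mul_zero]

/-- The Weyl character formula for a finite-dimensional highest weight module. -/
theorem alt_rho_mul_fchar [FiniteDimensional ℂ V] (hv : IsHighest ρ lam v) (hv0 : v ≠ 0)
    (hspan : Submodule.span ℂ {w | ∃ k δ, Descendant ρ v k δ w} = ⊤)
    (hdom : StrictAnti (lam + rho n)) (hge : ∀ i, 1 ≤ (lam + rho n) i) :
    ∃ (ι : Type) (_ : Fintype ι) (w : ι → Fin n → ℤ),
      (∀ μ, Module.finrank ℂ (wtSpace ρ μ) = Fintype.card {i // w i = μ}) ∧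
        alt (xU ℂ) (rho n) * fchar w = alt (xU ℂ) (lam + rho n) := by
  classical
  obtain ⟨ι, _, b, w, hb, hcone, hone⟩ := exists_weight_basis hv hv0 hspan
  obtain ⟨κ, hκ⟩ := casimir_eq_smul hv hv0 hspan hb hone
  refine ⟨ι, inferInstance, w, finrank_wtSpace hb, ?_⟩
  let R : Lie n →ₗ⁅ℂ⁆ Matrix ι ι ℂ :=
    (AlgHom.toLieHom (LinearMap.toMatrixAlgEquiv b).toAlgHom).comp ρ
  have hR : ∀ x, R x = LinearMap.toMatrixAlgEquiv b (ρ x) := fun _ => rfl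
  have hw : ∀ k, R (cartan n k) = Matrix.diagonal fun i => (w i k : ℂ) :=
    fun k => toMatrix_cartan hb k
  have hC : ∑ a, ∑ c, (jc a * jc c)⁻¹ • (R (gen a c) * R (gen (bar c) (bar a))) = κ • 1 := by
    have h := congrArg (LinearMap.toMatrixAlgEquiv b) hκ
    simpa only [casimir, map_sum, map_smul, map_mul, map_one, hR] using h
  set f := alt (xU ℂ) (rho n) * fchar w with hf
  have hfw : Below lam (fchar w) := by
    intro ν h
    rw [coeff_fchar, Nat.cast_ne_zero, ← Nat.pos_iff_ne_zero, Fintype.card_pos_iff] at h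
    obtain ⟨i, rfl⟩ := h
    exact hcone i
  have hbelow : Below (lam + rho n) f := by
    rw [add_comm]
    exact below_alt_rho.mul hfw
  have hlead : f.coeff (lam + rho n) = 1 := by
    -- The exponent arises only as `rho n` plus `lam`, because the cone is pointed, and both leading
    -- coefficients are 1.
    rw [hf, add_comm, AddMonoidAlgebra.coeff_mul_add_of_uniqueAdd, coeff_fchar, hone,
      coeff_alt_dominant ℂ (rho_strictAnti n) rho_pos (rho_strictAnti n) rho_pos, if_pos rfl]
    · simp
    · intro a c ha hc h
      have h1 := below_alt_rho a (Finsupp.mem_support_iff.1 ha)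
      have h2 := hfw c (Finsupp.mem_support_iff.1 hc)
      have h3 : (rho n - a) + (lam - c) = 0 := by
        rw [← add_sub_add_comm, h, sub_self]
      have h4 := cone_eq_zero_of_add_eq_zero h1 h2 h3
      have h5 := cone_eq_zero_of_add_eq_zero h2 h1 (by rw [add_comm, h3])
      exact ⟨(sub_eq_zero.1 h4).symm, (sub_eq_zero.1 h5).symm⟩
  rw [← sub_eq_zero]
  refine eq_zero_of_antisymm _ (fun i j hij => ?_) (fun i => ?_) fun ν hν hν1 => ?_
  · rw [map_sub, hf, map_mul, domCongr_swap_alt hij, domCongr_swap_alt hij,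
      domCongr_swap_fchar hb hij]
    ring
  · rw [map_sub, hf, map_mul, domCongr_neg_alt, domCongr_neg_alt, domCongr_neg_fchar hb]
    ring
  · rw [AddMonoidAlgebra.coeff_sub, Finsupp.sub_apply, coeff_alt_dominant ℂ hdom hge hν hν1]
    split_ifs with h
    · rw [← h, hlead, sub_self]
    · rw [sub_zero]
      by_contra hne
      -- Both exponents lie on one sphere, so their difference, an element of the cone, pairs to
      -- zero with a strictly dominant vector and therefore vanishes.
      have h1 : quad (lam + rho n) = quad ν :=
        quad_eq_of_coeff_ne_zero hw hC (by rw [← hf, hlead]; exact one_ne_zero) hne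
      have h2 := quad_sub_quad (lam + rho n) ν
      rw [h1, sub_self] at h2
      rcases pairing_cone (κ := fun i => (lam + rho n) i + ν i - 1)
        (fun i j hij => by have := hdom hij; have := hν hij; dsimp only; omega)
        (fun i => by have := hge i; have := hν1 i; omega) (hbelow ν hne) with h3 | h3
      · exact h (sub_eq_zero.1 h3)
      · omega

end WeylCharacter

/-! ### Change of coefficients -/

section Coefficients

variable {n : ℕ}

theorem mapRingHom_alt {R S : Type*} [CommRing R] [CommRing S] (f : R →+* S) (l : Fin n → ℤ) :
    AddMonoidAlgebra.mapRingHom (Fin n → ℤ) f (alt (xU R) l) = alt (xU S) l := by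
  rw [map_alt]
  congr 1
  ext1 i
  apply Units.ext
  change AddMonoidAlgebra.mapRingHom (Fin n → ℤ) f (xU R i : Laurent R n) = _
  rw [val_xU, val_xU, AddMonoidAlgebra.mapRingHom_single, map_one]

theorem mapRingHom_sum_single {R S : Type*} [CommRing R] [CommRing S] (f : R →+* S) {ι : Type*}
    [Fintype ι] (w : ι → Fin n → ℤ) :
    AddMonoidAlgebra.mapRingHom (Fin n → ℤ) f (∑ i, AddMonoidAlgebra.single (w i) 1) =
      ∑ i, AddMonoidAlgebra.single (w i) 1 := by
  simp only [map_sum, AddMonoidAlgebra.mapRingHom_single, map_one]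

/-- All coefficients are integers, so the identity descends from ℂ to ℤ and extends to any ring. -/
theorem alt_rho_mul_sum_single (S : Type*) [CommRing S] {ι : Type*} [Fintype ι]
    {w : ι → Fin n → ℤ} {l : Fin n → ℤ}
    (h : alt (xU ℂ) (rho n) * fchar w = alt (xU ℂ) l) :
    alt (xU S) (rho n) * ∑ i, AddMonoidAlgebra.single (w i) 1 = alt (xU S) l := by
  have hZ : alt (xU ℤ) (rho n) * ∑ i, AddMonoidAlgebra.single (w i) 1 = alt (xU ℤ) l := by
    have hinj : Function.Injective (AddMonoidAlgebra.mapRingHom (Fin n → ℤ) (Int.castRingHom ℂ)) := by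
      intro f g hfg
      apply AddMonoidAlgebra.ext
      ext ν
      have h1 := congrArg (fun p : Laurent ℂ n => p.coeff ν) hfg
      simp only [AddMonoidAlgebra.coeff_mapRingHom] at h1
      exact (Int.castRingHom ℂ).injective_int h1
    apply hinj
    rw [map_mul, mapRingHom_alt, mapRingHom_alt, mapRingHom_sum_single]
    exact h
  have h1 := congrArg (AddMonoidAlgebra.mapRingHom (Fin n → ℤ) (Int.castRingHom S)) hZ
  rwa [map_mul, mapRingHom_alt, mapRingHom_alt, mapRingHom_sum_single] at h1

/-- The Weyl character formula for `L(lam)`. -/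
theorem alt_rho_mul_chi (K : Type*) [Field K] {lam : Fin n → ℤ} (hlam : IsFDWeight lam)
    (hdom : StrictAnti (lam + rho n)) (hge : ∀ i, 1 ≤ (lam + rho n) i) :
    algebraMap (Laurent K n) (CharField K n) (alt (xU K) (rho n)) * chi K lam =
      algebraMap (Laurent K n) (CharField K n) (alt (xU K) (lam + rho n)) := by
  obtain ⟨W, _, _, _, ρ, v, hv, hv0⟩ := hlam
  obtain ⟨hgen, hfd⟩ := finiteDimensional_simple hv hv0
  obtain ⟨ι, _, w, hrank, hweyl⟩ := alt_rho_mul_fchar (isHighest_simpleGen lam)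
    (simpleGen_ne_zero lam hgen)
    (span_descendant_eq_top (isHighest_simpleGen lam) (span_simpleGen lam)) hdom hge
  -- `weightSpace` is by definition the weight space of the action of the Lie algebra through
  -- `envRep`.
  have hrank' : ∀ μ, Module.finrank ℂ (weightSpace lam μ) = Fintype.card {i // w i = μ} := hrank
  have hchi : chi K lam =
      algebraMap (Laurent K n) (CharField K n) (∑ i, AddMonoidAlgebra.single (w i) 1) := by
    classical
    unfold chi
    rw [finsum_eq_sum_of_support_subset (s := Finset.univ.image w), map_sum]
    · rw [← Finset.sum_fiberwise_of_maps_to (g := w) (t := Finset.univ.image w)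
        (fun i _ => Finset.mem_image_of_mem w (Finset.mem_univ i))]
      refine Finset.sum_congr rfl fun μ _ => ?_
      rw [hrank', Fintype.card_subtype, ← nsmul_eq_mul, ← Finset.sum_const]
      refine Finset.sum_congr rfl fun i hi => ?_
      rw [(Finset.mem_filter.1 hi).2]
      rfl
    · intro μ hμ
      have h1 : Module.finrank ℂ (weightSpace lam μ) ≠ 0 := fun h => hμ (by
        change (Module.finrank ℂ (weightSpace lam μ) : CharField K n) * _ = 0
        rw [h, Nat.cast_zero, zero_mul])
      rw [hrank', ← Nat.pos_iff_ne_zero, Fintype.card_pos_iff] at h1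
      obtain ⟨i, rfl⟩ := h1
      simp
  rw [hchi, ← map_mul, alt_rho_mul_sum_single K hweyl]

end Coefficients

end TypeB

end

noncomputable section

namespace TypeB

/-! ### Hook weights -/

section Hooks

variable {N k r : ℕ}

theorem rbar_le (hr : r < 2 * (N + 1)) : rbar (N + 1) r ≤ N := by
  unfold rbar
  omega

/-- Raising the first r̄ of the entries after the first by one opens a gap in the staircase, which
is the omitted entry. -/
theorem hook_add_rho : hook (N + 1) k r + rho (N + 1) =
    Fin.cons ((k : ℤ) - r + (N + 1)) (rhoOmit N (rbar (N + 1) r)) := by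
  ext i
  refine Fin.cases ?_ (fun a => ?_) i
  · simp [hook, rho]
  · simp only [hook, rho, rhoOmit, Pi.add_apply, Fin.cons_succ, Fin.val_succ]
    push_cast
    split_ifs <;> omega

theorem hook_antitone (hk : r < k) : Antitone (hook (N + 1) k r) := by
  intro i j hij
  have : (i : ℕ) ≤ j := hij
  simp only [hook]
  split_ifs <;> omega

theorem hook_nonneg (hk : r < k) (i : Fin (N + 1)) : 0 ≤ hook (N + 1) k r i := by
  simp only [hook]
  split_ifs <;> omega

/-- The hook weight is (k - r - 1) ε_1 plus ε_1 + ⋯ + ε_{r̄+1}, both realized by exterior powers and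
their tensor products. -/
theorem isFDWeight_hook (hr : r < 2 * (N + 1)) (hk : r < k) : IsFDWeight (hook (N + 1) k r) := by
  have h1 : IsFDWeight (fun i : Fin (N + 1) => if (i : ℕ) < rbar (N + 1) r + 1 then (1 : ℤ) else 0) :=
    isFDWeight_wedge (by have := rbar_le hr; omega)
  have h2 : IsFDWeight (fun i : Fin (N + 1) => if (i : ℕ) < 1 then (1 : ℤ) else 0) :=
    isFDWeight_wedge (by omega)
  obtain ⟨m, rfl⟩ : ∃ m, k = r + 1 + m := ⟨k - (r + 1), by omega⟩
  -- `IsFDWeight.nsmul` supplies positive multiples only, so k = r + 1 is separate.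
  rcases m with _ | m
  · convert h1 using 1
    ext i
    simp only [hook]
    push_cast
    split_ifs <;> omega
  · convert (h2.nsmul m).add h1 using 1
    ext i
    simp only [hook, Pi.add_apply, Pi.smul_apply]
    rw [nsmul_eq_mul]
    push_cast
    split_ifs <;> omega

end Hooks

/-! ### The character of `G` -/

section ChG

variable {K : Type*} [Field K]

/-- The unit `e^{ε_i}` of the fraction field. -/
def fexpU (K : Type*) [Field K] {n : ℕ} (i : Fin n) : (CharField K n)ˣ :=
  Units.map (algebraMap (Laurent K n) (CharField K n) : Laurent K n →* CharField K n) (xU K i)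

theorem val_fexpU_zpow {n : ℕ} (i : Fin n) (m : ℤ) :
    ((fexpU K i ^ m : (CharField K n)ˣ) : CharField K n) = fexp K (m • eps i) := by
  rw [fexpU, ← map_zpow, Units.coe_map]
  change algebraMap (Laurent K n) (CharField K n) _ = _
  rw [val_xU_zpow]
  rfl

theorem val_fexpU {n : ℕ} (i : Fin n) : (fexpU K i : CharField K n) = fexp K (eps i) := rfl

theorem algebraMap_alt {n : ℕ} (l : Fin n → ℤ) :
    algebraMap (Laurent K n) (CharField K n) (alt (xU K) l) = alt (fexpU K) l :=
  map_alt _ _ _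

theorem alt_fexpU_rho_ne_zero (n : ℕ) : alt (fexpU K) (rho n) ≠ 0 := by
  rw [← algebraMap_alt]
  intro h
  rw [map_eq_zero_iff _ (IsFractionRing.injective (Laurent K n) (CharField K n))] at h
  have h1 := coeff_alt_dominant K (rho_strictAnti n) rho_pos (rho_strictAnti n) rho_pos
  rw [h, if_pos rfl] at h1
  simp at h1

theorem alt_rho_mul_chi_hook {N k r : ℕ} (hr : r < 2 * (N + 1)) (hk : r < k) :
    alt (fexpU K) (rho (N + 1)) * chi K (hook (N + 1) k r) =
      alt (fexpU K) (Fin.cons ((k : ℤ) - r + (N + 1)) (rhoOmit N (rbar (N + 1) r))) := by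
  rw [← hook_add_rho, ← algebraMap_alt, ← algebraMap_alt]
  refine alt_rho_mul_chi K (isFDWeight_hook hr hk) (fun i j hij => ?_) fun i => ?_
  · exact add_lt_add_of_le_of_lt (hook_antitone hk hij.le) (rho_strictAnti _ hij)
  · have h1 := hook_nonneg (N := N) hk i
    have h2 := rho_pos i
    rw [Pi.add_apply]
    omega

theorem const_ne_zero (n : ℕ) {q : K} (hq : q ≠ 0) : const n q ≠ 0 := by
  unfold const
  rw [IsScalarTower.algebraMap_apply K (Laurent K n) (CharField K n), Ne,
    map_eq_zero_iff _ (IsFractionRing.injective (Laurent K n) (CharField K n)),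
    AddMonoidAlgebra.coe_algebraMap]
  intro h
  have h1 := congrArg (fun f : Laurent K n => f.coeff 0) h
  simp at h1
  exact hq h1

/-- The nonzero Weyl denominator is cancelled from `alt_rho_mul_G`, with the character formula for r
< k and straightening for r ≥ k. The theorem then only has to sort the terms r ≥ k. -/
theorem ChG_eq_sum [CharZero K] {q : K} (hq : q ≠ 0) (N k : ℕ) :
    ChG (N + 1) q k = (const (N + 1) q ^ k)⁻¹ + ∑ r ∈ Finset.range (2 * (N + 1)),
      (-1) ^ r * const (N + 1) q ^ (2 * ((N + 1 : ℕ) : ℤ) - 2 * (r : ℤ) - 1) *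
        (if r < k then chi K (hook (N + 1) k r) else
          if k = 0 then (-1) ^ r else if k + 2 * N + 1 = 2 * r then -(-1) ^ r else 0) := by
  have hne : ∀ i j : Fin (N + 1), i ≠ j → fexpU K i ≠ fexpU K j := fun i j hij h =>
    hij (eps_injective (fexp_injective (congrArg Units.val h)))
  have hne' : ∀ i j : Fin (N + 1), i ≠ j → fexpU K i ≠ (fexpU K j)⁻¹ := by
    intro i j _ h
    refine fexp_ne_one (K := K) (eps_add_eps_ne_zero i j) ?_
    rw [fexp_add, ← val_fexpU, ← val_fexpU, ← Units.val_mul, h, inv_mul_cancel, Units.val_one]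
  have h := alt_rho_mul_G (Units.mk0 _ (const_ne_zero (N + 1) hq)) (fexpU K)
    (fun i => fexp_ne_one (eps_ne_zero i)) (fun i => fexp_ne_neg_one (eps_ne_zero i)) hne hne' k
  have hG : G ((Units.mk0 _ (const_ne_zero (N + 1) hq) : (CharField K (N + 1))ˣ) :
      CharField K (N + 1))
      (fun a : Idx (N + 1) => ((fexpU K a.1 ^ (a.2 : ℤ) : (CharField K (N + 1))ˣ) :
        CharField K (N + 1))) k = ChG (N + 1) q k := by
    unfold ChG
    congr 1
    ext a
    exact val_fexpU_zpow _ _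
  rw [hG] at h
  rw [← sub_eq_iff_eq_add']
  refine mul_left_cancel₀ (alt_fexpU_rho_ne_zero (K := K) (N + 1)) (Eq.trans h ?_)
  rw [Finset.mul_sum]
  refine Finset.sum_congr rfl fun r hr => ?_
  have hr' : r < 2 * (N + 1) := Finset.mem_range.1 hr
  rw [mul_left_comm, Units.val_zpow_eq_zpow_val, Units.val_mk0]
  congr 1
  by_cases hk : r < k
  · rw [if_pos hk, alt_rho_mul_chi_hook hr' hk]
  · rw [if_neg hk, alt_straighten _ k r hr' (not_lt.1 hk), mul_comm]

end ChG

end TypeB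

end
-- The three cases for k
theorem theorem3p5 {K : Type*} [Field K] [CharZero K] (q : K) (hq : q ≠ 0)
    (n : ℕ) (hn : 2 ≤ n) (k : ℕ) :
    TypeB.ChG n q k =
      if k = 0 then
        1 + ∑ r ∈ Finset.range (2 * n),
          TypeB.const n q ^ (2 * (n : ℤ) - 2 * (r : ℤ) - 1)
      else if Odd k ∧ k ≤ 2 * n - 1 then
        ∑ r ∈ Finset.range k,
          (-1) ^ r * TypeB.const n q ^ (2 * (n : ℤ) - 2 * (r : ℤ) - 1) *
            TypeB.chi K (TypeB.hook n k r)
      else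
        TypeB.const n q ^ (-(k : ℤ)) +
          ∑ r ∈ Finset.range (min (k - 1) (2 * n - 1) + 1),
            (-1) ^ r * TypeB.const n q ^ (2 * (n : ℤ) - 2 * (r : ℤ) - 1) *
              TypeB.chi K (TypeB.hook n k r) := by
  obtain ⟨N, rfl⟩ : ∃ N, n = N + 1 := ⟨n - 1, by omega⟩
  rw [TypeB.ChG_eq_sum hq]
  split_ifs with h0 hodd
  · subst h0
    rw [pow_zero, inv_one]
    congr 1
    refine Finset.sum_congr rfl fun r _ => ?_
    rw [if_neg (Nat.not_lt_zero r), mul_right_comm, ← mul_pow]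
    simp
  · obtain ⟨⟨m, rfl⟩, hk⟩ := hodd
    have hle : 2 * m + 1 ≤ 2 * (N + 1) := by omega
    -- For k = 2m + 1 the only surviving index r ≥ k is the solution m + N + 1 of k + 2N + 1 = 2r.
    -- Its power of q is q^(-k) with sign -1, which cancels the isolated summand.
    rw [← Finset.sum_range_add_sum_Ico _ hle, Finset.sum_eq_single_of_mem (m + N + 1)
      (Finset.mem_Ico.2 ⟨by omega, by omega⟩) (fun r hr hne => ?_)]
    · rw [if_neg (by omega), if_pos (by omega)]
      have h1 : ((-1 : TypeB.CharField K (N + 1)) ^ (m + N + 1)) * (-1) ^ (m + N + 1) = 1 := by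
        rw [← mul_pow]
        simp
      have h2 : 2 * ((N + 1 : ℕ) : ℤ) - 2 * ((m + N + 1 : ℕ) : ℤ) - 1 =
          -((2 * m + 1 : ℕ) : ℤ) := by
        push_cast
        ring
      rw [h2, zpow_neg, zpow_natCast, mul_neg, mul_right_comm, h1, one_mul, add_left_comm,
        add_neg_cancel, add_zero]
      refine Finset.sum_congr rfl fun r hr => ?_
      rw [if_pos (Finset.mem_range.1 hr)]
    · have hr' := Finset.mem_Ico.1 hr
      rw [if_neg (by omega), if_neg (by omega), mul_zero]
  · have hmin : min (k - 1) (2 * (N + 1) - 1) + 1 ≤ 2 * (N + 1) := by omega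
    rw [zpow_neg, zpow_natCast, ← Finset.sum_range_add_sum_Ico _ hmin,
      Finset.sum_eq_zero (s := Finset.Ico _ _) (fun r hr => ?_), add_zero]
    · congr 1
      refine Finset.sum_congr rfl fun r hr => ?_
      have hr' := Finset.mem_range.1 hr
      rw [if_pos (by omega)]
    · have hr' := Finset.mem_Ico.1 hr
      -- A solution r < 2(N + 1) would force k to be odd and at most 2N + 1, the case already
      -- excluded.
      have hodd' : ¬(k + 2 * N + 1 = 2 * r) := by
        intro h
        exact hodd ⟨⟨r - N - 1, by omega⟩, by omega⟩
      rw [if_neg (by omega), if_neg hodd', mul_zero]
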